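/- Let $p$ be a prime and $n\ge 2$. Let $\mathcal A_p$ be the algebra of Steenrod $p$th powers, i.e. the $\mathbb F_p$-algebra generated by elements $P^r$ ($r\ge 0$) subject to $P^0=1$ and the Adem relations $$P^aP^b=\sum_{j=0}^{\lfloor a/p\rfloor}(-1)^{a+j}\binom{(p-1)(b-j)-1}{a-pj}P^{a+b-j}P^j\qquad(a<pb).$$ It is a Hopf algebra with coproduct $P^r\mapsto\sum_{i+j=r}P^i\otimes P^j$, and it acts faithfully on $\mathbb F_p[x_0,x_1,\dots]$, with $P^r(f)$ the coefficient of $u^r$ in $f(x_0+ux_0^p,x_1+ux_1^p,\dots)$. For $s\ge 0$, $t\ge 1$ let $P^s_t$ be the Milnor basis element $P(0,\dots,0,p^s)$, with $p^s$ in position $t$; it acts by sending $f$ to the coefficient of $u^{p^s}$ in $f(x_0+ux_0^{p^t},x_1+ux_1^{p^t},\dots)$. Let $\mathcal A_p(n-2)$ be the subalgebra of $\mathcal A_p$ generated by $P^{p^i}$, $0\le i\le n-2$; it is a Hopf subalgebra. Filter it by the powers of its augmentation ideal; this filtration coincides with the one induced by the May filtration of $\mathcal A_p$ (the powers of the augmentation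 ideal of $\mathcal A_p$). Let $U(n)$ be the group of upper unitriangular $n\times n$ matrices over $\mathbb F_p$, and filter the group algebra $\mathbb F_pU(n)$, a Hopf algebra with $g\mapsto g\otimes g$ for $g\in U(n)$, by the powers of its augmentation ideal. For a Hopf algebra $A$ with augmentation ideal $I$, let $E^0(A)=\bigoplus_{k\ge 0}I^k/I^{k+1}$ (where $I^0=A$), with the induced graded Hopf algebra structure. Then there is an isomorphism of graded Hopf algebras $$E^0(\mathbb F_pU(n))\;\cong\;E^0(\mathcal A_p(n-2)).$$ For $1\le i<j\le n$, let $E_{i,j}\in U(n)$ be the identity matrix with its $(i,j)$ entry changed to $1$. Then $1-E_{i,j}$ lies in the $(j-i)$th power of the augmentation ideal of $\mathbb F_pU(n)$, and the classes of the elements $1-E_{i,j}$ in degree $j-i$ generate $E^0(\mathbb F_pU(n))$. For all such $i,j$, with $s=i-1$ and $t=j-i$, the element $P^s_t$ lies in the $t$th power of the augmentation ideal of $\mathcal A_p(n-2)$, and the isomorphism can be chosen so that, for all such $i,j$ simultaneously, it sends the class of $1-E_{i,j}$ to the class of $P^s_t$ in degree $t$. -/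

import Mathlib

open scoped TensorProduct DirectSum

noncomputable section

/-! ### Hopf algebra structures on a given algebra -/

/-- A Hopf algebra structure on a fixed `k`-algebra `A`. This is the data of Mathlib's
`HopfAlgebra k A` over the already given algebra structure
(see `HopfStructure.toHopfAlgebra` and `HopfStructure.ofHopfAlgebra`). -/
structure HopfStructure (k A : Type*) [CommRing k] [Ring A] [Algebra k A] where
  /-- the coproduct -/
  comul : A →ₐ[k] A ⊗[k] A
  /-- the counit, or augmentation -/
  counit : A →ₐ[k] k
  /-- the antipode -/
  antipode : A →ₗ[k] A
  coassoc : (Algebra.TensorProduct.assoc k k k A A A).toAlgHom.comp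
      ((Algebra.TensorProduct.map comul (.id k A)).comp comul)
      = (Algebra.TensorProduct.map (.id k A) comul).comp comul
  counit_left : (Algebra.TensorProduct.map counit (.id k A)).comp comul
      = (Algebra.TensorProduct.lid k A).symm
  counit_right : (Algebra.TensorProduct.map (.id k A) counit).comp comul
      = (Algebra.TensorProduct.rid k k A).symm
  antipode_left : LinearMap.mul' k A ∘ₗ antipode.rTensor A ∘ₗ comul.toLinearMap
      = Algebra.linearMap k A ∘ₗ counit.toLinearMap
  antipode_right : LinearMap.mul' k A ∘ₗ antipode.lTensor A ∘ₗ comul.toLinearMap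
      = Algebra.linearMap k A ∘ₗ counit.toLinearMap

namespace HopfStructure

/-- A `HopfStructure` gives a Hopf algebra in the sense of Mathlib. -/
abbrev toHopfAlgebra {k A : Type*} [CommRing k] [Ring A] [Algebra k A]
    (H : HopfStructure k A) : HopfAlgebra k A :=
  { Bialgebra.ofAlgHom H.comul H.counit H.coassoc H.counit_left H.counit_right with
    antipode := H.antipode
    mul_antipode_rTensor_comul := H.antipode_left
    mul_antipode_lTensor_comul := H.antipode_right }

/-- The structure maps of a Hopf algebra in the sense of Mathlib. -/
def ofHopfAlgebra (k A : Type*) [CommRing k] [Ring A] [HopfAlgebra k A] : HopfStructure k A where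
  comul := Bialgebra.comulAlgHom k A
  counit := Bialgebra.counitAlgHom k A
  antipode := HopfAlgebra.antipode k
  coassoc := by
    apply AlgHom.toLinearMap_injective
    exact Coalgebra.coassoc
  counit_left := by
    apply AlgHom.toLinearMap_injective
    exact Coalgebra.rTensor_counit_comp_comul
  counit_right := by
    apply AlgHom.toLinearMap_injective
    exact Coalgebra.lTensor_counit_comp_comul
  antipode_left := HopfAlgebra.mul_antipode_rTensor_comul
  antipode_right := HopfAlgebra.mul_antipode_lTensor_comul

/-- The algebra map `f` is a morphism of Hopf algebras. -/
def IsHom {k A B : Type*} [CommRing k] [Ring A] [Algebra k A] [Ring B] [Algebra k B]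
    (H : HopfStructure k A) (K : HopfStructure k B) (f : A →ₐ[k] B) : Prop :=
  (∀ x, Algebra.TensorProduct.map f f (H.comul x) = K.comul (f x)) ∧
  (∀ x, H.counit x = K.counit (f x)) ∧
  (∀ x, f (H.antipode x) = K.antipode (f x))

end HopfStructure

/-! ### The graded algebra of the augmentation ideal filtration -/

section Graded

variable {k A : Type*} [CommRing k] [Ring A] [Algebra k A]

/-- The `j`th power of the augmentation ideal `ker ε`, the zeroth power being `A`. -/
def augFiltration (ε : A →ₐ[k] k) (j : ℕ) : Submodule k A :=
  ((RingHom.ker ε : Ideal A) ^ j).restrictScalars k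

theorem mem_augFiltration {ε : A →ₐ[k] k} {j : ℕ} {x : A} :
    x ∈ augFiltration ε j ↔ x ∈ (RingHom.ker ε : Ideal A) ^ j := Iff.rfl

theorem augFiltration_zero_eq_top (ε : A →ₐ[k] k) (x : A) : x ∈ augFiltration ε 0 := by
  rw [mem_augFiltration, Submodule.pow_zero, Ideal.one_eq_top]
  trivial

theorem augFiltration_mul_mem {ε : A →ₐ[k] k} {i j : ℕ} {x y : A}
    (hx : x ∈ augFiltration ε i) (hy : y ∈ augFiltration ε j) :
    x * y ∈ augFiltration ε (i + j) := by
  rw [mem_augFiltration] at *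
  rw [Ideal.IsTwoSided.pow_add]
  exact Ideal.mul_mem_mul hx hy

/-- The quotient `I ^ j / I ^ (j + 1)`, where `I = ker ε`. -/
def grPiece (ε : A →ₐ[k] k) (j : ℕ) : Type _ :=
  augFiltration ε j ⧸ (augFiltration ε (j + 1)).submoduleOf (augFiltration ε j)

instance grPieceAddCommGroup (ε : A →ₐ[k] k) (j : ℕ) : AddCommGroup (grPiece ε j) :=
  inferInstanceAs (AddCommGroup
    (augFiltration ε j ⧸ (augFiltration ε (j + 1)).submoduleOf (augFiltration ε j)))

instance grPieceModule (ε : A →ₐ[k] k) (j : ℕ) : Module k (grPiece ε j) :=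
  inferInstanceAs (Module k
    (augFiltration ε j ⧸ (augFiltration ε (j + 1)).submoduleOf (augFiltration ε j)))

/-- The coset `x + I ^ (j + 1)` of `x ∈ I ^ j`. -/
def grMk (ε : A →ₐ[k] k) (j : ℕ) : augFiltration ε j →ₗ[k] grPiece ε j :=
  Submodule.mkQ ((augFiltration ε (j + 1)).submoduleOf (augFiltration ε j))

theorem grMk_surjective (ε : A →ₐ[k] k) (j : ℕ) : Function.Surjective (grMk ε j) :=
  Submodule.mkQ_surjective _

theorem grMk_eq_zero (ε : A →ₐ[k] k) {j : ℕ} (x : augFiltration ε j)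
    (hx : (x : A) ∈ augFiltration ε (j + 1)) : grMk ε j x = 0 := by
  exact (Submodule.Quotient.mk_eq_zero _).2 hx

/-- The product `I ^ i × I ^ j → I ^ (i + j) / I ^ (i + j + 1)`. -/
def grMulAux (ε : A →ₐ[k] k) (i j : ℕ) :
    augFiltration ε i →ₗ[k] augFiltration ε j →ₗ[k] grPiece ε (i + j) :=
  LinearMap.mk₂ k (fun x y => grMk ε (i + j) ⟨(x : A) * y, augFiltration_mul_mem x.2 y.2⟩)
    (fun x x' y => by
      rw [← map_add]; congr 1; ext; simp [add_mul])
    (fun c x y => by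
      rw [← map_smul]; congr 1; ext; simp)
    (fun x y y' => by
      rw [← map_add]; congr 1; ext; simp [mul_add])
    (fun c x y => by
      rw [← map_smul]; congr 1; ext; simp)

/-- The product of cosets, `(x + I ^ (i + 1)) (y + I ^ (j + 1)) = x y + I ^ (i + j + 1)`. -/
def grMul (ε : A →ₐ[k] k) (i j : ℕ) :
    grPiece ε i →ₗ[k] grPiece ε j →ₗ[k] grPiece ε (i + j) :=
  Submodule.liftQ _
    (LinearMap.flip (Submodule.liftQ _ (grMulAux ε i j).flip (by
      intro y hy
      rw [LinearMap.mem_ker]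
      ext x
      refine grMk_eq_zero ε _ ?_
      have := augFiltration_mul_mem x.2 (show (y : A) ∈ augFiltration ε (j + 1) from hy)
      rwa [← add_assoc] at this)))
    (by
      intro x hx
      rw [LinearMap.mem_ker]
      refine LinearMap.ext fun y => ?_
      obtain ⟨y, rfl⟩ := grMk_surjective ε j y
      refine grMk_eq_zero ε _ ?_
      have := augFiltration_mul_mem (show (x : A) ∈ augFiltration ε (i + 1) from hx) y.2
      rwa [add_right_comm] at this)

theorem grMul_mk (ε : A →ₐ[k] k) (i j : ℕ) (x : augFiltration ε i) (y : augFiltration ε j) :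
    grMul ε i j (grMk ε i x) (grMk ε j y)
      = grMk ε (i + j) ⟨(x : A) * y, augFiltration_mul_mem x.2 y.2⟩ := rfl

theorem grMk_congr (ε : A →ₐ[k] k) {i j : ℕ} (h : i = j) (x : augFiltration ε i)
    (y : augFiltration ε j) (hxy : (x : A) = y) :
    (GradedMonoid.mk i (grMk ε i x) : GradedMonoid (grPiece ε))
      = GradedMonoid.mk j (grMk ε j y) := by
  subst h
  have : x = y := Subtype.ext hxy
  rw [this]

instance grGMul (ε : A →ₐ[k] k) : GradedMonoid.GMul (grPiece ε) where
  mul {i j} x y := grMul ε i j x y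

instance grGOne (ε : A →ₐ[k] k) : GradedMonoid.GOne (grPiece ε) where
  one := grMk ε 0 ⟨1, augFiltration_zero_eq_top ε 1⟩

instance grGRing (ε : A →ₐ[k] k) : DirectSum.GRing (grPiece ε) where
  mul_zero {i j} x := map_zero (grMul ε i j x)
  zero_mul {i j} y := LinearMap.map_zero₂ (grMul ε i j) y
  mul_add {i j} x y z := map_add (grMul ε i j x) y z
  add_mul {i j} x y z := LinearMap.map_add₂ (grMul ε i j) x y z
  one_mul := by
    rintro ⟨i, x⟩
    obtain ⟨x, rfl⟩ := grMk_surjective ε i x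
    exact grMk_congr ε (zero_add i) _ _ (one_mul _)
  mul_one := by
    rintro ⟨i, x⟩
    obtain ⟨x, rfl⟩ := grMk_surjective ε i x
    exact grMk_congr ε (add_zero i) _ _ (mul_one _)
  mul_assoc := by
    rintro ⟨i, x⟩ ⟨j, y⟩ ⟨l, z⟩
    obtain ⟨x, rfl⟩ := grMk_surjective ε i x
    obtain ⟨y, rfl⟩ := grMk_surjective ε j y
    obtain ⟨z, rfl⟩ := grMk_surjective ε l z
    exact grMk_congr ε (add_assoc i j l) _ _ (mul_assoc _ _ _)
  natCast m := grMk ε 0 ⟨(m : A), augFiltration_zero_eq_top ε _⟩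
  natCast_zero := by
    apply grMk_eq_zero
    simp
  natCast_succ m := by
    change _ = grMk ε 0 _ + grMk ε 0 _
    rw [← map_add]
    congr 1
    ext
    simp
  intCast m := grMk ε 0 ⟨(m : A), augFiltration_zero_eq_top ε _⟩
  intCast_ofNat m := by
    change grMk ε 0 _ = grMk ε 0 _
    congr 1
    ext
    simp
  intCast_negSucc_ofNat m := by
    change grMk ε 0 _ = - grMk ε 0 _
    rw [← map_neg]
    congr 1
    ext
    simp

instance grGAlgebra (ε : A →ₐ[k] k) : DirectSum.GAlgebra k (grPiece ε) where
  toFun := ((grMk ε 0).comp ((Algebra.linearMap k A).codRestrict _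
    (fun r => augFiltration_zero_eq_top ε _))).toAddMonoidHom
  map_one := by
    change grMk ε 0 _ = grMk ε 0 _
    congr 1
    ext
    simp
  map_mul r s := by
    refine grMk_congr ε (add_zero 0).symm _ _ ?_
    simp
  commutes := by
    rintro r ⟨i, x⟩
    obtain ⟨x, rfl⟩ := grMk_surjective ε i x
    exact grMk_congr ε (add_comm 0 i) _ _ (Algebra.commutes r (x : A))
  smul_def := by
    rintro r ⟨i, x⟩
    obtain ⟨x, rfl⟩ := grMk_surjective ε i x
    exact grMk_congr ε (zero_add i).symm (r • x) _ (Algebra.smul_def r (x : A))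

/-- The graded algebra `⨁ j, I ^ j / I ^ (j + 1)`, where `I = ker ε`. -/
def E0 (ε : A →ₐ[k] k) : Type _ := ⨁ j : ℕ, grPiece ε j

instance E0.instRing (ε : A →ₐ[k] k) : Ring (E0 ε) :=
  inferInstanceAs (Ring (⨁ j : ℕ, grPiece ε j))

instance E0.instAlgebra (ε : A →ₐ[k] k) : Algebra k (E0 ε) :=
  inferInstanceAs (Algebra k (⨁ j : ℕ, grPiece ε j))

/-- The inclusion of the homogeneous elements of degree `j`. -/
def E0.lof (ε : A →ₐ[k] k) (j : ℕ) : grPiece ε j →ₗ[k] E0 ε :=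
  DirectSum.lof k ℕ (grPiece ε) j

/-- The element of degree `j` of `E0 ε` represented by `x ∈ I ^ j`. -/
def E0.cls (ε : A →ₐ[k] k) (j : ℕ) (x : augFiltration ε j) : E0 ε :=
  E0.lof ε j (grMk ε j x)

theorem E0.cls_mul (ε : A →ₐ[k] k) (i j : ℕ) (x : augFiltration ε i) (y : augFiltration ε j) :
    E0.cls ε i x * E0.cls ε j y
      = E0.cls ε (i + j) ⟨(x : A) * y, augFiltration_mul_mem x.2 y.2⟩ :=
  DirectSum.of_mul_of (A := grPiece ε) _ _

/-- The homogeneous component of degree `j` of `E0 ε`. -/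
def E0.component (ε : A →ₐ[k] k) (j : ℕ) : Submodule k (E0 ε) :=
  LinearMap.range (E0.lof ε j)

/-- `G` is the Hopf algebra structure on the graded algebra `E0` induced by the Hopf algebra
structure `H` on `A`. Let `I` be the augmentation ideal and `x ∈ I ^ j`. The coproduct of `x` is
a sum of tensors `y ⊗ z` with `y ∈ I ^ a`, `z ∈ I ^ b` and `a + b = j`, and for every such
expression the coproduct of the class of `x` is the sum of the tensors of the classes of `y` and
`z`. The counit is that of `A` in degree `0` and vanishes in positive degrees, and the antipode of
the class of `x` is the class of the antipode of `x`. -/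
def HopfStructure.IsInduced (H : HopfStructure k A) (G : HopfStructure k (E0 H.counit)) : Prop :=
  (∀ (j : ℕ) (x : augFiltration H.counit j), ∃ (N : ℕ) (a b : Fin N → ℕ)
    (y : ∀ i, augFiltration H.counit (a i)) (z : ∀ i, augFiltration H.counit (b i)),
    (∀ i, a i + b i = j) ∧ H.comul x = ∑ i, (y i : A) ⊗ₜ[k] (z i : A)) ∧
  (∀ (j : ℕ) (x : augFiltration H.counit j) (N : ℕ) (a b : Fin N → ℕ)
    (y : ∀ i, augFiltration H.counit (a i)) (z : ∀ i, augFiltration H.counit (b i)),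
    (∀ i, a i + b i = j) → H.comul x = ∑ i, (y i : A) ⊗ₜ[k] (z i : A) →
    G.comul (E0.cls H.counit j x)
      = ∑ i, E0.cls H.counit (a i) (y i) ⊗ₜ[k] E0.cls H.counit (b i) (z i)) ∧
  (∀ x : augFiltration H.counit 0, G.counit (E0.cls H.counit 0 x) = H.counit x) ∧
  (∀ (j : ℕ) (x : augFiltration H.counit j), 0 < j → G.counit (E0.cls H.counit j x) = 0) ∧
  (∀ (j : ℕ) (x : augFiltration H.counit j), ∃ h : H.antipode x ∈ augFiltration H.counit j,
    G.antipode (E0.cls H.counit j x) = E0.cls H.counit j ⟨H.antipode x, h⟩)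

end Graded

/-! ### The algebra of Steenrod `p`th powers -/

/-- The defining relations `P ^ 0 = 1` and the Adem relations, where the generator `P ^ r` of the
free algebra is `FreeAlgebra.ι _ r`. -/
inductive AdemRel (p : ℕ) : FreeAlgebra (ZMod p) ℕ → FreeAlgebra (ZMod p) ℕ → Prop
  | zero : AdemRel p (FreeAlgebra.ι (ZMod p) 0) 1
  | adem (a b : ℕ) (h : a < p * b) :
      AdemRel p (FreeAlgebra.ι (ZMod p) a * FreeAlgebra.ι (ZMod p) b)
        (∑ j ∈ Finset.range (a / p + 1),
          ((-1) ^ (a + j) * (((p - 1) * (b - j) - 1).choose (a - p * j) : ZMod p)) •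
            (FreeAlgebra.ι (ZMod p) (a + b - j) * FreeAlgebra.ι (ZMod p) j))

/-- The algebra of Steenrod `p`th powers over `𝔽_p`, generated by the `P ^ r` subject to the
relation `P ^ 0 = 1` and the Adem relations. -/
def SteenrodPowers (p : ℕ) : Type := RingQuot (AdemRel p)

instance SteenrodPowers.instRing (p : ℕ) : Ring (SteenrodPowers p) :=
  inferInstanceAs (Ring (RingQuot (AdemRel p)))

instance SteenrodPowers.instAlgebra (p : ℕ) : Algebra (ZMod p) (SteenrodPowers p) :=
  inferInstanceAs (Algebra (ZMod p) (RingQuot (AdemRel p)))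

/-- The element `P ^ r`. -/
def steenrodP (p r : ℕ) : SteenrodPowers p :=
  RingQuot.mkAlgHom (ZMod p) (AdemRel p) (FreeAlgebra.ι (ZMod p) r)

/-- The subalgebra generated by the elements `P ^ (p ^ i)` for `0 ≤ i ≤ m`. -/
def steenrodSub (p m : ℕ) : Subalgebra (ZMod p) (SteenrodPowers p) :=
  Algebra.adjoin (ZMod p) {x | ∃ i ≤ m, x = steenrodP p (p ^ i)}

/-- The operation by which the Milnor basis element `P(0, …, 0, r)`, with `r` in position `t`,
acts on the polynomial ring over `𝔽_p` in the variables `x_0, x_1, …`: the coefficient of `u ^ r`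
in the total operation, the multiplicative map with `x ↦ x + u x ^ (p ^ t)` for every variable `x`.
For `t = 1` this is the operation `P ^ r`. -/
def milnorOp (p t r : ℕ) : Module.End (ZMod p) (MvPolynomial ℕ (ZMod p)) :=
  ((Polynomial.lcoeff (MvPolynomial ℕ (ZMod p)) r).restrictScalars (ZMod p)).comp
    (MvPolynomial.aeval (R := ZMod p) (fun i : ℕ =>
      Polynomial.C (MvPolynomial.X i : MvPolynomial ℕ (ZMod p)) +
        Polynomial.X * Polynomial.C (MvPolynomial.X i ^ (p ^ t)))).toLinearMap

/-! ### The group of upper unitriangular matrices -/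

/-- The condition that a matrix is upper unitriangular. -/
def IsUnitriangular {p n : ℕ} (M : Matrix (Fin n) (Fin n) (ZMod p)) : Prop :=
  (∀ i j, j < i → M i j = 0) ∧ ∀ i, M i i = 1

theorem IsUnitriangular.mul {p n : ℕ} {M N : Matrix (Fin n) (Fin n) (ZMod p)}
    (hM : IsUnitriangular M) (hN : IsUnitriangular N) : IsUnitriangular (M * N) := by
  constructor
  · intro i j hij
    rw [Matrix.mul_apply]
    refine Finset.sum_eq_zero fun l _ => ?_
    rcases lt_or_ge l i with h | h
    · rw [hM.1 i l h, zero_mul]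
    · rw [hN.1 l j (lt_of_lt_of_le hij h), mul_zero]
  · intro i
    rw [Matrix.mul_apply, Finset.sum_eq_single i]
    · rw [hM.2, hN.2, one_mul]
    · intro l _ hl
      rcases lt_or_gt_of_ne hl with h | h
      · rw [hM.1 i l h, zero_mul]
      · rw [hN.1 l i h, mul_zero]
    · intro h
      exact absurd (Finset.mem_univ i) h

theorem IsUnitriangular.one {p n : ℕ} :
    IsUnitriangular (1 : Matrix (Fin n) (Fin n) (ZMod p)) :=
  ⟨fun _ _ h => Matrix.one_apply_ne h.ne', fun _ => Matrix.one_apply_eq _⟩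

/-- The group `U(n)` of upper unitriangular `n × n` matrices over `𝔽_p`. -/
def unitriangularGroup (p n : ℕ) : Subgroup (Matrix (Fin n) (Fin n) (ZMod p))ˣ where
  carrier := {g | IsUnitriangular (g : Matrix (Fin n) (Fin n) (ZMod p))}
  mul_mem' {g h} hg hh := by
    change IsUnitriangular ((g * h : (Matrix (Fin n) (Fin n) (ZMod p))ˣ) :
      Matrix (Fin n) (Fin n) (ZMod p))
    rw [Units.val_mul]
    exact IsUnitriangular.mul hg hh
  one_mem' := IsUnitriangular.one
  inv_mem' {g} hg := by
    have hB : Matrix.BlockTriangular (g : Matrix (Fin n) (Fin n) (ZMod p)) id :=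
      fun i j h => hg.1 i j h
    let _ : Invertible (g : Matrix (Fin n) (Fin n) (ZMod p)) := g.invertible
    have hI : ∀ i j, j < i →
        ((g⁻¹ : (Matrix (Fin n) (Fin n) (ZMod p))ˣ) : Matrix (Fin n) (Fin n) (ZMod p)) i j = 0 := by
      intro i j h
      rw [Matrix.coe_units_inv]
      exact Matrix.blockTriangular_inv_of_blockTriangular hB h
    refine ⟨hI, fun i => ?_⟩
    have h1 := congrFun (congrFun g.mul_inv i) i
    rw [Matrix.mul_apply, Finset.sum_eq_single i, hg.2, one_mul, Matrix.one_apply_eq] at h1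
    · exact h1
    · intro l _ hl
      rcases lt_or_gt_of_ne hl with h | h
      · rw [hg.1 i l h, zero_mul]
      · rw [hI l i h, mul_zero]
    · intro h
      exact absurd (Finset.mem_univ i) h

/-- The elementary matrix `E_{i,j}`, with an additional entry `1` in position `(i, j)`. -/
def elemUnitriangular (p : ℕ) {n : ℕ} {i j : Fin n} (h : i < j) : unitriangularGroup p n :=
  ⟨⟨Matrix.transvection i j 1, Matrix.transvection i j (-1),
      by rw [Matrix.transvection_mul_transvection_same _ _ h.ne]; simp,
      by rw [Matrix.transvection_mul_transvection_same _ _ h.ne]; simp⟩, by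
    constructor
    · intro a b hab
      have h2 : ¬ (i = a ∧ j = b) := by
        rintro ⟨rfl, rfl⟩
        exact absurd hab h.asymm
      simp [Matrix.transvection, hab.ne', h2]
    · intro a
      have h2 : ¬ (i = a ∧ j = a) := by
        rintro ⟨rfl, rfl⟩
        exact lt_irrefl _ h
      simp [Matrix.transvection, h2]⟩

/-- The group algebra `𝔽_p U(n)`. -/
abbrev UGroupAlgebra (p n : ℕ) : Type := MonoidAlgebra (ZMod p) (unitriangularGroup p n)

/-- The Hopf algebra structure of the group algebra, with coproduct `g ↦ g ⊗ g`. -/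
abbrev UHopf (p n : ℕ) : HopfStructure (ZMod p) (UGroupAlgebra p n) :=
  HopfStructure.ofHopfAlgebra (ZMod p) (UGroupAlgebra p n)

/-- The element `f = 1 - E_{i,j}` of the group algebra. -/
def fElem (p : ℕ) {n : ℕ} {i j : Fin n} (h : i < j) : UGroupAlgebra p n :=
  1 - MonoidAlgebra.of (ZMod p) (unitriangularGroup p n) (elemUnitriangular p h)

end

/-! Both algebras are dual to a commutative algebra generated by the entries of a generic upper
unitriangular matrix. For the group algebra it is the algebra of functions on `U(n)`, with the
entries of the inverse matrix as coordinates. For `A_p(n-2)` it is the quotient of Milnor's dual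
`F_p[ξ_1, ξ_2, …]` by the powers `ξ_t ^ (p ^ (n - t))`, with `ξ_{b-a} ^ (p ^ a)` as entry `(a, b)`,
rows and columns being counted from `0`. Give entry `(a, b)` the weight `b - a`. In both cases the
augmentation ideal lowers the weight filtration by one. The generators `1 - E_{i,i+1}` and `P^(p^i)`
act to leading order as the same derivation, which replaces column `i + 1` by column `i`. The `p`th
power of a coordinate has weight less than `p` times that of the coordinate: it is the coordinate
itself for the group, and the next entry on the same diagonal, or zero, for the Steenrod algebra.
`RootModel` collects these properties; the rest of the comparison uses nothing else.

The decisive fact is `mem_powerIdeal_of_wordDer`: a homogeneous polynomial killed by all composites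
of these derivations has no monomial with all exponents below `p`, so its image has smaller weight.
Hence the powers of the augmentation ideal and the steps of the weight filtration are annihilators
of each other (`mem_augFiltration_iff`). The associated graded algebra is then the free algebra on
the simple roots modulo the kernel of a pairing with polynomials that is computed by the derivations
alone. This quotient is the same for both algebras, which gives the isomorphism (`exists_algEquiv`).
It respects the Hopf structures automatically, because classes of degree one are primitive and
generate (`gr_isHom`). It matches `1 - E_{i,j}` with `P^s_t` because both are dual to the coordinate
`(i, j)` among monomials of weight at most `j - i`.

The Steenrod side must be derived from the presentation. The Bullett–Macdonald identity gives the
Adem relations for the action on polynomials and for the right action on the dual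
(`adem_of_bullettMacdonald`). Admissible monomials span and pair triangularly with monomials in the
`ξ_k`, so the pairing separates elements (`eq_zero_of_pair`). This yields the coproduct, the
faithfulness of the action and the identification of `P^s_t` by its pairing. Comparing weight
filtrations shows that the augmentation filtration of the subalgebra is induced from the whole
algebra. -/

noncomputable section

/-! ### Antipodes -/

section Antipode

open WithConv

/-- `f ∘ S` is a left and `S ∘ f` a right convolution inverse of `f`, so the two coincide. -/
theorem HopfAlgebra.map_antipode_of_bialgHom {k A B : Type*} [CommRing k] [Ring A] [Ring B]
    [HopfAlgebra k A] [HopfAlgebra k B] (f : A →ₐc[k] B) (x : A) :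
    f (HopfAlgebra.antipode k x) = HopfAlgebra.antipode k (f x) := by
  let F : WithConv (A →ₗ[k] B) := toConv ((f : A →ₐ[k] B).toLinearMap)
  let U : WithConv (A →ₗ[k] B) :=
    toConv ((f : A →ₐ[k] B).toLinearMap.comp (HopfAlgebra.antipode k))
  let V : WithConv (A →ₗ[k] B) :=
    toConv ((HopfAlgebra.antipode k).comp (f : A →ₐ[k] B).toLinearMap)
  have h1 : U * F = 1 := by
    have := LinearMap.algHom_comp_convMul_distrib (f : A →ₐ[k] B)
      (toConv (HopfAlgebra.antipode k (A := A))) (toConv LinearMap.id)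
    rw [LinearMap.antipode_mul_id] at this
    apply ofConv_injective
    refine Eq.trans this.symm ?_
    ext x
    exact (f : A →ₐ[k] B).commutes _
  have h2 : F * V = 1 := by
    have := LinearMap.convMul_comp_coalgHom_distrib (toConv LinearMap.id)
      (toConv (HopfAlgebra.antipode k (A := B))) (f : A →ₗc[k] B)
    rw [LinearMap.id_mul_antipode] at this
    apply ofConv_injective
    refine Eq.trans this.symm ?_
    ext x
    simp [LinearMap.convOne_def]
  have h3 : U = V := left_inv_eq_right_inv h1 h2
  exact congrArg (fun W : WithConv (A →ₗ[k] B) => W.ofConv x) h3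

/-- The convolution difference between the unit `η ε` and the identity. -/
def unitSubId (k A : Type*) [CommRing k] [Ring A] [Bialgebra k A] : WithConv (A →ₗ[k] A) :=
  1 - toConv LinearMap.id

/-- With `ν = ηε - id`, the convolution inverse of `id = 1 - ν` is the geometric series in `ν`. It
is a finite sum on every element. -/
theorem exists_antipode_of_nilpotent {k A : Type*} [CommRing k] [Ring A] [Bialgebra k A]
    (h : ∀ x : A, ∃ n, ∀ m, n ≤ m → (unitSubId k A ^ m) x = 0) :
    ∃ S : A →ₗ[k] A,
      LinearMap.mul' k A ∘ₗ S.rTensor A ∘ₗ Coalgebra.comul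
        = Algebra.linearMap k A ∘ₗ Coalgebra.counit ∧
      LinearMap.mul' k A ∘ₗ S.lTensor A ∘ₗ Coalgebra.comul
        = Algebra.linearMap k A ∘ₗ Coalgebra.counit := by
  choose N hN using h
  set ν := unitSubId k A with hν
  -- The truncation may be taken at any bound beyond `N x`; taking a common bound for several
  -- elements makes the truncated sum linear.
  have key : ∀ x : A, ∀ M, N x ≤ M →
      (∑ i ∈ Finset.range M, (ν ^ i) x) = ∑ i ∈ Finset.range (N x), (ν ^ i) x := by
    intro x M hM
    symm
    refine Finset.sum_subset (Finset.range_mono hM) fun i _ hi => hN x i ?_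
    simpa using hi
  let S : A →ₗ[k] A :=
    { toFun := fun x => ∑ i ∈ Finset.range (N x), (ν ^ i) x
      map_add' := by
        intro x y
        have hx := key x (max (N x) (max (N y) (N (x + y)))) (le_max_left _ _)
        have hy := key y (max (N x) (max (N y) (N (x + y))))
          (le_trans (le_max_left _ _) (le_max_right _ _))
        have hxy := key (x + y) (max (N x) (max (N y) (N (x + y))))
          (le_trans (le_max_right _ _) (le_max_right _ _))
        rw [← hx, ← hy, ← hxy, ← Finset.sum_add_distrib]
        exact Finset.sum_congr rfl fun i _ => map_add (ν ^ i).ofConv x y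
      map_smul' := by
        intro c x
        have hx := key x (max (N x) (N (c • x))) (le_max_left _ _)
        have hcx := key (c • x) (max (N x) (N (c • x))) (le_max_right _ _)
        rw [← hx, ← hcx, RingHom.id_apply, Finset.smul_sum]
        exact Finset.sum_congr rfl fun i _ => map_smul (ν ^ i).ofConv c x }
  have hS : ∀ x M, N x ≤ M → S x = (∑ i ∈ Finset.range M, ν ^ i : WithConv (A →ₗ[k] A)) x := by
    intro x M hM
    have := key x M hM
    rw [show S x = _ from this.symm]
    induction M with
    | zero => rfl
    | succ M ih =>
      clear ih this hM
      induction (M + 1) with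
      | zero => rfl
      | succ M ih => rw [Finset.sum_range_succ, Finset.sum_range_succ, ih]; rfl
  have hid : (toConv LinearMap.id : WithConv (A →ₗ[k] A)) = 1 - ν := by
    rw [hν, unitSubId]; abel
  refine ⟨S, ?_, ?_⟩
  · ext x
    let R := Coalgebra.Repr.arbitrary k x
    obtain ⟨M, hM⟩ : ∃ M, N x ≤ M ∧ ∀ i ∈ R.index, N (R.left i) ≤ M :=
      ⟨max (N x) (R.index.sup fun i => N (R.left i)), le_max_left _ _, fun i hi =>
        le_trans (Finset.le_sup (f := fun i => N (R.left i)) hi) (le_max_right _ _)⟩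
    have h1 : (toConv S * toConv LinearMap.id : WithConv (A →ₗ[k] A)) x
        = ((∑ i ∈ Finset.range M, ν ^ i) * toConv LinearMap.id : WithConv (A →ₗ[k] A)) x := by
      rw [R.convMul_apply, R.convMul_apply]
      exact Finset.sum_congr rfl fun i hi => by
        change S (R.left i) * _ = _
        rw [hS _ M (hM.2 i hi)]
    rw [hid, geom_sum_mul_neg] at h1
    have h2 : (ν ^ M) x = 0 := hN x M hM.1
    have h3 : (1 - ν ^ M : WithConv (A →ₗ[k] A)) x = (1 : WithConv (A →ₗ[k] A)) x - (ν ^ M) x := rfl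
    rw [h3, h2, sub_zero, ← hid] at h1
    exact h1
  · ext x
    let R := Coalgebra.Repr.arbitrary k x
    obtain ⟨M, hM⟩ : ∃ M, N x ≤ M ∧ ∀ i ∈ R.index, N (R.right i) ≤ M :=
      ⟨max (N x) (R.index.sup fun i => N (R.right i)), le_max_left _ _, fun i hi =>
        le_trans (Finset.le_sup (f := fun i => N (R.right i)) hi) (le_max_right _ _)⟩
    have h1 : (toConv LinearMap.id * toConv S : WithConv (A →ₗ[k] A)) x
        = (toConv LinearMap.id * (∑ i ∈ Finset.range M, ν ^ i) : WithConv (A →ₗ[k] A)) x := by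
      rw [R.convMul_apply, R.convMul_apply]
      exact Finset.sum_congr rfl fun i hi => by
        change _ * S (R.right i) = _
        rw [hS _ M (hM.2 i hi)]
    rw [hid, mul_neg_geom_sum] at h1
    have h2 : (ν ^ M) x = 0 := hN x M hM.1
    have h3 : (1 - ν ^ M : WithConv (A →ₗ[k] A)) x = (1 : WithConv (A →ₗ[k] A)) x - (ν ^ M) x := rfl
    rw [h3, h2, sub_zero, ← hid] at h1
    exact h1

/-- `ηε - id` vanishes on `C 0`, so every factor of the convolution power uses up at least one
degree. -/
theorem unitSubId_pow_eq_zero {k A : Type*} [CommRing k] [Ring A] [Bialgebra k A]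
    (C : ℕ → Submodule k A)
    (h0 : ∀ x ∈ C 0, x = algebraMap k A (Coalgebra.counit x))
    (hC : ∀ d, ∀ x ∈ C d, Coalgebra.comul (R := k) x ∈ Submodule.span k
      {t | ∃ i j, i + j = d ∧ ∃ a ∈ C i, ∃ b ∈ C j, t = a ⊗ₜ[k] b})
    (m : ℕ) : ∀ d, d < m → ∀ x ∈ C d, (unitSubId k A ^ m) x = 0 := by
  induction m with
  | zero => intro d hd; omega
  | succ m ih =>
    intro d hd x hx
    rw [pow_succ', LinearMap.convMul_apply]
    refine Submodule.span_induction (p := fun t _ => LinearMap.mul' k A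
      (TensorProduct.map (unitSubId k A).ofConv (unitSubId k A ^ m).ofConv t) = 0)
      ?_ ?_ ?_ ?_ (hC d x hx)
    · rintro _ ⟨i, j, hij, a, ha, b, hb, rfl⟩
      rw [TensorProduct.map_tmul, LinearMap.mul'_apply]
      rcases Nat.eq_zero_or_pos i with rfl | hi
      · have : (unitSubId k A).ofConv a = 0 := by
          change algebraMap k A (Coalgebra.counit a) - a = 0
          rw [← h0 a ha, sub_self]
        rw [this, zero_mul]
      · have : (unitSubId k A ^ m).ofConv b = 0 := ih j (by omega) b hb
        rw [this, mul_zero]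
    · simp
    · intro s t _ _ hs ht
      rw [map_add, map_add, hs, ht, add_zero]
    · intro c t _ ht
      rw [map_smul, map_smul, ht, smul_zero]

end Antipode

namespace HopfStructure

/-- A homomorphism compatible with coproducts and counits is compatible with antipodes. -/
theorem isHom_of_comul_counit {k A B : Type*} [CommRing k] [Ring A] [Algebra k A] [Ring B]
    [Algebra k B] (H : HopfStructure k A) (K : HopfStructure k B) (f : A →ₐ[k] B)
    (h1 : ∀ x, Algebra.TensorProduct.map f f (H.comul x) = K.comul (f x))
    (h2 : ∀ x, H.counit x = K.counit (f x)) : H.IsHom K f := by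
  refine ⟨h1, h2, ?_⟩
  let _ := H.toHopfAlgebra
  let _ := K.toHopfAlgebra
  let F : A →ₐc[k] B := BialgHom.ofAlgHom f
    (by ext x; exact (h2 x).symm) (by apply AlgHom.ext; exact h1)
  exact fun x => HopfAlgebra.map_antipode_of_bialgHom F x

theorem antipode_mul {k A : Type*} [CommRing k] [Ring A] [Algebra k A] (H : HopfStructure k A)
    (x y : A) : H.antipode (x * y) = H.antipode y * H.antipode x := by
  let _ := H.toHopfAlgebra
  exact HopfAlgebra.antipode_mul_antidistrib x y

theorem counit_antipode {k A : Type*} [CommRing k] [Ring A] [Algebra k A] (H : HopfStructure k A)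
    (x : A) : H.counit (H.antipode x) = H.counit x := by
  let _ := H.toHopfAlgebra
  exact HopfAlgebra.counit_antipode x

/-- A subalgebra which is closed under the coproduct and the antipode is a Hopf algebra. -/
theorem exists_restrict {k A : Type*} [Field k] [Ring A] [Algebra k A] (H : HopfStructure k A)
    (B : Subalgebra k A)
    (h1 : ∀ x ∈ B, H.comul x ∈ (Algebra.TensorProduct.map B.val B.val).range)
    (h2 : ∀ x ∈ B, H.antipode x ∈ B) : ∃ K : HopfStructure k B, K.IsHom H B.val := by
  have hi : Function.Injective B.val := Subtype.val_injective
  -- Over a field the tensor powers of `B` embed in those of `A`, so the structure maps restrict and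
  -- every axiom may be checked in `A`.
  have hi2 : Function.Injective (Algebra.TensorProduct.map B.val B.val) :=
    TensorProduct.map_injective_of_flat_flat B.val.toLinearMap B.val.toLinearMap hi hi
  have hi3 : Function.Injective
      (Algebra.TensorProduct.map B.val (Algebra.TensorProduct.map B.val B.val)) :=
    TensorProduct.map_injective_of_flat_flat B.val.toLinearMap
      (Algebra.TensorProduct.map B.val B.val).toLinearMap hi hi2
  let ι2 := AlgEquiv.ofInjective _ hi2
  let Δ : B →ₐ[k] B ⊗[k] B :=
    ι2.symm.toAlgHom.comp ((H.comul.comp B.val).codRestrict _ fun x => h1 _ x.2)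
  have hΔ : ∀ x, Algebra.TensorProduct.map B.val B.val (Δ x) = H.comul x := by
    intro x
    have := ι2.apply_symm_apply ((H.comul.comp B.val).codRestrict _ (fun x => h1 _ x.2) x)
    exact congrArg Subtype.val this
  have hΔ' : (Algebra.TensorProduct.map B.val B.val).comp Δ = H.comul.comp B.val :=
    AlgHom.ext hΔ
  let ε : B →ₐ[k] k := H.counit.comp B.val
  let S : B →ₗ[k] B := (H.antipode.comp B.val.toLinearMap).codRestrict
    (Subalgebra.toSubmodule B) fun x => h2 _ x.2
  have hmul : ∀ t : B ⊗[k] B, B.val (LinearMap.mul' k B t)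
      = LinearMap.mul' k A (Algebra.TensorProduct.map B.val B.val t) := by
    intro t
    induction t with
    | zero => simp
    | tmul x y => simp
    | add s t hs ht => simp only [map_add, hs, ht]
  refine ⟨{ comul := Δ, counit := ε, antipode := S, coassoc := ?_, counit_left := ?_,
            counit_right := ?_, antipode_left := ?_, antipode_right := ?_ }, ?_⟩
  · have e1 : (Algebra.TensorProduct.map B.val (Algebra.TensorProduct.map B.val B.val)).comp
        ((Algebra.TensorProduct.assoc k k k B B B).toAlgHom.comp
        (Algebra.TensorProduct.map Δ (.id k B)))
        = ((Algebra.TensorProduct.assoc k k k A A A).toAlgHom.comp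
        (Algebra.TensorProduct.map H.comul (.id k A))).comp
          (Algebra.TensorProduct.map B.val B.val) := by
      have e0 : (Algebra.TensorProduct.map B.val (Algebra.TensorProduct.map B.val B.val)).comp
          (Algebra.TensorProduct.assoc k k k B B B).toAlgHom
          = (Algebra.TensorProduct.assoc k k k A A A).toAlgHom.comp
          (Algebra.TensorProduct.map (Algebra.TensorProduct.map B.val B.val) B.val) := by
        ext <;> rfl
      rw [← AlgHom.comp_assoc, e0, AlgHom.comp_assoc, AlgHom.comp_assoc,
        ← Algebra.TensorProduct.map_comp, ← Algebra.TensorProduct.map_comp, hΔ']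
      rfl
    have e2 : (Algebra.TensorProduct.map B.val (Algebra.TensorProduct.map B.val B.val)).comp
        (Algebra.TensorProduct.map (.id k B) Δ)
        = (Algebra.TensorProduct.map (.id k A) H.comul).comp
          (Algebra.TensorProduct.map B.val B.val) := by
      rw [← Algebra.TensorProduct.map_comp, ← Algebra.TensorProduct.map_comp, hΔ']
      rfl
    refine AlgHom.ext fun x => hi3 ?_
    have e1' := DFunLike.congr_fun e1 (Δ x)
    have e2' := DFunLike.congr_fun e2 (Δ x)
    refine e1'.trans (Eq.trans ?_ e2'.symm)
    have := DFunLike.congr_fun H.coassoc (x : A)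
    simp only [AlgHom.comp_apply] at this ⊢
    rw [hΔ]
    exact this
  · refine AlgHom.ext fun x => ?_
    have e : (Algebra.TensorProduct.map (.id k k) B.val).comp
        (Algebra.TensorProduct.map ε (.id k B))
        = (Algebra.TensorProduct.map H.counit (.id k A)).comp
          (Algebra.TensorProduct.map B.val B.val) := by
      rw [← Algebra.TensorProduct.map_comp, ← Algebra.TensorProduct.map_comp]
      rfl
    have hj : Function.Injective (Algebra.TensorProduct.map (.id k k) B.val) :=
      TensorProduct.map_injective_of_flat_flat (AlgHom.id k k).toLinearMap B.val.toLinearMap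
        Function.injective_id hi
    refine hj ((DFunLike.congr_fun e (Δ x)).trans ?_)
    have := DFunLike.congr_fun H.counit_left (x : A)
    simp only [AlgHom.comp_apply] at this ⊢
    rw [hΔ, this]
    simp
  · refine AlgHom.ext fun x => ?_
    have e : (Algebra.TensorProduct.map B.val (.id k k)).comp
        (Algebra.TensorProduct.map (.id k B) ε)
        = (Algebra.TensorProduct.map (.id k A) H.counit).comp
          (Algebra.TensorProduct.map B.val B.val) := by
      rw [← Algebra.TensorProduct.map_comp, ← Algebra.TensorProduct.map_comp]
      rfl
    have hj : Function.Injective (Algebra.TensorProduct.map B.val (.id k k)) :=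
      TensorProduct.map_injective_of_flat_flat B.val.toLinearMap (AlgHom.id k k).toLinearMap
        hi Function.injective_id
    refine hj ((DFunLike.congr_fun e (Δ x)).trans ?_)
    have := DFunLike.congr_fun H.counit_right (x : A)
    simp only [AlgHom.comp_apply] at this ⊢
    rw [hΔ, this]
    simp
  · refine LinearMap.ext fun x => hi ?_
    have e : ∀ t : B ⊗[k] B, Algebra.TensorProduct.map B.val B.val (S.rTensor B t)
        = H.antipode.rTensor A (Algebra.TensorProduct.map B.val B.val t) := by
      intro t
      induction t with
      | zero => simp
      | tmul x y => rfl
      | add s t hs ht => simp only [map_add, hs, ht]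
    have := DFunLike.congr_fun H.antipode_left (x : A)
    refine (hmul _).trans ?_
    refine (congrArg _ (e _)).trans ?_
    refine Eq.trans (congrArg (fun t => LinearMap.mul' k A (H.antipode.rTensor A t)) (hΔ x)) ?_
    exact this
  · refine LinearMap.ext fun x => hi ?_
    have e : ∀ t : B ⊗[k] B, Algebra.TensorProduct.map B.val B.val (S.lTensor B t)
        = H.antipode.lTensor A (Algebra.TensorProduct.map B.val B.val t) := by
      intro t
      induction t with
      | zero => simp
      | tmul x y => rfl
      | add s t hs ht => simp only [map_add, hs, ht]
    have := DFunLike.congr_fun H.antipode_right (x : A)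
    refine (hmul _).trans ?_
    refine (congrArg _ (e _)).trans ?_
    refine Eq.trans (congrArg (fun t => LinearMap.mul' k A (H.antipode.lTensor A t)) (hΔ x)) ?_
    exact this
  · exact isHom_of_comul_counit _ H B.val hΔ fun _ => rfl

end HopfStructure

end

noncomputable section

/-! ### The induced Hopf algebra structure on the associated graded algebra -/

namespace E0

variable {k A : Type*} [CommRing k] [Ring A] [Algebra k A] {ε : A →ₐ[k] k}

theorem cls_congr {i j : ℕ} (h : i = j) (x : augFiltration ε i) (y : augFiltration ε j)
    (hxy : (x : A) = y) : E0.cls ε i x = E0.cls ε j y := by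
  subst h
  rw [Subtype.ext hxy]

theorem cls_add (j : ℕ) (x y : augFiltration ε j) :
    E0.cls ε j (x + y) = E0.cls ε j x + E0.cls ε j y := by
  simp only [E0.cls, map_add]

theorem cls_smul (j : ℕ) (c : k) (x : augFiltration ε j) :
    E0.cls ε j (c • x) = c • E0.cls ε j x := by
  simp only [E0.cls, map_smul]

theorem cls_zero (j : ℕ) : E0.cls ε j 0 = 0 := by
  simp only [E0.cls, map_zero]

/-- The class map as a linear map. -/
def clsₗ (ε : A →ₐ[k] k) (j : ℕ) : augFiltration ε j →ₗ[k] E0 ε :=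
  (E0.lof ε j).comp (grMk ε j)

theorem cls_eq_zero {j : ℕ} (x : augFiltration ε j) (hx : (x : A) ∈ augFiltration ε (j + 1)) :
    E0.cls ε j x = 0 := by
  rw [E0.cls, grMk_eq_zero ε x hx, map_zero]

@[elab_as_elim]
theorem induction {P : E0 ε → Prop} (z : E0 ε) (h0 : P 0)
    (hcls : ∀ j (x : augFiltration ε j), P (E0.cls ε j x))
    (hadd : ∀ x y, P x → P y → P (x + y)) : P z := by
  refine DirectSum.induction_on (motive := P) z h0 ?_ hadd
  intro j x
  obtain ⟨x, rfl⟩ := grMk_surjective ε j x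
  exact hcls j x

theorem linearMap_ext {M : Type*} [AddCommGroup M] [Module k M] {f g : E0 ε →ₗ[k] M}
    (h : ∀ j (x : augFiltration ε j), f (E0.cls ε j x) = g (E0.cls ε j x)) : f = g := by
  refine LinearMap.ext fun z => ?_
  induction z using E0.induction with
  | h0 => simp
  | hcls j x => exact h j x
  | hadd x y hx hy => simp only [map_add, hx, hy]

theorem one_eq_cls : (1 : E0 ε) = E0.cls ε 0 ⟨1, augFiltration_zero_eq_top ε 1⟩ := rfl

theorem algebraMap_eq_cls (c : k) : algebraMap k (E0 ε) c
    = E0.cls ε 0 ⟨algebraMap k A c, augFiltration_zero_eq_top ε _⟩ := by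
  rw [Algebra.algebraMap_eq_smul_one, one_eq_cls, ← cls_smul]
  congr 1
  ext
  exact (Algebra.algebraMap_eq_smul_one c).symm

theorem mem_aug_one {x : A} (hx : ε x = 0) : x ∈ augFiltration ε 1 := by
  rw [mem_augFiltration, Submodule.pow_one]
  exact hx

theorem counit_eq_zero {j : ℕ} {x : A} (hj : 0 < j) (hx : x ∈ augFiltration ε j) : ε x = 0 := by
  have : x ∈ (RingHom.ker ε : Ideal A) := by
    rw [mem_augFiltration] at hx
    exact Ideal.pow_le_self hj.ne' hx
  exact this

theorem aug_anti {i j : ℕ} (h : i ≤ j) {x : A} (hx : x ∈ augFiltration ε j) :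
    x ∈ augFiltration ε i := Ideal.pow_le_pow_right h hx

theorem cls_zero_eq (x : augFiltration ε 0) :
    E0.cls ε 0 x = algebraMap k (E0 ε) (ε (x : A)) := by
  rw [algebraMap_eq_cls, ← sub_eq_zero, sub_eq_add_neg, ← neg_one_smul k (E0.cls ε 0 ⟨_, _⟩),
    ← cls_smul, ← cls_add]
  refine cls_eq_zero _ (mem_aug_one ?_)
  simp

/-- Induction for the powers of the augmentation ideal. -/
theorem aug_succ_induction {j : ℕ} {P : ∀ x : A, x ∈ augFiltration ε (j + 1) → Prop}
    (hmul : ∀ a b (ha : a ∈ augFiltration ε 1) (hb : b ∈ augFiltration ε j),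
      P (a * b) (by rw [add_comm]; exact augFiltration_mul_mem ha hb))
    (hadd : ∀ x y hx hy, P x hx → P y hy → P (x + y) (add_mem hx hy))
    {x : A} (hx : x ∈ augFiltration ε (j + 1)) : P x hx := by
  have hx' : x ∈ (RingHom.ker ε : Ideal A) * (RingHom.ker ε : Ideal A) ^ j := by
    rw [mem_augFiltration, add_comm, Ideal.IsTwoSided.pow_add, Submodule.pow_one] at hx
    exact hx
  have : ∃ h, P x h := by
    refine Submodule.mul_induction_on hx' ?_ ?_
    · intro a ha b hb
      exact ⟨_, hmul a b (mem_aug_one ha) hb⟩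
    · rintro x y ⟨hx, hx'⟩ ⟨hy, hy'⟩
      exact ⟨_, hadd x y hx hy hx' hy'⟩
  exact this.2

/-- Since `I ^ (j + 1) = I * I ^ j`, the associated graded algebra is generated in degree one. This
reduces the coalgebra axioms to degree one. -/
theorem algHom_ext {B : Type*} [Ring B] [Algebra k B] {f g : E0 ε →ₐ[k] B}
    (h : ∀ x : augFiltration ε 1, f (E0.cls ε 1 x) = g (E0.cls ε 1 x)) : f = g := by
  have key : ∀ j (x : augFiltration ε j), f (E0.cls ε j x) = g (E0.cls ε j x) := by
    intro j
    induction j with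
    | zero => intro x; rw [cls_zero_eq, AlgHom.commutes, AlgHom.commutes]
    | succ j ih =>
      rintro ⟨x, hx⟩
      induction hx using aug_succ_induction with
      | hmul a b ha hb =>
        have : E0.cls ε (j + 1) ⟨a * b, by rw [add_comm]; exact augFiltration_mul_mem ha hb⟩
            = E0.cls ε 1 ⟨a, ha⟩ * E0.cls ε j ⟨b, hb⟩ := by
          rw [E0.cls_mul]
          exact cls_congr (add_comm _ _) _ _ rfl
        rw [this, map_mul, map_mul, h, ih]
      | hadd x y hx hy h1 h2 =>
        have : E0.cls ε (j + 1) ⟨x + y, add_mem hx hy⟩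
            = E0.cls ε (j + 1) ⟨x, hx⟩ + E0.cls ε (j + 1) ⟨y, hy⟩ := by
          rw [← cls_add]; rfl
        rw [this, map_add, map_add, h1, h2]
  exact AlgHom.toLinearMap_injective (linearMap_ext key)

/-- The linear map out of `E0` given by linear maps on the powers of the augmentation ideal. -/
def desc {M : Type*} [AddCommGroup M] [Module k M] (f : ∀ j, augFiltration ε j →ₗ[k] M)
    (hf : ∀ j (x : augFiltration ε j), (x : A) ∈ augFiltration ε (j + 1) → f j x = 0) :
    E0 ε →ₗ[k] M :=
  DirectSum.toModule k ℕ M fun j => Submodule.liftQ _ (f j) fun x hx => hf j x hx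

theorem desc_cls {M : Type*} [AddCommGroup M] [Module k M] (f : ∀ j, augFiltration ε j →ₗ[k] M)
    (hf : ∀ j (x : augFiltration ε j), (x : A) ∈ augFiltration ε (j + 1) → f j x = 0)
    (j : ℕ) (x : augFiltration ε j) : desc f hf (E0.cls ε j x) = f j x :=
  (DirectSum.toModule_lof k j _).trans rfl

end E0

section Induced

variable {k A : Type*} [Field k] [Ring A] [Algebra k A]

/-- The filtration of `A ⊗ A` induced by the augmentation ideal filtration of `A`. -/
def tensorFiltration (ε : A →ₐ[k] k) (j : ℕ) : Submodule k (A ⊗[k] A) :=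
  Submodule.span k {t | ∃ a b, a + b = j ∧
    ∃ y ∈ augFiltration ε a, ∃ z ∈ augFiltration ε b, t = y ⊗ₜ[k] z}

variable {ε : A →ₐ[k] k}

theorem tmul_mem_tensorFiltration {a b j : ℕ} (h : a + b = j) {y z : A}
    (hy : y ∈ augFiltration ε a) (hz : z ∈ augFiltration ε b) :
    y ⊗ₜ[k] z ∈ tensorFiltration ε j :=
  Submodule.subset_span ⟨a, b, h, y, hy, z, hz, rfl⟩

theorem mul_mem_tensorFiltration {i j : ℕ} {s t : A ⊗[k] A}
    (hs : s ∈ tensorFiltration ε i) (ht : t ∈ tensorFiltration ε j) :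
    s * t ∈ tensorFiltration ε (i + j) := by
  have : tensorFiltration ε i * tensorFiltration ε j ≤ tensorFiltration ε (i + j) := by
    unfold tensorFiltration
    rw [Submodule.span_mul_span]
    refine Submodule.span_le.2 ?_
    rintro _ ⟨_, ⟨a, b, hab, y, hy, z, hz, rfl⟩, _, ⟨a', b', hab', y', hy', z', hz', rfl⟩, rfl⟩
    simp only [Algebra.TensorProduct.tmul_mul_tmul]
    exact tmul_mem_tensorFiltration (by omega) (augFiltration_mul_mem hy hy')
      (augFiltration_mul_mem hz hz')
  exact this (Submodule.mul_mem_mul hs ht)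

theorem tensorFiltration_anti {i j : ℕ} (h : i ≤ j) :
    tensorFiltration ε j ≤ tensorFiltration ε i := by
  refine Submodule.span_le.2 ?_
  rintro _ ⟨a, b, hab, y, hy, z, hz, rfl⟩
  rcases le_total i a with h1 | h1
  · exact tmul_mem_tensorFiltration (add_zero i) (E0.aug_anti h1 hy)
      (augFiltration_zero_eq_top _ _)
  · exact tmul_mem_tensorFiltration (by omega : a + (i - a) = i) hy (E0.aug_anti (by omega) hz)

theorem tensorFiltration_repr {j : ℕ} {t : A ⊗[k] A} (ht : t ∈ tensorFiltration ε j) :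
    ∃ (N : ℕ) (a b : Fin N → ℕ) (y : ∀ i, augFiltration ε (a i)) (z : ∀ i, augFiltration ε (b i)),
      (∀ i, a i + b i = j) ∧ t = ∑ i, (y i : A) ⊗ₜ[k] (z i : A) := by
  induction ht using Submodule.span_induction with
  | mem t ht =>
    obtain ⟨a, b, hab, y, hy, z, hz, rfl⟩ := ht
    exact ⟨1, fun _ => a, fun _ => b, fun _ => ⟨y, hy⟩, fun _ => ⟨z, hz⟩, fun _ => hab, by simp⟩
  | zero => exact ⟨0, Fin.elim0, Fin.elim0, fun i => i.elim0, fun i => i.elim0,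
      fun i => i.elim0, by simp⟩
  | add s t _ _ hs ht =>
    obtain ⟨N, a, b, y, z, hab, rfl⟩ := hs
    obtain ⟨N', a', b', y', z', hab', rfl⟩ := ht
    refine ⟨N + N', Fin.append a a', Fin.append b b',
      Fin.addCases (fun i => ⟨y i, by rw [Fin.append_left]; exact (y i).2⟩)
        (fun i => ⟨y' i, by rw [Fin.append_right]; exact (y' i).2⟩),
      Fin.addCases (fun i => ⟨z i, by rw [Fin.append_left]; exact (z i).2⟩)
        (fun i => ⟨z' i, by rw [Fin.append_right]; exact (z' i).2⟩), ?_, ?_⟩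
    · intro i
      refine Fin.addCases (fun i => ?_) (fun i => ?_) i
      · simpa using hab i
      · simpa using hab' i
    · rw [Fin.sum_univ_add]
      simp
  | smul c t _ ht =>
    obtain ⟨N, a, b, y, z, hab, rfl⟩ := ht
    refine ⟨N, a, b, fun i => c • y i, z, hab, ?_⟩
    simp [Finset.smul_sum, TensorProduct.smul_tmul']

theorem exists_grProj (ε : A →ₐ[k] k) (j : ℕ) :
    ∃ r : A →ₗ[k] grPiece ε j, ∀ x : augFiltration ε j, r x = grMk ε j x := by
  obtain ⟨g, hg⟩ := LinearMap.exists_extend (grMk ε j)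
  exact ⟨g, fun x => DFunLike.congr_fun hg x⟩

/-- A linear extension to `A` of the quotient map `I ^ j → I ^ j / I ^ (j + 1)`. -/
def grProj (ε : A →ₐ[k] k) (j : ℕ) : A →ₗ[k] grPiece ε j := (exists_grProj ε j).choose

theorem grProj_apply (j : ℕ) {x : A} (hx : x ∈ augFiltration ε j) :
    grProj ε j x = grMk ε j ⟨x, hx⟩ := (exists_grProj ε j).choose_spec ⟨x, hx⟩

theorem grProj_eq_zero {i j : ℕ} (h : j < i) {x : A} (hx : x ∈ augFiltration ε i) :
    grProj ε j x = 0 := by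
  rw [grProj_apply j (E0.aug_anti h.le hx)]
  exact grMk_eq_zero ε _ (E0.aug_anti h hx)

/-- The map sending an element of filtration `j` of `A ⊗ A` to its class. -/
def tensorCls (ε : A →ₐ[k] k) (j : ℕ) : A ⊗[k] A →ₗ[k] E0 ε ⊗[k] E0 ε :=
  ∑ ab ∈ Finset.HasAntidiagonal.antidiagonal j,
    TensorProduct.map ((E0.lof ε ab.1).comp (grProj ε ab.1))
      ((E0.lof ε ab.2).comp (grProj ε ab.2))

/-- A bidegree of total `j` other than `(a, b)` is too small in one coordinate, where the projection
vanishes. So the arbitrary choice of the extensions `grProj` has no effect on elements of filtration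
`j`. -/
theorem tensorCls_tmul {a b j : ℕ} (h : a + b = j) (y : augFiltration ε a)
    (z : augFiltration ε b) :
    tensorCls ε j ((y : A) ⊗ₜ[k] (z : A)) = E0.cls ε a y ⊗ₜ[k] E0.cls ε b z := by
  rw [tensorCls, LinearMap.sum_apply, Finset.sum_eq_single (a, b)]
  · simp [grProj_apply, y.2, z.2, E0.cls]
  · rintro ⟨a', b'⟩ hab hne
    simp only [Finset.HasAntidiagonal.mem_antidiagonal] at hab
    simp only [TensorProduct.map_tmul, LinearMap.comp_apply]
    rcases lt_trichotomy a' a with h1 | h1 | h1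
    · rw [grProj_eq_zero h1 y.2, map_zero, TensorProduct.zero_tmul]
    · exact absurd (Prod.ext h1 (by simp; omega)) hne
    · rw [grProj_eq_zero (by omega : b' < b) z.2, map_zero, TensorProduct.tmul_zero]
  · intro hn
    exact absurd (Finset.HasAntidiagonal.mem_antidiagonal.2 h) hn

theorem tensorCls_eq_zero {j : ℕ} {t : A ⊗[k] A} (ht : t ∈ tensorFiltration ε (j + 1)) :
    tensorCls ε j t = 0 := by
  have : tensorFiltration ε (j + 1) ≤ LinearMap.ker (tensorCls ε j) := by
    refine Submodule.span_le.2 ?_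
    rintro _ ⟨a, b, hab, y, hy, z, hz, rfl⟩
    rw [SetLike.mem_coe, LinearMap.mem_ker, tensorCls, LinearMap.sum_apply]
    refine Finset.sum_eq_zero ?_
    rintro ⟨a', b'⟩ hab'
    simp only [Finset.HasAntidiagonal.mem_antidiagonal] at hab'
    simp only [TensorProduct.map_tmul, LinearMap.comp_apply]
    rcases lt_or_ge a' a with h1 | h1
    · rw [grProj_eq_zero h1 hy, map_zero, TensorProduct.zero_tmul]
    · rw [grProj_eq_zero (by omega : b' < b) hz, map_zero, TensorProduct.tmul_zero]
  exact this ht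

theorem tensorCls_mul {i j : ℕ} {s t : A ⊗[k] A}
    (hs : s ∈ tensorFiltration ε i) (ht : t ∈ tensorFiltration ε j) :
    tensorCls ε (i + j) (s * t) = tensorCls ε i s * tensorCls ε j t := by
  induction hs using Submodule.span_induction with
  | zero => simp
  | add s s' _ _ h h' => simp only [add_mul, map_add, h, h']
  | smul c s _ h => simp only [smul_mul_assoc, map_smul, h]
  | mem s hs =>
    obtain ⟨a, b, hab, y, hy, z, hz, rfl⟩ := hs
    induction ht using Submodule.span_induction with
    | zero => simp
    | add s s' _ _ h h' => simp only [mul_add, map_add, h, h']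
    | smul c s _ h => simp only [mul_smul_comm, map_smul, h]
    | mem t ht =>
      obtain ⟨a', b', hab', y', hy', z', hz', rfl⟩ := ht
      have h1 := tensorCls_tmul hab ⟨y, hy⟩ ⟨z, hz⟩
      have h2 := tensorCls_tmul hab' ⟨y', hy'⟩ ⟨z', hz'⟩
      have h3 := tensorCls_tmul (show (a + a') + (b + b') = i + j by omega)
        ⟨y * y', augFiltration_mul_mem hy hy'⟩ ⟨z * z', augFiltration_mul_mem hz hz'⟩
      simp only at h1 h2 h3
      rw [Algebra.TensorProduct.tmul_mul_tmul, h1, h2, h3, Algebra.TensorProduct.tmul_mul_tmul,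
        E0.cls_mul, E0.cls_mul]

namespace HopfStructure

variable (H : HopfStructure k A)

/-- The coproduct of an element of the augmentation ideal is primitive modulo `I ⊗ I`. -/
theorem comul_sub_mem {x : A} (hx : H.counit x = 0) :
    H.comul x - x ⊗ₜ[k] 1 - 1 ⊗ₜ[k] x ∈ tensorFiltration H.counit 2 := by
  -- `R` and `L` stand for `id ⊗ ε` and `ε ⊗ id`. On `a ⊗ b` the expression equals `(a - ε a) ⊗ (b -
  -- ε b)`, which lies in `I ⊗ I`.
  have key : ∀ R L : A ⊗[k] A →ₗ[k] A, (∀ a b, R (a ⊗ₜ b) = H.counit b • a) →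
      (∀ a b, L (a ⊗ₜ b) = H.counit a • b) → ∀ t : A ⊗[k] A,
      t - R t ⊗ₜ[k] 1 - 1 ⊗ₜ[k] L t + H.counit (L t) • (1 ⊗ₜ[k] 1)
        ∈ tensorFiltration H.counit 2 := by
    intro R L hR hL t
    induction t with
    | zero => simp
    | tmul a b =>
      have : a ⊗ₜ[k] b - R (a ⊗ₜ b) ⊗ₜ[k] 1 - 1 ⊗ₜ[k] L (a ⊗ₜ b)
          + H.counit (L (a ⊗ₜ b)) • (1 ⊗ₜ[k] 1)
          = (a - algebraMap k A (H.counit a)) ⊗ₜ[k] (b - algebraMap k A (H.counit b)) := by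
        simp only [hR, hL, TensorProduct.sub_tmul, TensorProduct.tmul_sub,
          Algebra.algebraMap_eq_smul_one, ← TensorProduct.smul_tmul',
          TensorProduct.tmul_smul, map_smul, smul_eq_mul, mul_smul, smul_sub]
        rw [smul_comm (H.counit a) (H.counit b)]
        abel
      rw [this]
      exact tmul_mem_tensorFiltration one_add_one_eq_two (E0.mem_aug_one (by simp)) (E0.mem_aug_one (by simp))
    | add s t hs ht =>
      have : s + t - R (s + t) ⊗ₜ[k] 1 - 1 ⊗ₜ[k] L (s + t) + H.counit (L (s + t)) • (1 ⊗ₜ[k] 1)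
          = (s - R s ⊗ₜ[k] 1 - 1 ⊗ₜ[k] L s + H.counit (L s) • (1 ⊗ₜ[k] 1))
            + (t - R t ⊗ₜ[k] 1 - 1 ⊗ₜ[k] L t + H.counit (L t) • (1 ⊗ₜ[k] 1)) := by
        simp only [map_add, TensorProduct.add_tmul, TensorProduct.tmul_add, add_smul]
        abel
      rw [this]
      exact Submodule.add_mem _ hs ht
  have h1 : Algebra.TensorProduct.rid k k A
      (Algebra.TensorProduct.map (.id k A) H.counit (H.comul x)) = x := by
    have := DFunLike.congr_fun H.counit_right x
    simp only [AlgHom.comp_apply] at this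
    rw [this]
    simp
  have h2 : Algebra.TensorProduct.lid k A
      (Algebra.TensorProduct.map H.counit (.id k A) (H.comul x)) = x := by
    have := DFunLike.congr_fun H.counit_left x
    simp only [AlgHom.comp_apply] at this
    rw [this]
    simp
  have := key
    ((Algebra.TensorProduct.rid k k A).toLinearMap.comp
      (Algebra.TensorProduct.map (.id k A) H.counit).toLinearMap)
    ((Algebra.TensorProduct.lid k A).toLinearMap.comp
      (Algebra.TensorProduct.map H.counit (.id k A)).toLinearMap)
    (fun a b => by simp) (fun a b => by simp) (H.comul x)
  simp only [LinearMap.comp_apply, AlgHom.toLinearMap_apply, AlgEquiv.toLinearMap_apply] at this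
  rwa [h1, h2, hx, zero_smul, add_zero] at this

theorem comul_mem {j : ℕ} {x : A} (hx : x ∈ augFiltration H.counit j) :
    H.comul x ∈ tensorFiltration H.counit j := by
  induction j generalizing x with
  | zero =>
    have : ∀ t : A ⊗[k] A, t ∈ tensorFiltration H.counit 0 := by
      intro t
      induction t with
      | zero => exact zero_mem _
      | tmul a b =>
        exact tmul_mem_tensorFiltration (add_zero 0) (augFiltration_zero_eq_top _ _)
          (augFiltration_zero_eq_top _ _)
      | add s t hs ht => exact Submodule.add_mem _ hs ht
    exact this _
  | succ j ih =>
    induction hx using E0.aug_succ_induction with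
    | hmul a b ha hb =>
      rw [map_mul, add_comm]
      refine mul_mem_tensorFiltration ?_ (ih hb)
      have h := tensorFiltration_anti (by norm_num : 1 ≤ 2)
        (H.comul_sub_mem (E0.counit_eq_zero one_pos ha))
      have h1 := tmul_mem_tensorFiltration (add_zero 1) ha
        (augFiltration_zero_eq_top H.counit 1)
      have h2 := tmul_mem_tensorFiltration (zero_add 1)
        (augFiltration_zero_eq_top H.counit 1) ha
      have h3 := Submodule.add_mem _ (Submodule.add_mem _ h h1) h2
      rwa [sub_sub, sub_add, add_sub_cancel_left, sub_add_cancel] at h3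
    | hadd x y hx hy h1 h2 =>
      rw [map_add]
      exact Submodule.add_mem _ h1 h2

theorem antipode_mem {j : ℕ} {x : A} (hx : x ∈ augFiltration H.counit j) :
    H.antipode x ∈ augFiltration H.counit j := by
  induction j generalizing x with
  | zero => exact augFiltration_zero_eq_top _ _
  | succ j ih =>
    induction hx using E0.aug_succ_induction with
    | hmul a b ha hb =>
      rw [H.antipode_mul]
      refine augFiltration_mul_mem (ih hb) (E0.mem_aug_one ?_)
      rw [H.counit_antipode]
      exact E0.counit_eq_zero one_pos ha
    | hadd x y hx hy h1 h2 =>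
      rw [map_add]
      exact Submodule.add_mem _ h1 h2

/-- The coproduct on the associated graded algebra, as a linear map. -/
def grComulₗ : E0 H.counit →ₗ[k] E0 H.counit ⊗[k] E0 H.counit :=
  E0.desc (fun j => ((tensorCls H.counit j).comp H.comul.toLinearMap).comp
    (augFiltration H.counit j).subtype)
    fun _ _ hx => tensorCls_eq_zero (H.comul_mem hx)

theorem grComulₗ_cls (j : ℕ) (x : augFiltration H.counit j) :
    H.grComulₗ (E0.cls H.counit j x) = tensorCls H.counit j (H.comul x) :=
  E0.desc_cls _ _ j x

/-- The coproduct on the associated graded algebra. -/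
def grComul : E0 H.counit →ₐ[k] E0 H.counit ⊗[k] E0 H.counit :=
  AlgHom.ofLinearMap H.grComulₗ
    (by
      rw [E0.one_eq_cls, grComulₗ_cls]
      simp only [map_one, Algebra.TensorProduct.one_def]
      exact tensorCls_tmul (zero_add 0) ⟨1, augFiltration_zero_eq_top _ 1⟩
        ⟨1, augFiltration_zero_eq_top _ 1⟩)
    (by
      intro x y
      induction x using E0.induction with
      | h0 => simp
      | hadd x x' h h' => simp only [add_mul, map_add, h, h']
      | hcls i x =>
        induction y using E0.induction with
        | h0 => simp
        | hadd y y' h h' => simp only [mul_add, map_add, h, h']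
        | hcls j y =>
          rw [E0.cls_mul, grComulₗ_cls, grComulₗ_cls, grComulₗ_cls, map_mul,
            tensorCls_mul (H.comul_mem x.2) (H.comul_mem y.2)])

theorem grComul_cls (j : ℕ) (x : augFiltration H.counit j) :
    H.grComul (E0.cls H.counit j x) = tensorCls H.counit j (H.comul x) := H.grComulₗ_cls j x

/-- Classes of degree one are primitive. As they generate, they determine the whole coalgebra
structure. -/
theorem grComul_cls_one (x : augFiltration H.counit 1) :
    H.grComul (E0.cls H.counit 1 x)
      = E0.cls H.counit 1 x ⊗ₜ[k] 1 + 1 ⊗ₜ[k] E0.cls H.counit 1 x := by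
  rw [grComul_cls]
  have h := tensorCls_eq_zero (H.comul_sub_mem (E0.counit_eq_zero one_pos x.2))
  rw [map_sub, map_sub, sub_sub, sub_eq_zero] at h
  rw [h]
  congr 1
  · exact tensorCls_tmul (add_zero 1) x ⟨1, augFiltration_zero_eq_top _ 1⟩
  · exact tensorCls_tmul (zero_add 1) ⟨1, augFiltration_zero_eq_top _ 1⟩ x

/-- The counit of the associated graded algebra, as a linear map. -/
def grCounitₗ : E0 H.counit →ₗ[k] k :=
  E0.desc (fun j => if j = 0 then H.counit.toLinearMap.comp (augFiltration H.counit j).subtype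
      else 0) (by
    intro j x hx
    split_ifs with h
    · exact E0.counit_eq_zero (Nat.succ_pos _) hx
    · rfl)

theorem grCounitₗ_zero (x : augFiltration H.counit 0) :
    H.grCounitₗ (E0.cls H.counit 0 x) = H.counit x := E0.desc_cls _ _ 0 x

theorem grCounitₗ_pos {j : ℕ} (hj : 0 < j) (x : augFiltration H.counit j) :
    H.grCounitₗ (E0.cls H.counit j x) = 0 := by
  refine (E0.desc_cls _ _ j x).trans ?_
  rw [if_neg hj.ne']
  rfl

/-- The counit of the associated graded algebra. -/
def grCounit : E0 H.counit →ₐ[k] k :=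
  AlgHom.ofLinearMap H.grCounitₗ
    (by rw [E0.one_eq_cls, grCounitₗ_zero]; exact map_one _)
    (by
      intro x y
      induction x using E0.induction with
      | h0 => simp
      | hadd x x' h h' => simp only [add_mul, map_add, h, h']
      | hcls i x =>
        induction y using E0.induction with
        | h0 => simp
        | hadd y y' h h' => simp only [mul_add, map_add, h, h']
        | hcls j y =>
          rw [E0.cls_mul]
          rcases Nat.eq_zero_or_pos i with rfl | hi
          · rcases Nat.eq_zero_or_pos j with rfl | hj
            · rw [H.grCounitₗ_zero x, H.grCounitₗ_zero y, ← map_mul]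
              exact H.grCounitₗ_zero ⟨x * y, _⟩
            · rw [H.grCounitₗ_pos hj, mul_zero, H.grCounitₗ_pos (by omega)]
          · rw [H.grCounitₗ_pos hi, zero_mul, H.grCounitₗ_pos (by omega)])

/-- The antipode of the associated graded algebra. -/
def grAntipode : E0 H.counit →ₗ[k] E0 H.counit :=
  E0.desc (fun j => (E0.clsₗ H.counit j).comp
    ((H.antipode.comp (augFiltration H.counit j).subtype).codRestrict _
      fun x => H.antipode_mem x.2))
    fun _ _ hx => E0.cls_eq_zero _ (H.antipode_mem hx)

theorem grAntipode_cls (j : ℕ) (x : augFiltration H.counit j) :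
    H.grAntipode (E0.cls H.counit j x) = E0.cls H.counit j ⟨H.antipode x, H.antipode_mem x.2⟩ :=
  E0.desc_cls _ _ j x

theorem cls_sum {ε : A →ₐ[k] k} {ι : Type*} (s : Finset ι) (j : ℕ) (x : ι → augFiltration ε j) :
    E0.cls ε j (∑ i ∈ s, x i) = ∑ i ∈ s, E0.cls ε j (x i) :=
  map_sum (E0.clsₗ ε j) x s

/-- Covers both antipode axioms at once: the pair `(f, g)` will be `(S, id)` or `(id, S)`. -/
theorem grMul_antipode (f g : A →ₗ[k] A) (f' g' : E0 H.counit →ₗ[k] E0 H.counit)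
    (hf : ∀ {j : ℕ} {x : A}, x ∈ augFiltration H.counit j → f x ∈ augFiltration H.counit j)
    (hg : ∀ {j : ℕ} {x : A}, x ∈ augFiltration H.counit j → g x ∈ augFiltration H.counit j)
    (hf' : ∀ j (x : augFiltration H.counit j), f' (E0.cls H.counit j x)
      = E0.cls H.counit j ⟨f x, hf x.2⟩)
    (hg' : ∀ j (x : augFiltration H.counit j), g' (E0.cls H.counit j x)
      = E0.cls H.counit j ⟨g x, hg x.2⟩)
    (h : ∀ x, LinearMap.mul' k A (TensorProduct.map f g (H.comul x))
      = algebraMap k A (H.counit x)) (z : E0 H.counit) :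
    LinearMap.mul' k (E0 H.counit) (TensorProduct.map f' g' (H.grComul z))
      = algebraMap k (E0 H.counit) (H.grCounit z) := by
  induction z using E0.induction with
  | h0 => simp
  | hadd x y h h' => simp only [map_add, h, h']
  | hcls j x =>
    rw [grComul_cls]
    obtain ⟨N, a, b, y, z, hab, ht⟩ := tensorFiltration_repr (H.comul_mem x.2)
    have h1 := h x
    rw [ht] at h1 ⊢
    simp only [map_sum, tensorCls_tmul (hab _), TensorProduct.map_tmul, LinearMap.mul'_apply,
      hf', hg', E0.cls_mul] at h1 ⊢
    have h2 : ∀ i, E0.cls H.counit (a i + b i) ⟨f (y i) * g (z i),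
        augFiltration_mul_mem (hf (y i).2) (hg (z i).2)⟩
        = E0.cls H.counit j ⟨f (y i) * g (z i), by
          have := augFiltration_mul_mem (hf (y i).2) (hg (z i).2); rwa [hab] at this⟩ :=
      fun i => E0.cls_congr (hab i) _ _ rfl
    simp only [h2]
    rw [← cls_sum]
    rcases Nat.eq_zero_or_pos j with rfl | hj
    · rw [E0.cls_zero_eq]
      congr 1
      refine Eq.trans ?_ (H.grCounitₗ_zero x).symm
      rw [Submodule.coe_sum]
      refine (congrArg H.counit h1).trans ?_
      simp
    · rw [show H.grCounit (E0.cls H.counit j x) = 0 from H.grCounitₗ_pos hj x, map_zero]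
      have : (∑ i, ⟨f (y i) * g (z i), by
          have := augFiltration_mul_mem (hf (y i).2) (hg (z i).2); rwa [hab] at this⟩ :
          augFiltration H.counit j) = 0 := by
        ext
        rw [Submodule.coe_sum]
        refine h1.trans ?_
        rw [E0.counit_eq_zero hj x.2, map_zero]
        rfl
      rw [this, E0.cls_zero]

/-- The Hopf algebra structure on the associated graded algebra. -/
def gr : HopfStructure k (E0 H.counit) where
  comul := H.grComul
  counit := H.grCounit
  antipode := H.grAntipode
  coassoc := by
    refine E0.algHom_ext fun x => ?_
    simp only [AlgHom.comp_apply, grComul_cls_one, map_add, Algebra.TensorProduct.map_tmul,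
      AlgHom.id_apply, map_one, Algebra.TensorProduct.one_def, TensorProduct.add_tmul,
      TensorProduct.tmul_add]
    simp only [AlgEquiv.coe_toAlgHom, Algebra.TensorProduct.assoc_tmul]
    abel
  counit_left := by
    refine E0.algHom_ext fun x => ?_
    have : H.grCounit (E0.cls H.counit 1 x) = 0 := H.grCounitₗ_pos one_pos x
    simp [grComul_cls_one, this]
  counit_right := by
    refine E0.algHom_ext fun x => ?_
    have : H.grCounit (E0.cls H.counit 1 x) = 0 := H.grCounitₗ_pos one_pos x
    simp [grComul_cls_one, this]
  antipode_left := LinearMap.ext fun z =>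
    H.grMul_antipode H.antipode LinearMap.id H.grAntipode LinearMap.id (H.antipode_mem)
      (fun h => h) H.grAntipode_cls (fun _ _ => rfl) (DFunLike.congr_fun H.antipode_left) z
  antipode_right := LinearMap.ext fun z =>
    H.grMul_antipode LinearMap.id H.antipode LinearMap.id H.grAntipode (fun h => h)
      (H.antipode_mem) (fun _ _ => rfl) H.grAntipode_cls (DFunLike.congr_fun H.antipode_right) z

theorem isInduced_gr : H.IsInduced H.gr := by
  refine ⟨?_, ?_, ?_, ?_, ?_⟩
  · exact fun j x => tensorFiltration_repr (H.comul_mem x.2)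
  · intro j x N a b y z hab h
    refine (H.grComul_cls j x).trans ?_
    rw [h, map_sum]
    exact Finset.sum_congr rfl fun i _ => tensorCls_tmul (hab i) _ _
  · exact H.grCounitₗ_zero
  · exact fun j x hj => H.grCounitₗ_pos hj x
  · exact fun j x => ⟨H.antipode_mem x.2, H.grAntipode_cls j x⟩

/-- An algebra homomorphism between associated graded algebras which preserves degrees is a
homomorphism of Hopf algebras. -/
theorem gr_isHom {B : Type*} [Ring B] [Algebra k B] (K : HopfStructure k B)
    (f : E0 H.counit →ₐ[k] E0 K.counit)
    (hf : ∀ x : augFiltration H.counit 1, ∃ y, f (E0.cls H.counit 1 x) = E0.cls K.counit 1 y) :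
    H.gr.IsHom K.gr f := by
  -- Both sides are algebra maps, so degree one suffices, and there `f` sends primitive classes to
  -- primitive classes.
  have h1 : (Algebra.TensorProduct.map f f).comp H.grComul = K.grComul.comp f := by
    refine E0.algHom_ext fun x => ?_
    obtain ⟨y, hy⟩ := hf x
    simp only [AlgHom.comp_apply, grComul_cls_one, hy, map_add, Algebra.TensorProduct.map_tmul,
      map_one]
  have h2 : H.grCounit = K.grCounit.comp f := by
    refine E0.algHom_ext fun x => ?_
    obtain ⟨y, hy⟩ := hf x
    rw [AlgHom.comp_apply, hy]
    exact (H.grCounitₗ_pos one_pos x).trans (K.grCounitₗ_pos one_pos y).symm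
  exact isHom_of_comul_counit _ _ _ (DFunLike.congr_fun h1) (DFunLike.congr_fun h2)

end HopfStructure

end Induced

end

noncomputable section

/-! ### The Adem relations from the Bullett–Macdonald identity -/

section Adem

theorem PowerSeries.coeff_one_sub_X_pow {R : Type*} [CommRing R] (n m : ℕ) :
    PowerSeries.coeff m ((1 - PowerSeries.X : PowerSeries R) ^ n) = (-1) ^ m * (n.choose m : R) := by
  have h : (1 - PowerSeries.X : PowerSeries R) ^ n = PowerSeries.rescale (-1 : R)
      (((1 + Polynomial.X) ^ n : Polynomial R) : PowerSeries R) := by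
    simp [PowerSeries.rescale_X, sub_eq_add_neg]
  rw [h, PowerSeries.coeff_rescale, Polynomial.coeff_coe, Polynomial.coeff_one_add_X_pow]

/-- Uses `(pm choose m) = p * (pm - 1 choose m - 1)`. -/
theorem natCast_choose_mul_self_eq_zero {R : Type*} [CommRing R] (p m : ℕ) [CharP R p]
    (hm : 0 < m) : ((p * m).choose m : R) = 0 := by
  rw [CharP.cast_eq_zero_iff R p]
  obtain ⟨m, rfl⟩ := Nat.exists_eq_succ_of_ne_zero hm.ne'
  rcases Nat.eq_zero_or_pos p with rfl | hp
  · simp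
  obtain ⟨q, hq⟩ : ∃ q, p * (m + 1) = q + 1 := ⟨p * (m + 1) - 1, by
    have : 0 < p * (m + 1) := Nat.mul_pos hp (Nat.succ_pos m)
    omega⟩
  have h := Nat.add_one_mul_choose_eq q m
  rw [← hq] at h
  refine ⟨q.choose m, ?_⟩
  have h2 : (p * q.choose m) * (m + 1) = (p * (m + 1)).choose (m + 1) * (m + 1) := by
    rw [← h]; ring
  exact (Nat.eq_of_mul_eq_mul_right (Nat.succ_pos m) h2).symm

/-- The series `PowerSeries.mk 1` plays the role of `(1 - X)⁻¹`. -/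
theorem one_sub_X_pow_mul_mk_one_pow {R : Type*} [CommRing R] (n m : ℕ) :
    (1 - PowerSeries.X : PowerSeries R) ^ n * (PowerSeries.mk 1) ^ (n + m)
      = (PowerSeries.mk 1) ^ m := by
  rw [pow_add, ← mul_assoc, ← mul_pow, mul_comm (1 - PowerSeries.X),
    PowerSeries.mk_one_mul_one_sub_eq_one, one_pow, one_mul]

theorem one_sub_X_pow_mul_mk_one_pow' {R : Type*} [CommRing R] (n m : ℕ) :
    (1 - PowerSeries.X : PowerSeries R) ^ (m + n) * (PowerSeries.mk 1) ^ m
      = (1 - PowerSeries.X) ^ n := by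
  rw [pow_add, mul_right_comm, ← mul_pow, mul_comm (1 - PowerSeries.X),
    PowerSeries.mk_one_mul_one_sub_eq_one, one_pow, one_mul]

/-- A residue under the substitution `u = w (1 - w) ^ (p - 1)`. In characteristic `p` one has `du =
(1 - w) ^ (p - 2) dw`, so the coefficient of `u ^ a` is the coefficient of `w ^ a` after
multiplication by `(1 - w) ^ (-(p - 1) a - 1)`. For `i < a` this leaves a binomial coefficient `(pm
choose m)` with `m = a - i > 0`, which vanishes. -/
theorem coeff_residue_left {p : ℕ} [hp : Fact p.Prime] {R : Type*} [CommRing R] [CharP R p]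
    (a i : ℕ) :
    PowerSeries.coeff a ((PowerSeries.X * (1 - PowerSeries.X : PowerSeries R) ^ (p - 1)) ^ i
      * (PowerSeries.mk 1) ^ ((p - 1) * a + 1)) = if i = a then 1 else 0 := by
  rw [mul_pow, mul_assoc, PowerSeries.coeff_X_pow_mul', ← pow_mul]
  rcases lt_trichotomy i a with h | rfl | h
  · rw [if_pos h.le, if_neg h.ne]
    obtain ⟨m, rfl⟩ := Nat.exists_eq_add_of_le h.le
    have hm : 0 < m := by omega
    have e : (p - 1) * (i + m) + 1 = (p - 1) * i + ((p - 1) * m + 1) := by ring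
    rw [e, one_sub_X_pow_mul_mk_one_pow, PowerSeries.mk_one_pow_eq_mk_choose_add,
      PowerSeries.coeff_mk, Nat.add_sub_cancel_left]
    have e2 : (p - 1) * m + m = p * m := by
      have := hp.out.one_lt
      obtain ⟨q, rfl⟩ := Nat.exists_eq_add_of_le this.le
      rw [Nat.add_sub_cancel_left]
      ring
    rw [Nat.choose_symm_add, e2]
    exact natCast_choose_mul_self_eq_zero p m hm
  · rw [if_pos le_rfl, if_pos rfl, one_sub_X_pow_mul_mk_one_pow]
    simp
  · rw [if_neg (by omega), if_neg (by omega)]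

/-- The same residue applied to the other side of the identity gives the Adem coefficients. From `a
< p * b` and `p * j ≤ a` follows `j < b`, so the remaining exponent `(p - 1) (b - j) - 1` of `1 - w`
is a genuine natural number. -/
theorem coeff_residue_right {p : ℕ} [hp : Fact p.Prime] {R : Type*} [CommRing R] [CharP R p]
    {a b i j : ℕ} (hab : a < p * b) (hij : i + j = a + b) :
    PowerSeries.coeff a (((1 - PowerSeries.X : PowerSeries R) ^ (p - 1)) ^ i
      * (PowerSeries.X ^ p) ^ j * (PowerSeries.mk 1) ^ ((p - 1) * a + 1))
      = if j < a / p + 1 then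
        (-1) ^ (a + j) * (((p - 1) * (b - j) - 1).choose (a - p * j) : R) else 0 := by
  have hp1 := hp.out.one_lt
  rw [mul_right_comm, mul_comm, ← pow_mul, ← pow_mul, PowerSeries.coeff_X_pow_mul']
  have hiff : p * j ≤ a ↔ j < a / p + 1 := by
    rw [Nat.lt_succ_iff, Nat.le_div_iff_mul_le (by omega), mul_comm]
  by_cases h : p * j ≤ a
  · rw [if_pos h, if_pos (hiff.1 h)]
    have hjb : j < b := by
      by_contra hc
      have : p * b ≤ p * j := Nat.mul_le_mul_left p (by omega)
      omega
    have e : (p - 1) * i = ((p - 1) * a + 1) + ((p - 1) * (b - j) - 1) := by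
      have h1 : i = a + (b - j) := by omega
      have h2 : 1 ≤ (p - 1) * (b - j) := Nat.mul_pos (by omega) (by omega)
      rw [h1, mul_add]
      omega
    rw [e, one_sub_X_pow_mul_mk_one_pow', PowerSeries.coeff_one_sub_X_pow]
    congr 1
    rcases hp.out.eq_two_or_odd' with rfl | hodd
    · have : (-1 : R) = 1 := by
        have h2 : (2 : R) = 0 := by exact_mod_cast CharP.cast_eq_zero R 2
        linear_combination -h2
      rw [this, one_pow, one_pow]
    · obtain ⟨c, rfl⟩ := Nat.exists_eq_add_of_le h
      rw [Nat.add_sub_cancel_left, pow_add, pow_add, pow_mul, hodd.neg_one_pow,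
        mul_right_comm, ← pow_add, ← two_mul, pow_mul]
      simp
  · rw [if_neg h, if_neg fun h' => h (hiff.2 h')]

open Polynomial in
/-- If a two-parameter multiplicative family `Q` of operations satisfies the Bullett–Macdonald
identity, then its coefficients satisfy the Adem relations. -/
theorem adem_of_bullettMacdonald {p : ℕ} [Fact p.Prime] {R : Type*} [CommRing R]
    [Algebra (ZMod p) R] (Q : R →ₐ[ZMod p] R[X][X])
    (hQ : ∀ f, aevalAeval (R := R) (A := R[X][X]) (C (X * (1 - X) ^ (p - 1)) * X) X (Q f)
      = aevalAeval (R := R) (A := R[X][X]) (C ((1 - X) ^ (p - 1)) * X) (C (X ^ p) * X) (Q f))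
    {a b : ℕ} (hab : a < p * b) (f : R) :
    ((Q f).coeff b).coeff a = ∑ j ∈ Finset.range (a / p + 1),
      ((-1) ^ (a + j) * (((p - 1) * (b - j) - 1).choose (a - p * j) : ZMod p)) •
        ((Q f).coeff j).coeff (a + b - j) := by
  rcases subsingleton_or_nontrivial R with hR | hR
  · exact Subsingleton.elim _ _
  have _ : CharP R p := charP_of_injective_algebraMap (algebraMap (ZMod p) R).injective p
  -- The inner variable is `w`, the outer one scales both parameters. `Λ` takes the part of total
  -- degree `a + b` and then the residue in `w`. It isolates the left side of the Adem relation in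
  -- one substitution and the right side in the other.
  let Λ : R[X][X] → R := fun m => PowerSeries.coeff a
    ((m.coeff (a + b) : PowerSeries R) * (PowerSeries.mk 1) ^ ((p - 1) * a + 1))
  have hΛadd : ∀ m m', Λ (m + m') = Λ m + Λ m' := by
    intro m m'
    simp only [Λ, coeff_add, Polynomial.coe_add, add_mul, map_add]
  have hΛ : ∀ (r : R) (g : R[X]) (n : ℕ), Λ (r • (C g * X ^ n)) = if n = a + b then
      r * PowerSeries.coeff a ((g : PowerSeries R) * (PowerSeries.mk 1) ^ ((p - 1) * a + 1))
      else 0 := by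
    intro r g n
    simp only [Λ, coeff_smul, coeff_C_mul, coeff_X_pow]
    by_cases h : n = a + b
    · rw [if_pos h, if_pos h.symm, mul_one, Polynomial.coe_smul, smul_mul_assoc,
        PowerSeries.coeff_smul, smul_eq_mul]
    · rw [if_neg h, if_neg fun h' => h h'.symm]
      simp
  have h1 : ∀ P : R[X][X], Λ (aevalAeval (R := R) (A := R[X][X])
      (C (X * (1 - X) ^ (p - 1)) * X) X P) = (P.coeff b).coeff a := by
    intro P
    induction P using Polynomial.induction_on' with
    | add P P' h h' => simp only [map_add, hΛadd, h, h', coeff_add]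
    | monomial j g =>
      induction g using Polynomial.induction_on' with
      | add P P' h h' => simp only [map_add, hΛadd, h, h', coeff_add]
      | monomial i r =>
        have e : aevalAeval (R := R) (A := R[X][X]) (C (X * (1 - X) ^ (p - 1)) * X) X
            (monomial j (monomial i r))
            = r • (C ((X * (1 - X) ^ (p - 1)) ^ i) * X ^ (i + j)) := by
          rw [← C_mul_X_pow_eq_monomial, map_mul, map_pow, aevalAeval_C, aevalAeval_Y,
            aeval_monomial, Algebra.smul_def, mul_pow, C_pow, pow_add]
          ring
        rw [e, hΛ]
        have e2 := coeff_residue_left (p := p) (R := R) a i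
        simp only [Polynomial.coe_pow, Polynomial.coe_mul, Polynomial.coe_X, Polynomial.coe_sub,
          Polynomial.coe_one] at e2 ⊢
        rw [e2, coeff_monomial]
        by_cases hj : j = b
        · subst hj
          rw [if_pos rfl, coeff_monomial]
          by_cases hi : i = a
          · simp [hi]
          · simp [hi]
        · rw [if_neg hj]
          by_cases hi : i = a
          · rw [if_neg (by omega)]; simp
          · simp [hi]
  have h2 : ∀ P : R[X][X], Λ (aevalAeval (R := R) (A := R[X][X])
      (C ((1 - X) ^ (p - 1)) * X) (C (X ^ p) * X) P) = ∑ j ∈ Finset.range (a / p + 1),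
      ((-1) ^ (a + j) * (((p - 1) * (b - j) - 1).choose (a - p * j) : R)) *
        (P.coeff j).coeff (a + b - j) := by
    intro P
    induction P using Polynomial.induction_on' with
    | add P P' h h' => simp only [map_add, hΛadd, h, h', coeff_add, mul_add,
        Finset.sum_add_distrib]
    | monomial j g =>
      induction g using Polynomial.induction_on' with
      | add P P' h h' => simp only [map_add, hΛadd, h, h', coeff_add, mul_add,
          Finset.sum_add_distrib]
      | monomial i r =>
        have e : aevalAeval (R := R) (A := R[X][X]) (C ((1 - X) ^ (p - 1)) * X) (C (X ^ p) * X)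
            (monomial j (monomial i r))
            = r • (C (((1 - X) ^ (p - 1)) ^ i * (X ^ p) ^ j) * X ^ (i + j)) := by
          rw [← C_mul_X_pow_eq_monomial, map_mul,
            map_pow (aevalAeval (R := R) (A := R[X][X]) _ _), aevalAeval_C, aevalAeval_Y,
            aeval_monomial]
          simp only [Algebra.smul_def, mul_pow, C_mul, C_pow, pow_add]
          ring
        rw [e, hΛ]
        by_cases hij : i + j = a + b
        · have e2 := coeff_residue_right (p := p) (R := R) hab hij
          simp only [Polynomial.coe_pow, Polynomial.coe_mul, Polynomial.coe_X, Polynomial.coe_sub,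
            Polynomial.coe_one] at e2 ⊢
          rw [if_pos hij, e2]
          by_cases hj : j < a / p + 1
          · rw [if_pos hj, Finset.sum_eq_single j]
            · rw [coeff_monomial, if_pos rfl, coeff_monomial, if_pos (by omega)]
              ring
            · intro j' _ hne
              rw [coeff_monomial, if_neg (Ne.symm hne)]
              simp
            · intro hn
              exact absurd (Finset.mem_range.2 hj) hn
          · rw [if_neg hj, mul_zero, Finset.sum_eq_zero]
            intro j' hj'
            rw [coeff_monomial, if_neg]
            · simp
            · rintro rfl
              exact hj (Finset.mem_range.1 hj')
        · rw [if_neg hij, Finset.sum_eq_zero]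
          intro j' hj'
          rw [coeff_monomial]
          split_ifs with h
          · subst h
            rw [coeff_monomial, if_neg, mul_zero]
            have hj'' : j ≤ a / p := Nat.lt_succ_iff.1 (Finset.mem_range.1 hj')
            have := Nat.div_le_self a p
            omega
          · simp
  have h3 := h2 (Q f)
  rw [← hQ, h1] at h3
  rw [h3]
  refine Finset.sum_congr rfl fun j _ => ?_
  rw [Algebra.smul_def]
  simp

end Adem

end

noncomputable section

/-! ### The Steenrod powers as coefficients of multiplicative total operations -/

section CoeffOp

variable {k R : Type*} [CommRing k] [CommRing R] [Algebra k R]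

/-- The coefficient of `u ^ r` in a total operation `E : R → R[u]`. -/
def coeffOp (E : R →ₐ[k] Polynomial R) (r : ℕ) : R →ₗ[k] R :=
  ((Polynomial.lcoeff R r).restrictScalars k).comp E.toLinearMap

theorem coeffOp_apply (E : R →ₐ[k] Polynomial R) (r : ℕ) (f : R) :
    coeffOp E r f = (E f).coeff r := rfl

theorem coeffOp_mul (E : R →ₐ[k] Polynomial R) (r : ℕ) (f g : R) :
    coeffOp E r (f * g) = ∑ ij ∈ Finset.HasAntidiagonal.antidiagonal r,
      coeffOp E ij.1 f * coeffOp E ij.2 g := by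
  simp only [coeffOp_apply, map_mul, Polynomial.coeff_mul]

/-- The outer variable of the double operation records the operation that is applied first. -/
theorem coeffOp_comp (E : R →ₐ[k] Polynomial R) (i j : ℕ) (f : R) :
    coeffOp E i (coeffOp E j f)
      = (((Polynomial.mapAlgHom E).comp E f).coeff j).coeff i := by
  simp [coeffOp_apply]

theorem coeff_coeff_swap (P : Polynomial (Polynomial R)) (i j : ℕ) :
    ((Polynomial.Bivariate.swap P).coeff j).coeff i = (P.coeff i).coeff j := by
  induction P using Polynomial.induction_on' with
  | add P P' h h' => simp only [map_add, Polynomial.coeff_add, h, h']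
  | monomial a g =>
    induction g using Polynomial.induction_on' with
    | add P P' h h' => simp only [map_add, Polynomial.coeff_add, h, h']
    | monomial b r =>
      rw [Polynomial.Bivariate.swap_monomial_monomial]
      simp only [Polynomial.coeff_monomial]
      by_cases h1 : b = j <;> by_cases h2 : a = i <;> simp [h1, h2, Polynomial.coeff_monomial]

end CoeffOp

section Steenrod

variable {p : ℕ} [hp : Fact p.Prime]

/-- The two pairs of parameters have the same `α + β` and the same `α ^ p * β`, the only
combinations on which the double total operations below depend. -/
theorem bullettMacdonald_parameters {R : Type*} [CommRing R] [CharP R p] (w y : R) :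
    w * (1 - w) ^ (p - 1) * y + y = (1 - w) ^ (p - 1) * y + w ^ p * y ∧
    (w * (1 - w) ^ (p - 1) * y) ^ p * y = ((1 - w) ^ (p - 1) * y) ^ p * (w ^ p * y) := by
  constructor
  · have h : (1 - w) ^ (p - 1) * (1 - w) = 1 - w ^ p := by
      rw [← pow_succ, Nat.sub_add_cancel hp.out.one_lt.le, sub_pow_char, one_pow]
    linear_combination (-y) * h
  · ring

theorem MvPolynomial.aevalAeval_comp_ext {k : Type*} [CommRing k]
    (Q : MvPolynomial ℕ k →ₐ[k] Polynomial (Polynomial (MvPolynomial ℕ k)))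
    {α β α' β' : Polynomial (Polynomial (MvPolynomial ℕ k))}
    (h : ∀ i, Polynomial.aevalAeval (R := MvPolynomial ℕ k) α β (Q (MvPolynomial.X i))
      = Polynomial.aevalAeval (R := MvPolynomial ℕ k) α' β' (Q (MvPolynomial.X i)))
    (f : MvPolynomial ℕ k) : Polynomial.aevalAeval (R := MvPolynomial ℕ k) α β (Q f)
      = Polynomial.aevalAeval (R := MvPolynomial ℕ k) α' β' (Q f) := by
  induction f using MvPolynomial.induction_on with
  | C r =>
    have : Q (MvPolynomial.C r) = algebraMap (MvPolynomial ℕ k) _ (MvPolynomial.C r) :=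
      Q.commutes r
    rw [this, AlgHom.commutes, AlgHom.commutes]
  | add f g hf hg => simp only [map_add, hf, hg]
  | mul_X f i hf => simp only [map_mul, hf, h]

variable (p) in
/-- The total Steenrod power on polynomials. -/
def powerHom : MvPolynomial ℕ (ZMod p) →ₐ[ZMod p] Polynomial (MvPolynomial ℕ (ZMod p)) :=
  MvPolynomial.aeval fun i => Polynomial.C (MvPolynomial.X i) +
    Polynomial.X * Polynomial.C (MvPolynomial.X i ^ (p ^ 1))

theorem milnorOp_one (r : ℕ) : milnorOp p 1 r = coeffOp (powerHom p) r := rfl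

theorem powerHom_adem {a b : ℕ} (hab : a < p * b) :
    milnorOp p 1 a * milnorOp p 1 b = ∑ j ∈ Finset.range (a / p + 1),
      ((-1) ^ (a + j) * (((p - 1) * (b - j) - 1).choose (a - p * j) : ZMod p)) •
        (milnorOp p 1 (a + b - j) * milnorOp p 1 j) := by
  refine LinearMap.ext fun f => ?_
  rw [LinearMap.sum_apply]
  simp only [LinearMap.smul_apply, Module.End.mul_apply, milnorOp_one, coeffOp_comp]
  refine adem_of_bullettMacdonald _ (fun f => ?_) hab f
  -- The double operation sends `x` to `x + (α + β) x ^ p + α ^ p β x ^ (p ^ 2)`.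
  have key : ∀ α β : Polynomial (Polynomial (MvPolynomial ℕ (ZMod p))), ∀ i,
      Polynomial.aevalAeval (R := MvPolynomial ℕ (ZMod p)) α β
        ((Polynomial.mapAlgHom (powerHom p)).comp (powerHom p) (MvPolynomial.X i))
      = algebraMap _ _ (MvPolynomial.X i : MvPolynomial ℕ (ZMod p))
        + (α + β) * algebraMap _ _ (MvPolynomial.X i : MvPolynomial ℕ (ZMod p)) ^ p
        + α ^ p * β * (algebraMap _ _ (MvPolynomial.X i : MvPolynomial ℕ (ZMod p)) ^ p) ^ p := by
    intro α β i
    have e : powerHom p (MvPolynomial.X i) = Polynomial.C (MvPolynomial.X i) +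
      Polynomial.X * Polynomial.C (MvPolynomial.X i) ^ p := by
      rw [powerHom, MvPolynomial.aeval_X, pow_one, Polynomial.C_pow]
    simp only [AlgHom.comp_apply, e, map_add, map_mul, map_pow]
    simp only [Polynomial.coe_mapAlgHom, Polynomial.map_C, Polynomial.map_X, RingHom.coe_coe, e,
      Polynomial.aevalAeval_C, map_add, map_mul, map_pow, Polynomial.aevalAeval_Y,
      Polynomial.aeval_X, Polynomial.aeval_C]
    have hfr : ∀ x y : Polynomial (Polynomial (MvPolynomial ℕ (ZMod p))),
      (x + y) ^ p = x ^ p + y ^ p := fun x y => add_pow_char x y p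
    rw [hfr]
    ring
  refine MvPolynomial.aevalAeval_comp_ext _ (fun i => ?_) f
  refine (key _ _ i).trans (Eq.trans ?_ (key _ _ i).symm)
  have h := bullettMacdonald_parameters (p := p)
    (Polynomial.C (Polynomial.X) : Polynomial (Polynomial (MvPolynomial ℕ (ZMod p))))
    Polynomial.X
  simp only [Polynomial.C_mul, Polynomial.C_pow, Polynomial.C_sub, Polynomial.C_1]
  rw [h.1, h.2]

theorem milnorOp_one_zero : milnorOp p 1 0 = 1 := by
  have h : (Polynomial.constantCoeff.comp (powerHom p).toRingHom) = RingHom.id _ := by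
    apply MvPolynomial.ringHom_ext
    · intro r
      simp [powerHom]
    · intro i
      simp [powerHom]
  refine LinearMap.ext fun f => ?_
  exact RingHom.congr_fun h f

variable (p) in
/-- The dual Milnor generators `ξ_k`, with `ξ_0 = 1`. -/
def milnorXi : ℕ → MvPolynomial ℕ (ZMod p)
  | 0 => 1
  | k + 1 => MvPolynomial.X k

variable (p) in
/-- The total operation on the dual of the algebra of Steenrod powers given by pairing the left
hand factors of the coproduct with the powers `P ^ r`. -/
def dualHom : MvPolynomial ℕ (ZMod p) →ₐ[ZMod p] Polynomial (MvPolynomial ℕ (ZMod p)) :=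
  MvPolynomial.aeval fun i => Polynomial.C (MvPolynomial.X i) +
    Polynomial.X ^ (p ^ i) * Polynomial.C (milnorXi p i)

theorem dualHom_xi_zero : dualHom p (milnorXi p 0) = Polynomial.C (milnorXi p 0) := by
  simp [milnorXi]

theorem dualHom_xi_succ (k : ℕ) : dualHom p (milnorXi p (k + 1)) =
    Polynomial.C (milnorXi p (k + 1)) + Polynomial.X ^ (p ^ k) * Polynomial.C (milnorXi p k) := by
  rw [milnorXi, dualHom, MvPolynomial.aeval_X]

/-- The products are reversed because the Steenrod powers act on their dual from the right.
Accordingly the two variables of the double operation are exchanged before the Bullett–Macdonald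
identity is applied. -/
theorem dualHom_adem {a b : ℕ} (hab : a < p * b) :
    coeffOp (dualHom p) b * coeffOp (dualHom p) a = ∑ j ∈ Finset.range (a / p + 1),
      ((-1) ^ (a + j) * (((p - 1) * (b - j) - 1).choose (a - p * j) : ZMod p)) •
        (coeffOp (dualHom p) j * coeffOp (dualHom p) (a + b - j)) := by
  refine LinearMap.ext fun f => ?_
  rw [LinearMap.sum_apply]
  have hs : ∀ i j, coeffOp (dualHom p) j (coeffOp (dualHom p) i f)
      = ((((Polynomial.Bivariate.swap (R := MvPolynomial ℕ (ZMod p))).toAlgHom.restrictScalars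
          (ZMod p)).comp
        ((Polynomial.mapAlgHom (dualHom p)).comp (dualHom p)) f).coeff j).coeff i := by
    intro i j
    rw [coeffOp_comp]
    exact (coeff_coeff_swap _ _ _).symm
  simp only [LinearMap.smul_apply, Module.End.mul_apply, hs]
  refine adem_of_bullettMacdonald _ (fun f => ?_) hab f
  have key : ∀ α β : Polynomial (Polynomial (MvPolynomial ℕ (ZMod p))), ∀ i,
      Polynomial.aevalAeval (R := MvPolynomial ℕ (ZMod p)) α β
        (((Polynomial.Bivariate.swap (R := MvPolynomial ℕ (ZMod p))).toAlgHom.restrictScalars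
          (ZMod p)).comp
        ((Polynomial.mapAlgHom (dualHom p)).comp (dualHom p)) (MvPolynomial.X i))
      = algebraMap _ _ (milnorXi p (i + 1))
        + (α + β) ^ p ^ i * algebraMap _ _ (milnorXi p i)
        + (if i = 0 then 0 else
          (α ^ p * β) ^ p ^ (i - 1) * algebraMap _ _ (milnorXi p (i - 1))) := by
    intro α β i
    have e1 : ∀ P : Polynomial (Polynomial (MvPolynomial ℕ (ZMod p))),
      Polynomial.aevalAeval (R := MvPolynomial ℕ (ZMod p)) α β
        (((Polynomial.Bivariate.swap (R := MvPolynomial ℕ (ZMod p))).toAlgHom.restrictScalars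
          (ZMod p)) P) = Polynomial.aevalAeval (R := MvPolynomial ℕ (ZMod p)) β α P :=
      fun P => Polynomial.Bivariate.aevalAeval_swap _ _ _
    rw [AlgHom.comp_apply, e1]
    change Polynomial.aevalAeval (R := MvPolynomial ℕ (ZMod p)) β α
      (Polynomial.mapAlgHom (dualHom p) (dualHom p (milnorXi p (i + 1)))) = _
    have hfr : ∀ x y : Polynomial (Polynomial (MvPolynomial ℕ (ZMod p))),
      (x + y) ^ p ^ i = x ^ p ^ i + y ^ p ^ i := fun x y => add_pow_char_pow x y p i
    rw [dualHom_xi_succ, hfr]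
    simp only [map_add, map_mul, map_pow]
    simp only [Polynomial.coe_mapAlgHom, Polynomial.map_C, Polynomial.map_X, RingHom.coe_coe,
      dualHom_xi_succ]
    cases i with
    | zero =>
      rw [dualHom_xi_zero, if_pos rfl]
      simp only [Polynomial.aevalAeval_C, map_add, map_mul, map_pow, Polynomial.aevalAeval_Y,
        Polynomial.aeval_X, Polynomial.aeval_C]
      ring
    | succ i =>
      rw [dualHom_xi_succ, if_neg (Nat.succ_ne_zero i), Nat.add_sub_cancel]
      simp only [Polynomial.aevalAeval_C, map_add, map_mul, map_pow, Polynomial.aevalAeval_Y,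
        Polynomial.aeval_X, Polynomial.aeval_C]
      ring
  refine MvPolynomial.aevalAeval_comp_ext _ (fun i => ?_) f
  refine (key _ _ i).trans (Eq.trans ?_ (key _ _ i).symm)
  have h := bullettMacdonald_parameters (p := p)
    (Polynomial.C (Polynomial.X) : Polynomial (Polynomial (MvPolynomial ℕ (ZMod p))))
    Polynomial.X
  simp only [Polynomial.C_mul, Polynomial.C_pow, Polynomial.C_sub, Polynomial.C_1]
  rw [h.1, h.2]

theorem coeffOp_dualHom_zero : coeffOp (dualHom p) 0 = 1 := by
  have h : (Polynomial.constantCoeff.comp (dualHom p).toRingHom) = RingHom.id _ := by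
    apply MvPolynomial.ringHom_ext
    · intro r
      simp [dualHom]
    · intro i
      have : 0 ≠ p ^ i := (pow_ne_zero _ hp.out.ne_zero).symm
      simp [dualHom, this]
  refine LinearMap.ext fun f => ?_
  exact RingHom.congr_fun h f

/-! ### The universal property, the two actions and the pairing with the dual. -/

namespace SteenrodPowers

/-- The universal property of the algebra of Steenrod powers. -/
def lift {B : Type*} [Ring B] [Algebra (ZMod p) B] (P : ℕ → B) (h0 : P 0 = 1)
    (h : ∀ a b, a < p * b → P a * P b = ∑ j ∈ Finset.range (a / p + 1),
      ((-1) ^ (a + j) * (((p - 1) * (b - j) - 1).choose (a - p * j) : ZMod p)) •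
        (P (a + b - j) * P j)) : SteenrodPowers p →ₐ[ZMod p] B :=
  RingQuot.liftAlgHom (ZMod p) ⟨FreeAlgebra.lift (ZMod p) P, by
    intro x y hxy
    cases hxy with
    | zero => simp [h0]
    | adem a b hab =>
      simp only [map_mul, map_sum, map_smul, FreeAlgebra.lift_ι_apply]
      exact h a b hab⟩

theorem lift_steenrodP {B : Type*} [Ring B] [Algebra (ZMod p) B] (P : ℕ → B) (h0 : P 0 = 1)
    (h) (r : ℕ) : lift P h0 h (steenrodP p r) = P r := by
  refine (RingQuot.liftAlgHom_mkAlgHom_apply (ZMod p) _ _ _).trans ?_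
  exact FreeAlgebra.lift_ι_apply _ _

theorem algHom_ext {B : Type*} [Ring B] [Algebra (ZMod p) B] {f g : SteenrodPowers p →ₐ[ZMod p] B}
    (h : ∀ r, f (steenrodP p r) = g (steenrodP p r)) : f = g := by
  refine RingQuot.ringQuot_ext' (ZMod p) (s := AdemRel p) f g ?_
  refine FreeAlgebra.hom_ext ?_
  funext r
  exact h r

theorem steenrodP_zero : steenrodP p 0 = 1 := by
  rw [steenrodP, RingQuot.mkAlgHom_rel (ZMod p) AdemRel.zero, map_one]
  rfl

theorem adem {a b : ℕ} (hab : a < p * b) :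
    steenrodP p a * steenrodP p b = ∑ j ∈ Finset.range (a / p + 1),
      ((-1) ^ (a + j) * (((p - 1) * (b - j) - 1).choose (a - p * j) : ZMod p)) •
        (steenrodP p (a + b - j) * steenrodP p j) := by
  have := RingQuot.mkAlgHom_rel (ZMod p) (AdemRel.adem a b hab)
  simp only [map_mul, map_sum, map_smul] at this
  exact this

variable (p) in
/-- The action of the Steenrod powers on polynomials. -/
def rho : SteenrodPowers p →ₐ[ZMod p] Module.End (ZMod p) (MvPolynomial ℕ (ZMod p)) :=
  lift (fun r => milnorOp p 1 r) milnorOp_one_zero fun _ _ => powerHom_adem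

theorem rho_steenrodP (r : ℕ) : rho p (steenrodP p r) = milnorOp p 1 r := lift_steenrodP _ _ _ r

variable (p) in
/-- The right action of the Steenrod powers on their dual. -/
def dualAction :
    SteenrodPowers p →ₐ[ZMod p] (Module.End (ZMod p) (MvPolynomial ℕ (ZMod p)))ᵐᵒᵖ :=
  lift (fun r => MulOpposite.op (coeffOp (dualHom p) r)) (by rw [coeffOp_dualHom_zero]; rfl) (by
    intro a b hab
    rw [← MulOpposite.op_mul, dualHom_adem hab]
    exact map_sum (MulOpposite.opLinearEquiv (ZMod p)) _ _)

theorem dualAction_steenrodP (r : ℕ) :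
    (dualAction p (steenrodP p r)).unop = coeffOp (dualHom p) r := by
  rw [dualAction, lift_steenrodP, MulOpposite.unop_op]

theorem dualAction_mul (x y : SteenrodPowers p) (f : MvPolynomial ℕ (ZMod p)) :
    (dualAction p (x * y)).unop f = (dualAction p y).unop ((dualAction p x).unop f) := by
  rw [map_mul, MulOpposite.unop_mul, Module.End.mul_apply]

variable (p) in
/-- The pairing of the Steenrod powers with their dual. -/
def pair : SteenrodPowers p →ₗ[ZMod p] MvPolynomial ℕ (ZMod p) →ₗ[ZMod p] ZMod p :=
  LinearMap.mk₂ (ZMod p)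
    (fun x f => MvPolynomial.aeval (fun _ : ℕ => (0 : ZMod p)) ((dualAction p x).unop f))
    (fun x y f => by simp) (fun c x f => by simp) (fun x f g => by simp) (fun c x f => by simp)

theorem pair_apply (x : SteenrodPowers p) (f : MvPolynomial ℕ (ZMod p)) :
    pair p x f = MvPolynomial.aeval (fun _ : ℕ => (0 : ZMod p)) ((dualAction p x).unop f) := rfl

theorem pair_mul (x y : SteenrodPowers p) (f : MvPolynomial ℕ (ZMod p)) :
    pair p (x * y) f = pair p y ((dualAction p x).unop f) := by
  rw [pair_apply, dualAction_mul, ← pair_apply]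

theorem pair_one (f : MvPolynomial ℕ (ZMod p)) :
    pair p 1 f = MvPolynomial.aeval (fun _ : ℕ => (0 : ZMod p)) f := by
  rw [pair_apply, map_one]; rfl

theorem pair_steenrodP_mul (r : ℕ) (y : SteenrodPowers p) (f : MvPolynomial ℕ (ZMod p)) :
    pair p (steenrodP p r * y) f = pair p y (coeffOp (dualHom p) r f) := by
  rw [pair_mul, dualAction_steenrodP]

end SteenrodPowers

end Steenrod

end

noncomputable section

/-! ### Admissible monomials -/

namespace SteenrodPowers

section Admissible

variable {p : ℕ} [hp : Fact p.Prime]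

variable (p) in
/-- The product of the powers `P ^ r` for `r` in a list. -/
def word (l : List ℕ) : SteenrodPowers p := (l.map (steenrodP p)).prod

theorem word_nil : word p [] = 1 := rfl

theorem word_cons (a : ℕ) (l : List ℕ) : word p (a :: l) = steenrodP p a * word p l := by
  simp [word]

theorem word_append (l m : List ℕ) : word p (l ++ m) = word p l * word p m := by
  simp [word]

theorem word_replicate_zero (n : ℕ) : word p (List.replicate n 0) = 1 := by
  simp [word, steenrodP_zero]

theorem exists_freeAlgebra (x : SteenrodPowers p) : ∃ y : FreeAlgebra (ZMod p) ℕ,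
    FreeAlgebra.lift (ZMod p) (steenrodP p) y = x := by
  obtain ⟨y, hy⟩ := RingQuot.mkAlgHom_surjective (ZMod p) (AdemRel p) x
  refine ⟨y, ?_⟩
  have : FreeAlgebra.lift (ZMod p) (steenrodP p) = RingQuot.mkAlgHom (ZMod p) (AdemRel p) := by
    refine FreeAlgebra.hom_ext ?_
    funext r
    exact FreeAlgebra.lift_ι_apply _ _
  rw [← hy, ← this]
  rfl

theorem span_word : Submodule.span (ZMod p) (Set.range (word p)) = ⊤ := by
  rw [eq_top_iff]
  rintro x -
  obtain ⟨y, rfl⟩ := exists_freeAlgebra x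
  induction y using FreeAlgebra.induction with
  | grade0 r =>
    rw [AlgHom.commutes, Algebra.algebraMap_eq_smul_one]
    exact Submodule.smul_mem _ _ (Submodule.subset_span ⟨[], rfl⟩)
  | grade1 r =>
    rw [FreeAlgebra.lift_ι_apply]
    exact Submodule.subset_span ⟨[r], by simp [word]⟩
  | add x y hx hy => rw [map_add]; exact add_mem hx hy
  | mul x y hx hy =>
    rw [map_mul]
    have := Submodule.mul_mem_mul hx hy
    rw [Submodule.span_mul_span] at this
    refine Submodule.span_mono ?_ this
    rintro _ ⟨_, ⟨l, rfl⟩, _, ⟨m, rfl⟩, rfl⟩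
    exact ⟨l ++ m, word_append l m⟩

@[elab_as_elim]
theorem word_induction {P : SteenrodPowers p → Prop} (x : SteenrodPowers p) (h0 : P 0)
    (hw : ∀ l, P (word p l)) (hadd : ∀ x y, P x → P y → P (x + y))
    (hsmul : ∀ (c : ZMod p) x, P x → P (c • x)) : P x := by
  have hx : x ∈ Submodule.span (ZMod p) (Set.range (word p)) := by rw [span_word]; trivial
  induction hx using Submodule.span_induction with
  | mem x hx => obtain ⟨l, rfl⟩ := hx; exact hw l
  | zero => exact h0
  | add x y _ _ hx hy => exact hadd x y hx hy
  | smul c x _ hx => exact hsmul c x hx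

/-- The moment of a list of exponents. -/
def moment : List ℕ → ℕ
  | [] => 0
  | _ :: l => moment l + l.sum

theorem moment_append (l m : List ℕ) :
    moment (l ++ m) = moment l + l.length * m.sum + moment m := by
  induction l with
  | nil => simp [moment]
  | cons a l ih =>
    simp only [List.cons_append, moment, ih, List.sum_append, List.length_cons]
    ring

variable (p) in
/-- Admissible sequences of exponents. -/
def Admissible (l : List ℕ) : Prop := l.IsChain fun a b => p * b ≤ a

theorem exists_of_not_admissible {l : List ℕ} (h : ¬ Admissible p l) :
    ∃ l₁ a b l₂, l = l₁ ++ a :: b :: l₂ ∧ a < p * b := by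
  induction l with
  | nil => exact absurd List.IsChain.nil h
  | cons a l ih =>
    cases l with
    | nil => exact absurd (List.IsChain.singleton a) h
    | cons b l =>
      by_cases hab : p * b ≤ a
      · have h' : ¬ Admissible p (b :: l) := fun hc => h (List.isChain_cons_cons.2 ⟨hab, hc⟩)
        obtain ⟨l₁, a', b', l₂, h1, h2⟩ := ih h'
        exact ⟨a :: l₁, a', b', l₂, by rw [h1]; rfl, h2⟩
      · exact ⟨[], a, b, l, rfl, by omega⟩

variable (p) in
/-- The span of the admissible monomials of length `n`. -/
def admissibleSpan (n : ℕ) : Submodule (ZMod p) (SteenrodPowers p) :=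
  Submodule.span (ZMod p) (word p '' {l | Admissible p l ∧ l.length = n})

/-- An Adem relation keeps the length and the sum of the exponents but replaces the second exponent
`b` by some `j < b`, so the moment decreases. Keeping the length fixed requires admissible sequences
that may end in zeros. -/
theorem word_mem_admissibleSpan (l : List ℕ) : word p l ∈ admissibleSpan p l.length := by
  induction hm : moment l using Nat.strong_induction_on generalizing l with
  | _ m ih =>
    by_cases h : Admissible p l
    · exact Submodule.subset_span ⟨l, ⟨h, rfl⟩, rfl⟩
    · obtain ⟨l₁, a, b, l₂, rfl, hab⟩ := exists_of_not_admissible h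
      rw [word_append, word_cons, word_cons, ← mul_assoc (steenrodP p a), adem hab,
        Finset.sum_mul, Finset.mul_sum]
      refine Submodule.sum_mem _ fun j hj => ?_
      rw [smul_mul_assoc, mul_smul_comm, mul_assoc, ← word_cons, ← word_cons, ← word_append]
      refine Submodule.smul_mem _ _ ?_
      have hja : j * p ≤ a := by
        rw [← Nat.le_div_iff_mul_le hp.out.pos]
        exact Nat.lt_succ_iff.1 (Finset.mem_range.1 hj)
      have hjb : j < b := by
        by_contra hc
        have : p * b ≤ p * j := Nat.mul_le_mul_left p (by omega)
        rw [mul_comm p j] at this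
        omega
      have hlen : (l₁ ++ a :: b :: l₂).length = (l₁ ++ (a + b - j) :: j :: l₂).length := by simp
      rw [hlen]
      refine ih _ ?_ _ rfl
      rw [← hm, moment_append, moment_append]
      have hs : ((a + b - j) :: j :: l₂).sum = (a :: b :: l₂).sum := by
        simp only [List.sum_cons]
        omega
      rw [hs]
      simp only [moment, List.sum_cons]
      omega

/-- Pad with `P ^ 0 = 1`. -/
theorem word_mem_admissibleSpan_of_le {n : ℕ} (l : List ℕ) (h : l.length ≤ n) :
    word p l ∈ admissibleSpan p n := by
  have := word_mem_admissibleSpan (p := p) (l ++ List.replicate (n - l.length) 0)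
  rw [word_append, word_replicate_zero, mul_one] at this
  convert this using 2
  simp
  omega

theorem exists_mem_admissibleSpan (x : SteenrodPowers p) :
    ∃ n, ∀ m, n ≤ m → x ∈ admissibleSpan p m := by
  induction x using word_induction with
  | h0 => exact ⟨0, fun m _ => zero_mem _⟩
  | hw l => exact ⟨l.length, fun m hm => word_mem_admissibleSpan_of_le l hm⟩
  | hadd x y hx hy =>
    obtain ⟨n, hn⟩ := hx
    obtain ⟨n', hn'⟩ := hy
    exact ⟨max n n', fun m hm => add_mem (hn m (le_trans (le_max_left _ _) hm))
      (hn' m (le_trans (le_max_right _ _) hm))⟩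
  | hsmul c x hx =>
    obtain ⟨n, hn⟩ := hx
    exact ⟨n, fun m hm => Submodule.smul_mem _ _ (hn m hm)⟩

variable (p) in
/-- The monomial of the dual corresponding to an admissible sequence, with indices shifted
by `s`. -/
def dualMonomial : ℕ → List ℕ → MvPolynomial ℕ (ZMod p)
  | _, [] => 1
  | s, a :: l => milnorXi p s ^ (a - p * l.headD 0) * dualMonomial (s + 1) l

theorem dualHom_xi_natDegree (s : ℕ) :
    (dualHom p (milnorXi p (s + 1))).natDegree ≤ p ^ s ∧
    (dualHom p (milnorXi p (s + 1))).coeff (p ^ s) = milnorXi p s := by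
  rw [dualHom_xi_succ]
  have h0 : p ^ s ≠ 0 := pow_ne_zero _ hp.out.ne_zero
  constructor
  · refine Polynomial.natDegree_add_le_of_degree_le ?_ ?_
    · simp
    · exact (Polynomial.natDegree_mul_C_le _ _).trans (Polynomial.natDegree_X_pow_le _)
  · rw [Polynomial.coeff_add, Polynomial.coeff_C, if_neg h0, zero_add, Polynomial.coeff_mul_C,
      Polynomial.coeff_X_pow, if_pos rfl, one_mul]

/-- The top term of the total operation on `ξ_{k+1}` is `u ^ (p ^ k) ξ_k`. On the monomial all
indices therefore drop by one, and the exponents of `u` telescope to `p ^ s` times the first entry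
of `l`. -/
theorem dualHom_dualMonomial (s : ℕ) (l : List ℕ) (hl : Admissible p l) :
    (dualHom p (dualMonomial p (s + 1) l)).natDegree ≤ p ^ s * l.headD 0 ∧
    (dualHom p (dualMonomial p (s + 1) l)).coeff (p ^ s * l.headD 0) = dualMonomial p s l := by
  induction l generalizing s with
  | nil => simp [dualMonomial]
  | cons a l ih =>
    have hl' : Admissible p l := List.IsChain.tail hl
    have hle : p * l.headD 0 ≤ a := by
      cases l with
      | nil => simp
      | cons b l => exact (List.isChain_cons_cons.1 hl).1
    obtain ⟨h1, h2⟩ := ih (s + 1) hl'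
    obtain ⟨h3, h4⟩ := dualHom_xi_natDegree (p := p) s
    have e : p ^ s * a = (a - p * l.headD 0) * p ^ s + p ^ (s + 1) * l.headD 0 := by
      obtain ⟨c, hc⟩ := Nat.exists_eq_add_of_le hle
      rw [hc, Nat.add_sub_cancel_left]
      ring
    rw [dualMonomial, map_mul, map_pow, List.headD_cons, e]
    have h5 : (dualHom p (milnorXi p (s + 1)) ^ (a - p * l.headD 0)).natDegree
        ≤ (a - p * l.headD 0) * p ^ s := Polynomial.natDegree_pow_le_of_le _ h3
    refine ⟨Polynomial.natDegree_mul_le_of_le h5 h1, ?_⟩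
    rw [Polynomial.coeff_mul_add_eq_of_natDegree_le h5 h1, h2,
      Polynomial.coeff_pow_of_natDegree_le h3, h4, dualMonomial]

/-- Triangularity of the pairing in the lexicographic order: the first entry of `l` is the degree of
the total operation, larger powers vanish, and the power of that degree strips the first entry
because `ξ_0 = 1`. -/
theorem pair_word_dualMonomial (l : List ℕ) (hl : Admissible p l) :
    pair p (word p l) (dualMonomial p 1 l) = 1 ∧
    ∀ l' : List ℕ, l'.length = l.length → l < l' → pair p (word p l') (dualMonomial p 1 l) = 0 := by
  induction l with
  | nil =>
    refine ⟨?_, ?_⟩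
    · rw [word_nil, pair_one, dualMonomial, map_one]
    · intro l' hl' hlt
      rw [List.eq_nil_of_length_eq_zero hl'] at hlt
      exact absurd hlt (lt_irrefl _)
  | cons a l ih =>
    have hl' : Admissible p l := List.IsChain.tail hl
    obtain ⟨h1, h2⟩ := ih hl'
    obtain ⟨h3, h4⟩ := dualHom_dualMonomial 0 (a :: l) hl
    rw [zero_add, pow_zero, one_mul, List.headD_cons] at h3 h4
    have h5 : dualMonomial p 0 (a :: l) = dualMonomial p 1 l := by
      rw [dualMonomial, milnorXi, one_pow, one_mul]
    rw [h5] at h4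
    refine ⟨?_, ?_⟩
    · rw [word_cons, pair_steenrodP_mul, coeffOp_apply, h4, h1]
    · rintro (_ | ⟨b, l'⟩) hlen hlt
      · simp at hlen
      · rw [word_cons, pair_steenrodP_mul, coeffOp_apply]
        rcases List.cons_lt_cons_iff.1 hlt with hab | ⟨rfl, hlt'⟩
        · rw [Polynomial.coeff_eq_zero_of_natDegree_lt (lt_of_le_of_lt h3 hab), map_zero]
        · rw [h4]
          exact h2 l' (by simpa using hlen) hlt'

/-- The monomial dual to the smallest admissible sequence occurring in `x` detects its coefficient.
This replaces any appeal to the linear independence of admissible monomials. -/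
theorem eq_zero_of_pair {x : SteenrodPowers p} (hx : ∀ f, pair p x f = 0) : x = 0 := by
  obtain ⟨n, hn⟩ := exists_mem_admissibleSpan x
  have hmem := hn n le_rfl
  rw [admissibleSpan, Finsupp.mem_span_image_iff_linearCombination] at hmem
  obtain ⟨c, hc, rfl⟩ := hmem
  have hc' : ∀ l ∈ c.support, Admissible p l ∧ l.length = n := fun l hl => hc hl
  suffices c.support = ∅ by
    rw [Finsupp.support_eq_empty] at this
    rw [this, map_zero]
  by_contra hne
  obtain ⟨l, hl, hmin⟩ := Finset.exists_min_image c.support id (Finset.nonempty_iff_ne_empty.2 hne)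
  obtain ⟨h1, h2⟩ := pair_word_dualMonomial l (hc' l hl).1
  have h := hx (dualMonomial p 1 l)
  rw [Finsupp.linearCombination_apply, Finsupp.sum, map_sum, LinearMap.sum_apply,
    Finset.sum_eq_single l] at h
  · rw [map_smul, LinearMap.smul_apply, h1, smul_eq_mul, mul_one] at h
    exact (Finsupp.mem_support_iff.1 hl) h
  · intro l' hl' hne'
    rw [map_smul, LinearMap.smul_apply, h2 l', smul_zero]
    · rw [(hc' l hl).2, (hc' l' hl').2]
    · exact lt_of_le_of_ne (hmin l' hl') (Ne.symm hne')
  · intro h'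
    exact absurd hl h'

end Admissible

end SteenrodPowers

end

noncomputable section

/-! ### The Hopf algebra of Steenrod powers -/

/-- An injective pairing of `V` with `M` induces an injective pairing of `V ⊗ V` with `M × M`. -/
theorem TensorProduct.eq_zero_of_pairing {k V M : Type*} [Field k] [AddCommGroup V] [Module k V]
    [AddCommGroup M] [Module k M] (π : V →ₗ[k] M →ₗ[k] k)
    (hπ : ∀ x, (∀ f, π x f = 0) → x = 0) {t : V ⊗[k] V}
    (ht : ∀ f g, LinearMap.mul' k k (TensorProduct.map (π.flip f) (π.flip g) t) = 0) : t = 0 := by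
  let b := Module.Basis.ofVectorSpace k V
  have h1 : ∀ f, TensorProduct.lid k V (TensorProduct.map (π.flip f) LinearMap.id t) = 0 := by
    intro f
    refine hπ _ fun g => ?_
    have e : ∀ s : V ⊗[k] V, π (TensorProduct.lid k V
        (TensorProduct.map (π.flip f) LinearMap.id s)) g
        = LinearMap.mul' k k (TensorProduct.map (π.flip f) (π.flip g) s) := by
      intro s
      induction s with
      | zero => simp
      | tmul x y => simp
      | add s s' h h' => simp only [map_add, LinearMap.add_apply, h, h']
    rw [e, ht]
  obtain ⟨c, rfl⟩ := TensorProduct.eq_repr_basis_right b t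
  have h2 : ∀ i, c i = 0 := by
    intro i
    refine hπ _ fun f => ?_
    have h := h1 f
    rw [Finsupp.sum, map_sum, map_sum] at h
    simp only [TensorProduct.map_tmul, TensorProduct.lid_tmul, LinearMap.id_apply] at h
    by_cases hi : i ∈ c.support
    · exact linearIndependent_iff'.1 b.linearIndependent c.support (fun i => π (c i) f) h i hi
    · rw [Finsupp.notMem_support_iff.1 hi, map_zero, LinearMap.zero_apply]
  have : c = 0 := Finsupp.ext h2
  rw [this, Finsupp.sum_zero_index]

namespace SteenrodPowers

variable {p : ℕ} [hp : Fact p.Prime]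

variable (p) in
/-- The pairing of `A ⊗ A` with two elements of the dual. -/
def pairTwo (f g : MvPolynomial ℕ (ZMod p)) :
    SteenrodPowers p ⊗[ZMod p] SteenrodPowers p →ₗ[ZMod p] ZMod p :=
  (LinearMap.mul' (ZMod p) (ZMod p)).comp
    (TensorProduct.map ((pair p).flip f) ((pair p).flip g))

theorem pairTwo_tmul (f g : MvPolynomial ℕ (ZMod p)) (x y : SteenrodPowers p) :
    pairTwo p f g (x ⊗ₜ y) = pair p x f * pair p y g := rfl

theorem pairTwo_steenrodP_mul (f g : MvPolynomial ℕ (ZMod p)) (i j : ℕ)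
    (t : SteenrodPowers p ⊗[ZMod p] SteenrodPowers p) :
    pairTwo p f g ((steenrodP p i ⊗ₜ steenrodP p j) * t)
      = pairTwo p (coeffOp (dualHom p) i f) (coeffOp (dualHom p) j g) t := by
  induction t with
  | zero => simp
  | tmul x y =>
    rw [Algebra.TensorProduct.tmul_mul_tmul, pairTwo_tmul, pairTwo_tmul, pair_steenrodP_mul,
      pair_steenrodP_mul]
  | add s t hs ht => simp only [mul_add, map_add, hs, ht]

variable (p) in
/-- The coproduct on the free algebra. -/
def freeComul :
    FreeAlgebra (ZMod p) ℕ →ₐ[ZMod p] SteenrodPowers p ⊗[ZMod p] SteenrodPowers p :=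
  FreeAlgebra.lift (ZMod p) fun r => ∑ ij ∈ Finset.HasAntidiagonal.antidiagonal r,
    steenrodP p ij.1 ⊗ₜ[ZMod p] steenrodP p ij.2

variable (p) in
/-- The projection from the free algebra. -/
def freeProj : FreeAlgebra (ZMod p) ℕ →ₐ[ZMod p] SteenrodPowers p :=
  RingQuot.mkAlgHom (ZMod p) (AdemRel p)

theorem freeProj_ι (r : ℕ) : freeProj p (FreeAlgebra.ι (ZMod p) r) = steenrodP p r := rfl

/-- The coproduct is adjoint to the multiplication of the dual, because each total operation is
multiplicative. With nondegeneracy of the pairing this forces the coproduct to respect the Adem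
relations. -/
theorem pairTwo_freeComul (w : FreeAlgebra (ZMod p) ℕ) (f g : MvPolynomial ℕ (ZMod p)) :
    pairTwo p f g (freeComul p w) = pair p (freeProj p w) (f * g) := by
  -- An arbitrary right factor `v` is carried along, since the pairing formulas only strip
  -- generators from the left.
  have key : ∀ v : FreeAlgebra (ZMod p) ℕ,
      (∀ f g, pairTwo p f g (freeComul p v) = pair p (freeProj p v) (f * g)) →
      ∀ f g, pairTwo p f g (freeComul p (w * v)) = pair p (freeProj p (w * v)) (f * g) := by
    induction w using FreeAlgebra.induction with
    | grade0 c =>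
      intro v hv f g
      rw [← Algebra.smul_def, map_smul, map_smul, map_smul, map_smul, hv]
      rfl
    | grade1 r =>
      intro v hv f g
      rw [map_mul (freeComul p), map_mul (freeProj p), freeProj_ι, pair_steenrodP_mul, coeffOp_mul, map_sum, freeComul,
        FreeAlgebra.lift_ι_apply, ← freeComul, Finset.sum_mul, map_sum]
      refine Finset.sum_congr rfl fun ij _ => ?_
      rw [pairTwo_steenrodP_mul, hv]
    | add x y hx hy =>
      intro v hv f g
      simp only [add_mul, map_add, LinearMap.add_apply, hx v hv, hy v hv]
    | mul x y hx hy =>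
      intro v hv f g
      rw [mul_assoc]
      exact hx _ (hy v hv) f g
  have := key 1 (fun f g => by
    rw [map_one (freeComul p), map_one (freeProj p), pair_one, map_mul, Algebra.TensorProduct.one_def, pairTwo_tmul,
      pair_one, pair_one]) f g
  rwa [mul_one] at this

variable (p) in
/-- The coproduct of the algebra of Steenrod powers. -/
def comul : SteenrodPowers p →ₐ[ZMod p] SteenrodPowers p ⊗[ZMod p] SteenrodPowers p :=
  RingQuot.liftAlgHom (ZMod p) ⟨freeComul p, by
    intro x y hxy
    rw [← sub_eq_zero]
    -- Related elements have the same image in the algebra, so their coproducts have the same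
    -- pairings and cannot differ.
    refine TensorProduct.eq_zero_of_pairing (pair p) (fun x hx => eq_zero_of_pair hx)
      fun f g => ?_
    change pairTwo p f g _ = 0
    rw [map_sub, pairTwo_freeComul, pairTwo_freeComul, sub_eq_zero]
    have : freeProj p x = freeProj p y := RingQuot.mkAlgHom_rel (ZMod p) hxy
    rw [this]⟩

theorem comul_steenrodP (r : ℕ) : comul p (steenrodP p r) =
    ∑ ij ∈ Finset.HasAntidiagonal.antidiagonal r,
      steenrodP p ij.1 ⊗ₜ[ZMod p] steenrodP p ij.2 := by
  refine (RingQuot.liftAlgHom_mkAlgHom_apply (ZMod p) _ _ _).trans ?_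
  exact FreeAlgebra.lift_ι_apply _ _

variable (p) in
/-- The counit of the algebra of Steenrod powers. -/
def counit : SteenrodPowers p →ₐ[ZMod p] ZMod p :=
  lift (fun r => if r = 0 then 1 else 0) (if_pos rfl) (by
    intro a b hab
    have hb : b ≠ 0 := by rintro rfl; simp at hab
    rw [if_neg hb, mul_zero, Finset.sum_eq_zero]
    intro j hj
    have hj' : j ≤ a / p := Nat.lt_succ_iff.1 (Finset.mem_range.1 hj)
    have := Nat.div_le_self a p
    rw [if_neg (by omega), zero_mul, smul_zero])

theorem counit_steenrodP (r : ℕ) : counit p (steenrodP p r) = if r = 0 then 1 else 0 :=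
  lift_steenrodP _ _ _ r

theorem comul_coassoc : (Algebra.TensorProduct.assoc (ZMod p) (ZMod p) (ZMod p)
      (SteenrodPowers p) (SteenrodPowers p) (SteenrodPowers p)).toAlgHom.comp
      ((Algebra.TensorProduct.map (comul p) (.id (ZMod p) (SteenrodPowers p))).comp (comul p))
      = (Algebra.TensorProduct.map (.id (ZMod p) (SteenrodPowers p)) (comul p)).comp
        (comul p) := by
  refine algHom_ext fun r => ?_
  simp only [AlgHom.comp_apply, comul_steenrodP, map_sum, Algebra.TensorProduct.map_tmul,
    AlgHom.id_apply, TensorProduct.sum_tmul, TensorProduct.tmul_sum, AlgEquiv.coe_toAlgHom,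
    Algebra.TensorProduct.assoc_tmul]
  rw [Finset.sum_sigma', Finset.sum_sigma']
  refine Finset.sum_nbij' (fun x => ⟨(x.2.1, x.2.2 + x.1.2), (x.2.2, x.1.2)⟩)
    (fun x => ⟨(x.1.1 + x.2.1, x.2.2), (x.1.1, x.2.1)⟩) ?_ ?_ ?_ ?_ ?_
  · rintro ⟨⟨i, j⟩, ⟨a, b⟩⟩ h
    simp only [Finset.mem_sigma, Finset.HasAntidiagonal.mem_antidiagonal] at h ⊢
    obtain ⟨rfl, rfl⟩ := h
    exact ⟨by ring, trivial⟩
  · rintro ⟨⟨i, j⟩, ⟨a, b⟩⟩ h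
    simp only [Finset.mem_sigma, Finset.HasAntidiagonal.mem_antidiagonal] at h ⊢
    obtain ⟨rfl, rfl⟩ := h
    exact ⟨by ring, trivial⟩
  · rintro ⟨⟨i, j⟩, ⟨a, b⟩⟩ h
    simp only [Finset.mem_sigma, Finset.HasAntidiagonal.mem_antidiagonal] at h ⊢
    obtain ⟨-, rfl⟩ := h
    rfl
  · rintro ⟨⟨i, j⟩, ⟨a, b⟩⟩ h
    simp only [Finset.mem_sigma, Finset.HasAntidiagonal.mem_antidiagonal] at h ⊢
    obtain ⟨-, rfl⟩ := h
    rfl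
  · rintro ⟨⟨i, j⟩, ⟨a, b⟩⟩ h
    rfl

theorem comul_counit_left :
    (Algebra.TensorProduct.map (counit p) (.id (ZMod p) (SteenrodPowers p))).comp (comul p)
      = (Algebra.TensorProduct.lid (ZMod p) (SteenrodPowers p)).symm := by
  refine algHom_ext fun r => ?_
  simp only [AlgHom.comp_apply, comul_steenrodP, map_sum, Algebra.TensorProduct.map_tmul,
    AlgHom.id_apply, counit_steenrodP]
  rw [Finset.sum_eq_single (0, r)]
  · simp
  · rintro ⟨i, j⟩ h hne
    simp only [Finset.HasAntidiagonal.mem_antidiagonal] at h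
    rw [if_neg, TensorProduct.zero_tmul]
    rintro rfl
    exact hne (by simpa using h)
  · intro h
    exact absurd (Finset.HasAntidiagonal.mem_antidiagonal.2 (zero_add r)) h

theorem comul_counit_right :
    (Algebra.TensorProduct.map (.id (ZMod p) (SteenrodPowers p)) (counit p)).comp (comul p)
      = (Algebra.TensorProduct.rid (ZMod p) (ZMod p) (SteenrodPowers p)).symm := by
  refine algHom_ext fun r => ?_
  simp only [AlgHom.comp_apply, comul_steenrodP, map_sum, Algebra.TensorProduct.map_tmul,
    AlgHom.id_apply, counit_steenrodP]
  rw [Finset.sum_eq_single (r, 0)]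
  · simp
  · rintro ⟨i, j⟩ h hne
    simp only [Finset.HasAntidiagonal.mem_antidiagonal] at h
    rw [if_neg, TensorProduct.tmul_zero]
    rintro rfl
    exact hne (by simpa using h)
  · intro h
    exact absurd (Finset.HasAntidiagonal.mem_antidiagonal.2 (add_zero r)) h

/-! ### The grading and the antipode. -/

variable (p) in
/-- The span of the products of powers of total degree `d`. -/
def degreeSpan (d : ℕ) : Submodule (ZMod p) (SteenrodPowers p) :=
  Submodule.span (ZMod p) (word p '' {l | l.sum = d})

theorem word_mem_degreeSpan (l : List ℕ) : word p l ∈ degreeSpan p l.sum :=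
  Submodule.subset_span ⟨l, rfl, rfl⟩

theorem steenrodP_mul_mem_degreeSpan (r : ℕ) {d : ℕ} {x : SteenrodPowers p}
    (hx : x ∈ degreeSpan p d) : steenrodP p r * x ∈ degreeSpan p (r + d) := by
  induction hx using Submodule.span_induction with
  | mem x hx =>
    obtain ⟨l, rfl, rfl⟩ := hx
    rw [← word_cons]
    exact word_mem_degreeSpan (r :: l)
  | zero => simp
  | add x y _ _ hx hy => rw [mul_add]; exact add_mem hx hy
  | smul c x _ hx => rw [mul_smul_comm]; exact Submodule.smul_mem _ _ hx

theorem comul_mem_degreeSpan (d : ℕ) (x : SteenrodPowers p) (hx : x ∈ degreeSpan p d) :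
    comul p x ∈ Submodule.span (ZMod p) {t | ∃ i j, i + j = d ∧ ∃ a ∈ degreeSpan p i,
      ∃ b ∈ degreeSpan p j, t = a ⊗ₜ[ZMod p] b} := by
  induction hx using Submodule.span_induction with
  | zero => simp
  | add x y _ _ hx hy => rw [map_add]; exact Submodule.add_mem _ hx hy
  | smul c x _ hx => rw [map_smul]; exact Submodule.smul_mem _ _ hx
  | mem x hx =>
    obtain ⟨l, rfl, rfl⟩ := hx
    induction l with
    | nil =>
      refine Submodule.subset_span ⟨0, 0, add_zero 0, 1, word_mem_degreeSpan [], 1,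
        word_mem_degreeSpan [], ?_⟩
      rw [word_nil, map_one, Algebra.TensorProduct.one_def]
    | cons r l ih =>
      rw [word_cons, map_mul, comul_steenrodP, Finset.sum_mul]
      refine Submodule.sum_mem _ fun ij hij => ?_
      rw [Finset.HasAntidiagonal.mem_antidiagonal] at hij
      generalize comul p (word p l) = c at ih
      induction ih using Submodule.span_induction with
      | zero => simp
      | add x y _ _ hx hy => rw [mul_add]; exact Submodule.add_mem _ hx hy
      | smul c x _ hx => rw [mul_smul_comm]; exact Submodule.smul_mem _ _ hx
      | mem t ht =>
        obtain ⟨i, j, h, a, ha, b, hb, rfl⟩ := ht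
        rw [Algebra.TensorProduct.tmul_mul_tmul]
        refine Submodule.subset_span ⟨ij.1 + i, ij.2 + j, ?_, _,
          steenrodP_mul_mem_degreeSpan _ ha, _, steenrodP_mul_mem_degreeSpan _ hb, rfl⟩
        rw [List.sum_cons]
        omega

theorem degreeSpan_zero {x : SteenrodPowers p} (hx : x ∈ degreeSpan p 0) :
    x = algebraMap (ZMod p) _ (counit p x) := by
  induction hx using Submodule.span_induction with
  | zero => simp
  | add x y _ _ hx hy => rw [map_add, map_add, ← hx, ← hy]
  | smul c x _ hx => rw [map_smul, smul_eq_mul, map_mul, ← hx, Algebra.smul_def]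
  | mem x hx =>
    obtain ⟨l, hl, rfl⟩ := hx
    have : word p l = 1 := by
      rw [List.eq_replicate_of_mem (List.sum_eq_zero_iff.1 hl), word_replicate_zero]
    rw [this, map_one, map_one]

theorem exists_hopfStructure : ∃ H : HopfStructure (ZMod p) (SteenrodPowers p),
    H.comul = comul p ∧ H.counit = counit p := by
  let _ : Bialgebra (ZMod p) (SteenrodPowers p) := Bialgebra.ofAlgHom (comul p) (counit p)
    comul_coassoc comul_counit_left comul_counit_right
  obtain ⟨S, h1, h2⟩ := exists_antipode_of_nilpotent (k := ZMod p) (A := SteenrodPowers p) (by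
    have key := unitSubId_pow_eq_zero (k := ZMod p) (degreeSpan p) (fun x hx => degreeSpan_zero hx)
      comul_mem_degreeSpan
    intro x
    induction x using word_induction with
    | h0 => exact ⟨0, fun m _ => map_zero (unitSubId (ZMod p) (SteenrodPowers p) ^ m).ofConv⟩
    | hw l => exact ⟨l.sum + 1, fun m hm => key m _ hm _ (word_mem_degreeSpan l)⟩
    | hadd x y hx hy =>
      obtain ⟨n, hn⟩ := hx
      obtain ⟨n', hn'⟩ := hy
      refine ⟨max n n', fun m hm => ?_⟩
      have e := map_add (unitSubId (ZMod p) (SteenrodPowers p) ^ m).ofConv x y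
      refine e.trans ?_
      refine (congrArg₂ (· + ·) (hn m (le_trans (le_max_left _ _) hm))
        (hn' m (le_trans (le_max_right _ _) hm))).trans (add_zero 0)
    | hsmul c x hx =>
      obtain ⟨n, hn⟩ := hx
      refine ⟨n, fun m hm => ?_⟩
      have e := map_smul (unitSubId (ZMod p) (SteenrodPowers p) ^ m).ofConv c x
      exact e.trans ((congrArg (c • ·) (hn m hm)).trans (smul_zero c)))
  exact ⟨{ comul := comul p, counit := counit p, antipode := S, coassoc := comul_coassoc,
           counit_left := comul_counit_left, counit_right := comul_counit_right,
           antipode_left := h1, antipode_right := h2 }, rfl, rfl⟩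

variable (p) in
/-- The Hopf algebra structure of the algebra of Steenrod powers. -/
def hopf : HopfStructure (ZMod p) (SteenrodPowers p) := exists_hopfStructure.choose

theorem hopf_comul : (hopf p).comul = comul p := exists_hopfStructure.choose_spec.1

theorem hopf_counit : (hopf p).counit = counit p := exists_hopfStructure.choose_spec.2

end SteenrodPowers

end

noncomputable section

/-! ### The action on polynomials in terms of the pairing with the dual -/

theorem mul_pow_mul_pow {R : Type*} [CommRing R] (a b c : R) (p j : ℕ) :
    a * (b * c ^ p) ^ p ^ j = b ^ p ^ j * (a * c ^ p ^ (j + 1)) := by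
  rw [mul_pow, mul_left_comm, ← pow_mul, ← pow_succ']

namespace SteenrodPowers

variable {p : ℕ} [hp : Fact p.Prime]

local notation "𝓢" => MvPolynomial ℕ (ZMod p)

variable (p) in
/-- The map killing the generators `ξ_k` of the dual for `k > m`. -/
def truncXi (m : ℕ) : 𝓢 →ₐ[ZMod p] 𝓢 :=
  MvPolynomial.aeval fun i => if i < m then MvPolynomial.X i else 0

theorem truncXi_xi_of_le {m j : ℕ} (h : j ≤ m) : truncXi p m (milnorXi p j) = milnorXi p j := by
  cases j with
  | zero => simp [milnorXi]
  | succ j => rw [milnorXi, truncXi, MvPolynomial.aeval_X, if_pos (by omega)]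

theorem truncXi_xi_of_lt {m j : ℕ} (h : m < j) : truncXi p m (milnorXi p j) = 0 := by
  cases j with
  | zero => omega
  | succ j => rw [milnorXi, truncXi, MvPolynomial.aeval_X, if_neg (by omega)]

theorem milnorXi_algHom_ext {B : Type*} [CommRing B] [Algebra (ZMod p) B] {f g : 𝓢 →ₐ[ZMod p] B}
    (h : ∀ j, f (milnorXi p (j + 1)) = g (milnorXi p (j + 1))) : f = g :=
  MvPolynomial.algHom_ext h

/-- One operation lowers the index of a generator `ξ_k` by at most one. -/
theorem map_truncXi_dualHom (m : ℕ) (f : 𝓢) :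
    Polynomial.mapAlgHom (truncXi p m) (dualHom p (truncXi p (m + 1) f))
      = Polynomial.mapAlgHom (truncXi p m) (dualHom p f) := by
  have : ((Polynomial.mapAlgHom (truncXi p m)).comp (dualHom p)).comp (truncXi p (m + 1))
      = (Polynomial.mapAlgHom (truncXi p m)).comp (dualHom p) := by
    refine milnorXi_algHom_ext fun j => ?_
    rcases lt_or_ge j (m + 1) with h | h
    · rw [AlgHom.comp_apply, truncXi_xi_of_le h]
    · rw [AlgHom.comp_apply, truncXi_xi_of_lt (by omega), map_zero, AlgHom.comp_apply,
        dualHom_xi_succ]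
      simp [truncXi_xi_of_lt (show m < j + 1 by omega), truncXi_xi_of_lt (show m < j by omega)]
  exact AlgHom.congr_fun this f

/-- A word only sees the generators `ξ_k` with `k` at most its length. This lets a finite truncation
replace the infinite coaction `x ↦ ∑ ξ_j ⊗ x ^ (p ^ j)`. -/
theorem pair_word_truncXi (l : List ℕ) (f : 𝓢) :
    pair p (word p l) (truncXi p l.length f) = pair p (word p l) f := by
  induction l generalizing f with
  | nil =>
    rw [word_nil, pair_one, pair_one]
    have : (MvPolynomial.aeval (fun _ : ℕ => (0 : ZMod p))).comp (truncXi p 0)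
        = MvPolynomial.aeval (fun _ : ℕ => (0 : ZMod p)) := by
      refine MvPolynomial.algHom_ext fun i => ?_
      simp [truncXi]
    exact AlgHom.congr_fun this f
  | cons r l ih =>
    rw [word_cons, pair_steenrodP_mul, pair_steenrodP_mul, ← ih, ← ih (coeffOp _ _ f)]
    have := congrArg (fun P => Polynomial.coeff P r) (map_truncXi_dualHom l.length f)
    simp only [Polynomial.coe_mapAlgHom, Polynomial.coeff_map] at this
    exact congrArg _ this

variable (p) in
/-- The coaction on polynomials, truncated to the generators `ξ_k` of the dual with `k ≤ m`. -/
def coaction (m : ℕ) : 𝓢 →ₐ[ZMod p] 𝓢 ⊗[ZMod p] 𝓢 :=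
  MvPolynomial.aeval fun i => ∑ j ∈ Finset.range (m + 1),
    milnorXi p j ⊗ₜ (MvPolynomial.X i ^ p ^ j)

variable (p) in
/-- The total operation on the first factor. -/
def totalLeft : 𝓢 ⊗[ZMod p] 𝓢 →ₐ[ZMod p] Polynomial (𝓢 ⊗[ZMod p] 𝓢) :=
  Algebra.TensorProduct.productMap (S := Polynomial (𝓢 ⊗[ZMod p] 𝓢))
    ((Polynomial.mapAlgHom (Algebra.TensorProduct.includeLeft : 𝓢 →ₐ[ZMod p] 𝓢 ⊗[ZMod p] 𝓢)).comp
      (dualHom p))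
    ((Polynomial.CAlgHom (R := ZMod p)).comp
      (Algebra.TensorProduct.includeRight : 𝓢 →ₐ[ZMod p] 𝓢 ⊗[ZMod p] 𝓢))

variable (p) in
/-- The total operation on the second factor. -/
def totalRight : 𝓢 ⊗[ZMod p] 𝓢 →ₐ[ZMod p] Polynomial (𝓢 ⊗[ZMod p] 𝓢) :=
  Algebra.TensorProduct.productMap (S := Polynomial (𝓢 ⊗[ZMod p] 𝓢))
    ((Polynomial.CAlgHom (R := ZMod p)).comp
      (Algebra.TensorProduct.includeLeft : 𝓢 →ₐ[ZMod p] 𝓢 ⊗[ZMod p] 𝓢))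
    ((Polynomial.mapAlgHom (Algebra.TensorProduct.includeRight : 𝓢 →ₐ[ZMod p] 𝓢 ⊗[ZMod p] 𝓢)).comp
      (powerHom p))

theorem coeff_totalLeft (r : ℕ) (t : 𝓢 ⊗[ZMod p] 𝓢) :
    (totalLeft p t).coeff r = (coeffOp (dualHom p) r).rTensor 𝓢 t := by
  induction t with
  | zero => simp
  | add x y hx hy => simp only [map_add, Polynomial.coeff_add, hx, hy]
  | tmul f g =>
    rw [totalLeft, Algebra.TensorProduct.productMap_apply_tmul, LinearMap.rTensor_tmul]
    simp [Polynomial.coeff_map, coeffOp_apply]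

theorem coeff_totalRight (r : ℕ) (t : 𝓢 ⊗[ZMod p] 𝓢) :
    (totalRight p t).coeff r = (coeffOp (powerHom p) r).lTensor 𝓢 t := by
  induction t with
  | zero => simp
  | add x y hx hy => simp only [map_add, Polynomial.coeff_add, hx, hy]
  | tmul f g =>
    rw [totalRight, Algebra.TensorProduct.productMap_apply_tmul, LinearMap.lTensor_tmul]
    simp [Polynomial.coeff_map, coeffOp_apply]

theorem powerHom_X (i : ℕ) : powerHom p (MvPolynomial.X i)
    = Polynomial.C (MvPolynomial.X i) + Polynomial.X * Polynomial.C (MvPolynomial.X i) ^ p := by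
  rw [powerHom, MvPolynomial.aeval_X, pow_one, Polynomial.C_pow]

theorem coaction_X (m i : ℕ) : coaction p m (MvPolynomial.X i) = ∑ j ∈ Finset.range (m + 1),
    milnorXi p j ⊗ₜ (MvPolynomial.X i ^ p ^ j) := by
  rw [coaction, MvPolynomial.aeval_X]

/-- Operating on the polynomial agrees with operating on the coefficients of its coaction: the term
`u ^ (p ^ j) ξ_j ⊗ x ^ (p ^ (j + 1))` comes from `ξ_{j+1}` on the left and from `x ^ (p ^ j)` on the
right. The shift of `j` accounts for the two truncation levels. -/
theorem totalLeft_coaction (m : ℕ) (f : 𝓢) :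
    Polynomial.mapAlgHom (Algebra.TensorProduct.map (truncXi p m) (.id (ZMod p) 𝓢))
      (totalLeft p (coaction p (m + 1) f)) = totalRight p (coaction p m f) := by
  have : ((Polynomial.mapAlgHom (Algebra.TensorProduct.map (truncXi p m) (.id (ZMod p) 𝓢))).comp
      (totalLeft p)).comp (coaction p (m + 1)) = (totalRight p).comp (coaction p m) := by
    refine MvPolynomial.algHom_ext fun i => ?_
    simp only [AlgHom.comp_apply, coaction_X, map_sum]
    have h1 : ∀ j, Polynomial.mapAlgHom
        (Algebra.TensorProduct.map (truncXi p m) (.id (ZMod p) 𝓢))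
        (totalLeft p (milnorXi p j ⊗ₜ (MvPolynomial.X i ^ p ^ j)))
        = Polynomial.C (truncXi p m (milnorXi p j) ⊗ₜ (MvPolynomial.X i ^ p ^ j))
          + if j = 0 then 0 else Polynomial.X ^ p ^ (j - 1) * Polynomial.C
            (truncXi p m (milnorXi p (j - 1)) ⊗ₜ (MvPolynomial.X i ^ p ^ j)) := by
      intro j
      rw [totalLeft, Algebra.TensorProduct.productMap_apply_tmul]
      cases j with
      | zero =>
        rw [AlgHom.comp_apply, dualHom_xi_zero, if_pos rfl, add_zero]
        simp [← Polynomial.C_mul]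
      | succ j =>
        rw [AlgHom.comp_apply, dualHom_xi_succ, if_neg (Nat.succ_ne_zero j), Nat.add_sub_cancel]
        simp only [map_add, map_mul, map_pow, Polynomial.coe_mapAlgHom, Polynomial.map_C,
          Polynomial.map_X, AlgHom.comp_apply, Polynomial.CAlgHom_apply, RingHom.coe_coe,
          Algebra.TensorProduct.includeLeft_apply, Algebra.TensorProduct.includeRight_apply,
          Algebra.TensorProduct.map_tmul, map_one, AlgHom.id_apply, add_mul, mul_assoc]
        simp only [← map_mul, ← map_pow, Algebra.TensorProduct.tmul_mul_tmul,
          Algebra.TensorProduct.tmul_pow, one_pow, one_mul, mul_one]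
    have h2 : ∀ j, totalRight p (milnorXi p j ⊗ₜ (MvPolynomial.X i ^ p ^ j))
        = Polynomial.C (milnorXi p j ⊗ₜ (MvPolynomial.X i ^ p ^ j))
          + Polynomial.X ^ p ^ j * Polynomial.C
            (milnorXi p j ⊗ₜ (MvPolynomial.X i ^ p ^ (j + 1))) := by
      intro j
      have hfr : ∀ x y : Polynomial (𝓢 ⊗[ZMod p] 𝓢),
        (x + y) ^ p ^ j = x ^ p ^ j + y ^ p ^ j := by
        have : CharP (𝓢 ⊗[ZMod p] 𝓢) p := charP_of_injective_algebraMap'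
          (ZMod p) p
        exact fun x y => add_pow_char_pow x y p j
      rw [totalRight, Algebra.TensorProduct.productMap_apply_tmul]
      simp only [AlgHom.comp_apply, map_pow, powerHom_X, map_add, map_mul,
        Polynomial.coe_mapAlgHom, Polynomial.map_C, Polynomial.map_X, Polynomial.CAlgHom_apply,
        RingHom.coe_coe, Algebra.TensorProduct.includeLeft_apply,
        Algebra.TensorProduct.includeRight_apply, hfr]
      have hmp : ∀ a b c : Polynomial (𝓢 ⊗[ZMod p] 𝓢),
          a * (b * c ^ p) ^ p ^ j = b ^ p ^ j * (a * c ^ p ^ (j + 1)) := fun a b c =>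
        mul_pow_mul_pow a b c p j
      rw [mul_add, hmp]
      simp only [← map_mul, ← map_pow, Algebra.TensorProduct.tmul_mul_tmul,
          Algebra.TensorProduct.tmul_pow, one_pow, one_mul, mul_one]
    simp only [h1, h2, Finset.sum_add_distrib]
    congr 1
    · rw [Finset.sum_range_succ, truncXi_xi_of_lt (Nat.lt_succ_self m), TensorProduct.zero_tmul,
        map_zero, add_zero]
      refine Finset.sum_congr rfl fun j hj => ?_
      rw [truncXi_xi_of_le (by simpa [Nat.lt_succ_iff] using hj)]
    · rw [Finset.sum_range_succ', if_pos rfl, add_zero]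
      refine Finset.sum_congr rfl fun j hj => ?_
      rw [if_neg (Nat.succ_ne_zero j), Nat.add_sub_cancel,
        truncXi_xi_of_le (by simpa [Nat.lt_succ_iff] using hj)]
  exact AlgHom.congr_fun this f

variable (p) in
/-- Evaluation of a functional on the first factor. -/
def contract (φ : 𝓢 →ₗ[ZMod p] ZMod p) : 𝓢 ⊗[ZMod p] 𝓢 →ₗ[ZMod p] 𝓢 :=
  (TensorProduct.lid (ZMod p) 𝓢).toLinearMap.comp (φ.rTensor 𝓢)

theorem contract_tmul (φ : 𝓢 →ₗ[ZMod p] ZMod p) (f g : 𝓢) :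
    contract p φ (f ⊗ₜ g) = φ f • g := by
  simp [contract]

/-- Expresses the action through the pairing. In the induction the outermost power is moved across
the coaction, from the polynomial factor to the dual factor. -/
theorem rho_word (l : List ℕ) (f : 𝓢) :
    rho p (word p l) f = contract p (pair p (word p l)) (coaction p l.length f) := by
  induction l generalizing f with
  | nil =>
    rw [word_nil, map_one, Module.End.one_apply, List.length_nil]
    have : ∀ t, contract p (pair p 1) t = Algebra.TensorProduct.lid (ZMod p) 𝓢
        (Algebra.TensorProduct.map (MvPolynomial.aeval (fun _ : ℕ => (0 : ZMod p)))
          (.id (ZMod p) 𝓢) t) := by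
      intro t
      induction t with
      | zero => simp
      | add x y hx hy => simp only [map_add, hx, hy]
      | tmul f g => rw [contract_tmul, pair_one]; simp
    rw [this]
    have h : ((Algebra.TensorProduct.lid (ZMod p) 𝓢).toAlgHom.comp
        (Algebra.TensorProduct.map (MvPolynomial.aeval (fun _ : ℕ => (0 : ZMod p)))
          (.id (ZMod p) 𝓢))).comp (coaction p 0) = AlgHom.id _ _ := by
      refine MvPolynomial.algHom_ext fun i => ?_
      simp [coaction_X, milnorXi]
    exact (AlgHom.congr_fun h f).symm
  | cons r l ih =>
    rw [word_cons, map_mul, Module.End.mul_apply, ih, rho_steenrodP, milnorOp_one, ← word_cons,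
      List.length_cons]
    have h1 : ∀ t, coeffOp (powerHom p) r (contract p (pair p (word p l)) t)
        = contract p (pair p (word p l)) ((coeffOp (powerHom p) r).lTensor 𝓢 t) := by
      intro t
      induction t with
      | zero => simp
      | add x y hx hy => simp only [map_add, hx, hy]
      | tmul f g => rw [contract_tmul, map_smul, LinearMap.lTensor_tmul, contract_tmul]
    have h2 : ∀ t, contract p (pair p (word p (r :: l))) t
        = contract p (pair p (word p l)) (Algebra.TensorProduct.map (truncXi p l.length)
          (.id (ZMod p) 𝓢) ((coeffOp (dualHom p) r).rTensor 𝓢 t)) := by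
      intro t
      induction t with
      | zero => simp
      | add x y hx hy => simp only [map_add, hx, hy]
      | tmul f g =>
        rw [LinearMap.rTensor_tmul, Algebra.TensorProduct.map_tmul, contract_tmul, contract_tmul,
          pair_word_truncXi, word_cons, pair_steenrodP_mul, AlgHom.id_apply]
    rw [h1, h2, ← coeff_totalLeft, ← coeff_totalRight, ← totalLeft_coaction]
    simp [Polynomial.coeff_map]

theorem rho_apply {m : ℕ} {x : SteenrodPowers p} (hx : x ∈ admissibleSpan p m) (f : 𝓢) :
    rho p x f = contract p (pair p x) (coaction p m f) := by
  induction hx using Submodule.span_induction with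
  | mem x hx => obtain ⟨l, ⟨-, rfl⟩, rfl⟩ := hx; exact rho_word l f
  | zero => simp [contract]
  | add x y _ _ hx hy =>
    rw [map_add, LinearMap.add_apply, hx, hy, map_add, contract, contract, contract,
      LinearMap.rTensor_add]
    simp
  | smul c x _ hx =>
    rw [map_smul, LinearMap.smul_apply, hx, map_smul, contract, contract, LinearMap.rTensor_smul]
    simp

/-- The action of an element whose pairing is a coefficient of the map `ξ_t ↦ u`, `ξ_k ↦ 0` for
`k ≠ t`. -/
theorem rho_eq_milnorOp {t r : ℕ} {x : SteenrodPowers p} (η : 𝓢 →ₐ[ZMod p] Polynomial (ZMod p))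
    (hη : ∀ j, η (milnorXi p (j + 1)) = if j + 1 = t then Polynomial.X else 0) (ht : 1 ≤ t)
    (hx : ∀ f, pair p x f = (η f).coeff r) : rho p x = milnorOp p t r := by
  refine LinearMap.ext fun f => ?_
  obtain ⟨n, hn⟩ := exists_mem_admissibleSpan x
  rw [rho_apply (hn (max n t) (le_max_left _ _))]
  generalize hm : max n t = m
  have htm : t ≤ m := by omega
  -- `ψ` specializes the dual factor by `η`. After the coaction only `j = 0` and `j = t` survive,
  -- leaving `x + u x ^ (p ^ t)`.
  let ψ : 𝓢 ⊗[ZMod p] 𝓢 →ₐ[ZMod p] Polynomial 𝓢 := Algebra.TensorProduct.productMap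
    ((Polynomial.mapAlgHom (Algebra.ofId (ZMod p) 𝓢)).comp η) (Polynomial.CAlgHom (R := ZMod p))
  have h1 : ∀ s, contract p (pair p x) s = (ψ s).coeff r := by
    intro s
    induction s with
    | zero => simp
    | add x y hx hy => simp only [map_add, Polynomial.coeff_add, hx, hy]
    | tmul f g =>
      rw [contract_tmul, hx, Algebra.TensorProduct.productMap_apply_tmul]
      simp [Polynomial.coeff_map, Algebra.smul_def]
  rw [h1]
  have h2 : ψ.comp (coaction p m) = MvPolynomial.aeval (R := ZMod p) (fun i : ℕ =>
      Polynomial.C (MvPolynomial.X i : MvPolynomial ℕ (ZMod p)) +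
        Polynomial.X * Polynomial.C (MvPolynomial.X i ^ (p ^ t))) := by
    refine MvPolynomial.algHom_ext fun i => ?_
    have h3 : ∀ j, ψ (milnorXi p j ⊗ₜ (MvPolynomial.X i ^ p ^ j))
        = if j = 0 then Polynomial.C (MvPolynomial.X i : MvPolynomial ℕ (ZMod p)) else
          if j = t then Polynomial.X * Polynomial.C (MvPolynomial.X i ^ (p ^ t)) else 0 := by
      intro j
      rw [Algebra.TensorProduct.productMap_apply_tmul, AlgHom.comp_apply]
      cases j with
      | zero => simp [milnorXi]
      | succ j =>
        rw [hη, if_neg (Nat.succ_ne_zero j)]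
        split_ifs with h
        · rw [h]
          simp
        · simp
    rw [AlgHom.comp_apply, coaction_X, map_sum, MvPolynomial.aeval_X]
    simp only [h3]
    rw [Finset.sum_range_succ', if_pos rfl, add_comm]
    congr 1
    rw [Finset.sum_eq_single (t - 1)]
    · rw [if_neg (by omega), if_pos (by omega)]
    · intro j _ hj
      rw [if_neg (by omega), if_neg (by omega)]
    · intro h
      exact absurd (Finset.mem_range.2 (by omega)) h
  exact congrArg (fun P => Polynomial.coeff P r) (AlgHom.congr_fun h2 f)

theorem coaction_prod_X (m N : ℕ) : coaction p m (∏ i : Fin N, MvPolynomial.X (i : ℕ))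
    = ∑ κ ∈ Fintype.piFinset fun _ : Fin N => Finset.range (m + 1),
      (∏ i, milnorXi p (κ i)) ⊗ₜ
        MvPolynomial.monomial (Finsupp.mapDomain Fin.val
          (Finsupp.equivFunOnFinite.symm fun i : Fin N => p ^ κ i)) (1 : ZMod p) := by
  rw [map_prod]
  simp only [coaction_X]
  rw [Finset.prod_univ_sum]
  refine Finset.sum_congr rfl fun κ _ => ?_
  have h : ∀ f g : Fin N → 𝓢, ∏ i, f i ⊗ₜ[ZMod p] g i = (∏ i, f i) ⊗ₜ (∏ i, g i) := by
    intro f g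
    induction (Finset.univ : Finset (Fin N)) using Finset.induction_on with
    | empty => simp [Algebra.TensorProduct.one_def]
    | insert a s ha ih =>
      rw [Finset.prod_insert ha, Finset.prod_insert ha, Finset.prod_insert ha, ih,
        Algebra.TensorProduct.tmul_mul_tmul]
  rw [h]
  congr 1
  rw [MvPolynomial.monomial_eq, map_one, one_mul, Finsupp.prod_mapDomain_index_inj
    Fin.val_injective, Finsupp.prod_fintype _ _ (fun i => pow_zero _)]
  rfl

/-- On a product of distinct variables the coaction attaches different monomials in the `x_i` to
different sequences `κ`. Its coefficients thus recover the pairing of `x` with every monomial in the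
`ξ_k`. -/
theorem rho_injective : Function.Injective (rho p) := by
  rw [injective_iff_map_eq_zero]
  intro x hx
  refine eq_zero_of_pair fun f => ?_
  obtain ⟨n, hn⟩ := exists_mem_admissibleSpan x
  have key : ∀ N (κ : Fin N → ℕ), pair p x (∏ i, milnorXi p (κ i)) = 0 := by
    intro N κ
    have hm := hn (max n (Finset.univ.sup κ)) (le_max_left _ _)
    have hκ : ∀ i, κ i ≤ max n (Finset.univ.sup κ) := fun i =>
      le_trans (Finset.le_sup (f := κ) (Finset.mem_univ i)) (le_max_right _ _)
    generalize max n (Finset.univ.sup κ) = m at hm hκ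
    have h := rho_apply hm (∏ i : Fin N, MvPolynomial.X (i : ℕ))
    rw [hx, LinearMap.zero_apply, coaction_prod_X, map_sum] at h
    have h' := congrArg (MvPolynomial.coeff (Finsupp.mapDomain Fin.val
          (Finsupp.equivFunOnFinite.symm fun i : Fin N => p ^ κ i))) h.symm
    rw [MvPolynomial.coeff_sum, MvPolynomial.coeff_zero, Finset.sum_eq_single κ] at h'
    · rw [contract_tmul, MvPolynomial.coeff_smul, MvPolynomial.coeff_monomial, if_pos rfl,
        smul_eq_mul, mul_one] at h'
      exact h'
    · intro κ' _ hne
      rw [contract_tmul, MvPolynomial.coeff_smul, MvPolynomial.coeff_monomial, if_neg, smul_zero]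
      intro he
      have := Finsupp.mapDomain_injective Fin.val_injective he
      refine hne (funext fun i => ?_)
      have := DFunLike.congr_fun this i
      exact Nat.pow_right_injective hp.out.two_le this
    · intro h
      exact absurd (Fintype.mem_piFinset.2 fun i => Finset.mem_range.2
        (Nat.lt_succ_of_le (hκ i))) h
  have hmon : ∀ s : ℕ →₀ ℕ, pair p x (MvPolynomial.monomial s 1) = 0 := by
    intro s
    have : ∃ l : List ℕ, (l.map (milnorXi p)).prod = MvPolynomial.monomial s (1 : ZMod p) := by
      induction s using Finsupp.induction_linear with
      | zero => exact ⟨[], rfl⟩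
      | add s t hs ht =>
        obtain ⟨l, hl⟩ := hs
        obtain ⟨l', hl'⟩ := ht
        exact ⟨l ++ l', by rw [List.map_append, List.prod_append, hl, hl',
          MvPolynomial.monomial_mul, one_mul]⟩
      | single i e =>
        refine ⟨List.replicate e (i + 1), ?_⟩
        rw [List.map_replicate, List.prod_replicate, milnorXi, MvPolynomial.X_pow_eq_monomial]
    obtain ⟨l, hl⟩ := this
    rw [← hl]
    have := key l.length l.get
    rwa [← List.prod_ofFn, List.ofFn_comp' l.get (milnorXi p), List.ofFn_get] at this
  induction f using MvPolynomial.induction_on' with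
  | add f g hf hg => rw [map_add, hf, hg, add_zero]
  | monomial s a =>
    have : MvPolynomial.monomial s a = a • MvPolynomial.monomial s (1 : ZMod p) := by
      rw [MvPolynomial.smul_monomial, smul_eq_mul, mul_one]
    rw [this, map_smul, hmon, smul_zero]

end SteenrodPowers

end

noncomputable section

/-! ### Filtrations by weight -/

section Weight

variable {k σ O : Type*} [CommRing k] [CommRing O] [Algebra k O]

/-- The polynomials whose monomials all have weight less than `m`. -/
def weightLT (k : Type*) [CommRing k] {σ : Type*} (w : σ → ℕ) (m : ℤ) :
    Submodule k (MvPolynomial σ k) :=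
  MvPolynomial.restrictSupport k {s | (Finsupp.weight w s : ℤ) < m}

/-- The filtration on `O` modulo the ideal `J` induced by the weight of polynomials. -/
def weightFiltration (q : MvPolynomial σ k →ₐ[k] O) (w : σ → ℕ) (J : Ideal O) (m : ℤ) :
    Submodule k O :=
  (weightLT k w m).map q.toLinearMap ⊔ J.restrictScalars k

variable {q : MvPolynomial σ k →ₐ[k] O} {w : σ → ℕ} {J : Ideal O}

theorem weightLT_mono {a b : ℤ} (h : a ≤ b) : weightLT k w a ≤ weightLT k w b :=
  MvPolynomial.restrictSupport_mono k fun _ hs => lt_of_lt_of_le hs h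

theorem weightFiltration_mono {a b : ℤ} (h : a ≤ b) :
    weightFiltration q w J a ≤ weightFiltration q w J b :=
  sup_le_sup_right (Submodule.map_mono (weightLT_mono h)) _

theorem mem_weightFiltration_of_mem_ideal {m : ℤ} {f : O} (h : f ∈ J) :
    f ∈ weightFiltration q w J m :=
  Submodule.mem_sup_right h

theorem map_mem_weightFiltration {m : ℤ} {g : MvPolynomial σ k} (h : g ∈ weightLT k w m) :
    q g ∈ weightFiltration q w J m :=
  Submodule.mem_sup_left ⟨g, h, rfl⟩

theorem monomial_mem_weightLT {m : ℤ} {s : σ →₀ ℕ} (h : (Finsupp.weight w s : ℤ) < m) (c : k) :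
    MvPolynomial.monomial s c ∈ weightLT k w m := by
  rw [weightLT, MvPolynomial.mem_restrictSupport_iff]
  intro t ht
  rw [Finset.mem_singleton.1 (MvPolynomial.support_monomial_subset ht)]
  exact h

theorem map_monomial_mem {m : ℤ} {s : σ →₀ ℕ} (h : (Finsupp.weight w s : ℤ) < m) (c : k) :
    q (MvPolynomial.monomial s c) ∈ weightFiltration q w J m :=
  map_mem_weightFiltration (monomial_mem_weightLT h c)

theorem map_X_mem {m : ℤ} {v : σ} (h : (w v : ℤ) < m) :
    q (MvPolynomial.X v) ∈ weightFiltration q w J m := by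
  refine map_monomial_mem ?_ 1
  rw [Finsupp.weight_single, one_smul]
  exact h

/-- Induction for the weight filtration. -/
@[elab_as_elim]
theorem weightFiltration_induction {m : ℤ} {P : ∀ f : O, f ∈ weightFiltration q w J m → Prop}
    (hJ : ∀ (f : O) (hf : f ∈ J), P f (mem_weightFiltration_of_mem_ideal hf))
    (hq : ∀ (s : σ →₀ ℕ) (hs : (Finsupp.weight w s : ℤ) < m),
      P (q (MvPolynomial.monomial s 1)) (map_monomial_mem hs 1))
    (hadd : ∀ f g hf hg, P f hf → P g hg → P (f + g) (add_mem hf hg))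
    (hsmul : ∀ (c : k) f hf, P f hf → P (c • f) (Submodule.smul_mem _ c hf))
    {f : O} (hf : f ∈ weightFiltration q w J m) : P f hf := by
  classical
  suffices ∃ h, P f h from this.2
  replace hJ : ∀ f ∈ J, ∃ h, P f h := fun f hf => ⟨_, hJ f hf⟩
  replace hq : ∀ (s : σ →₀ ℕ) (hs : (Finsupp.weight w s : ℤ) < m),
      ∃ h, P (q (MvPolynomial.monomial s 1)) h := fun s hs => ⟨_, hq s hs⟩
  replace hadd : ∀ f g, (∃ h, P f h) → (∃ h, P g h) → ∃ h, P (f + g) h :=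
    fun f g ⟨hf, h⟩ ⟨hg, h'⟩ => ⟨_, hadd f g hf hg h h'⟩
  replace hsmul : ∀ (c : k) f, (∃ h, P f h) → ∃ h, P (c • f) h :=
    fun c f ⟨hf, h⟩ => ⟨_, hsmul c f hf h⟩
  obtain ⟨_, ⟨g, hg, rfl⟩, j, hj, rfl⟩ := Submodule.mem_sup.1 hf
  refine hadd _ _ ?_ (hJ j hj)
  rw [AlgHom.toLinearMap_apply, g.as_sum, map_sum]
  rw [SetLike.mem_coe, weightLT, MvPolynomial.mem_restrictSupport_iff] at hg
  have : ∀ t : Finset (σ →₀ ℕ), t ⊆ g.support →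
      ∃ h, P (∑ s ∈ t, q (MvPolynomial.monomial s (g.coeff s))) h := by
    intro t
    induction t using Finset.induction_on with
    | empty => intro _; rw [Finset.sum_empty]; exact hJ 0 J.zero_mem
    | insert s t hs ih =>
      intro hst
      rw [Finset.sum_insert hs]
      refine hadd _ _ ?_ (ih ((Finset.subset_insert _ _).trans hst))
      have e : MvPolynomial.monomial s (g.coeff s) = g.coeff s • MvPolynomial.monomial s 1 := by
        rw [MvPolynomial.smul_monomial, smul_eq_mul, mul_one]
      rw [e, map_smul]
      exact hsmul _ _ (hq s (hg (hst (Finset.mem_insert_self _ _))))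
  exact this _ subset_rfl

/-- The filtration bounds weights strictly and no weight is negative, so only `J` remains. Integer
indices make room for the step `-1`, which occurs for corrections to weight zero. -/
theorem weightFiltration_of_nonpos {m : ℤ} (hm : m ≤ 0) {f : O}
    (hf : f ∈ weightFiltration q w J m) : f ∈ J := by
  induction hf using weightFiltration_induction with
  | hJ f hf => exact hf
  | hq s hs => omega
  | hadd f g _ _ hf hg => exact J.add_mem hf hg
  | hsmul c f _ hf => rw [Algebra.smul_def]; exact J.mul_mem_left _ hf

/-- Weights at most `a - 1` and `b - 1` add up to at most `a + b - 2`; strictness of the bounds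
gains the extra one. -/
theorem weightFiltration_mul {a b c : ℤ} {f g : O} (hf : f ∈ weightFiltration q w J a)
    (hg : g ∈ weightFiltration q w J b) (h : a + b ≤ c + 1) :
    f * g ∈ weightFiltration q w J c := by
  induction hf using weightFiltration_induction with
  | hJ f hf => exact mem_weightFiltration_of_mem_ideal (J.mul_mem_right _ hf)
  | hadd f f' _ _ hf hf' => rw [add_mul]; exact add_mem hf hf'
  | hsmul c f _ hf => rw [smul_mul_assoc]; exact Submodule.smul_mem _ _ hf
  | hq s hs =>
    induction hg using weightFiltration_induction with
    | hJ f hf => exact mem_weightFiltration_of_mem_ideal (J.mul_mem_left _ hf)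
    | hadd f f' _ _ hf hf' => rw [mul_add]; exact add_mem hf hf'
    | hsmul c f _ hf => rw [mul_smul_comm]; exact Submodule.smul_mem _ _ hf
    | hq t ht =>
      rw [← map_mul, MvPolynomial.monomial_mul]
      refine map_monomial_mem ?_ _
      rw [map_add]
      push_cast
      omega

theorem exists_sub_mem_weightFiltration {m : ℕ} {f : O}
    (hf : f ∈ weightFiltration q w J (m + 1)) :
    ∃ g : MvPolynomial σ k, MvPolynomial.IsWeightedHomogeneous w g m ∧
      f - q g ∈ weightFiltration q w J m := by
  induction hf using weightFiltration_induction with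
  | hJ f hf =>
    refine ⟨0, MvPolynomial.isWeightedHomogeneous_zero k w m, ?_⟩
    rw [map_zero, sub_zero]
    exact mem_weightFiltration_of_mem_ideal hf
  | hadd f f' _ _ hf hf' =>
    obtain ⟨g, hg, h⟩ := hf
    obtain ⟨g', hg', h'⟩ := hf'
    refine ⟨g + g', hg.add hg', ?_⟩
    rw [map_add, add_sub_add_comm]
    exact add_mem h h'
  | hsmul c f _ hf =>
    obtain ⟨g, hg, h⟩ := hf
    refine ⟨c • g, ?_, ?_⟩
    · exact (MvPolynomial.weightedHomogeneousSubmodule k w m).smul_mem c hg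
    · rw [map_smul, ← smul_sub]
      exact Submodule.smul_mem _ _ h
  | hq s hs =>
    rcases lt_or_eq_of_le (show Finsupp.weight w s ≤ m by omega) with h | h
    · refine ⟨0, MvPolynomial.isWeightedHomogeneous_zero k w m, ?_⟩
      rw [map_zero, sub_zero]
      exact map_monomial_mem (by omega) _
    · refine ⟨_, MvPolynomial.isWeightedHomogeneous_monomial w s 1 h, ?_⟩
      rw [sub_self]
      exact zero_mem _

theorem IsWeightedHomogeneous.mem_weightLT {m : ℕ} {g : MvPolynomial σ k}
    (h : MvPolynomial.IsWeightedHomogeneous w g m) : g ∈ weightLT k w (m + 1) := by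
  rw [weightLT, MvPolynomial.mem_restrictSupport_iff]
  intro s hs
  have := h (MvPolynomial.mem_support_iff.1 hs)
  change (Finsupp.weight w s : ℤ) < m + 1
  omega

/-! ### Total operations that lower the weight. -/

section Operations

variable (E : O →ₐ[k] Polynomial O) {B : ℕ}

/-- Let `D_r` be the `r`th coefficient of `E` minus that of the identity. Then `D_r (ab) = a D_r b +
D_r a b + ∑ D_i a D_j b`. If each `D_i` lowers the weight, the last sum lies two steps down and
`D_r` is a derivation to leading order. -/
theorem coeffOp_mul_sub {a b : O} (r : ℕ) :
    coeffOp E r (a * b) - (if r = 0 then a * b else 0)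
      = a * (coeffOp E r b - if r = 0 then b else 0)
        + (coeffOp E r a - if r = 0 then a else 0) * b
        + ∑ ij ∈ Finset.HasAntidiagonal.antidiagonal r,
          (coeffOp E ij.1 a - if ij.1 = 0 then a else 0)
          * (coeffOp E ij.2 b - if ij.2 = 0 then b else 0) := by
  have h1 : ∀ c : O, ∀ F : ℕ → O, ∑ ij ∈ Finset.HasAntidiagonal.antidiagonal r,
      (if ij.1 = 0 then c else 0) * F ij.2 = c * F r := by
    intro c F
    rw [Finset.sum_eq_single (0, r)]
    · simp
    · rintro ⟨i, j⟩ h hne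
      simp only [Finset.HasAntidiagonal.mem_antidiagonal] at h
      rw [if_neg, zero_mul]
      rintro rfl
      exact hne (by simpa using h)
    · intro h
      exact absurd (Finset.HasAntidiagonal.mem_antidiagonal.2 (zero_add r)) h
  have h2 : ∀ c : O, ∀ F : ℕ → O, ∑ ij ∈ Finset.HasAntidiagonal.antidiagonal r,
      F ij.1 * (if ij.2 = 0 then c else 0) = F r * c := by
    intro c F
    rw [Finset.sum_eq_single (r, 0)]
    · simp
    · rintro ⟨i, j⟩ h hne
      simp only [Finset.HasAntidiagonal.mem_antidiagonal] at h
      rw [if_neg, mul_zero]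
      rintro rfl
      exact hne (by simpa using h)
    · intro h
      exact absurd (Finset.HasAntidiagonal.mem_antidiagonal.2 (add_zero r)) h
  simp only [sub_mul, mul_sub, Finset.sum_sub_distrib]
  rw [← coeffOp_mul, h1 a (fun j => coeffOp E j b), h2 b (fun i => coeffOp E i a),
    h1 a (fun j => if j = 0 then b else 0)]
  split_ifs <;> ring

theorem coeffOp_one_sub (r : ℕ) : coeffOp E r 1 - (if r = 0 then 1 else 0) = 0 := by
  rw [coeffOp_apply, map_one, Polynomial.coeff_one, sub_self]

/-- The bound `B` on the degrees is inherited by both factors in the product rule. It is needed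
because the ideals used later are stable only under operations of small degree. -/
theorem coeffOp_monomial_sub_mem
    (hX : ∀ r < B, ∀ v, coeffOp E r (q (MvPolynomial.X v))
      - (if r = 0 then q (MvPolynomial.X v) else 0) ∈ weightFiltration q w J (w v))
    (s : σ →₀ ℕ) (r : ℕ) (hr : r < B) :
    coeffOp E r (q (MvPolynomial.monomial s 1))
      - (if r = 0 then q (MvPolynomial.monomial s 1) else 0)
      ∈ weightFiltration q w J (Finsupp.weight w s) := by
  induction s using Finsupp.induction_linear generalizing r with
  | zero =>
    have : (MvPolynomial.monomial (0 : σ →₀ ℕ)) (1 : k) = 1 := rfl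
    rw [this, map_one, coeffOp_one_sub]
    exact zero_mem _
  | add s t hs ht =>
    have e : MvPolynomial.monomial (s + t) (1 : k)
        = MvPolynomial.monomial s 1 * MvPolynomial.monomial t 1 := by
      rw [MvPolynomial.monomial_mul, one_mul]
    rw [e, map_mul, coeffOp_mul_sub, map_add]
    push_cast
    refine add_mem (add_mem ?_ ?_) (Submodule.sum_mem _ fun ij hij => ?_)
    · exact weightFiltration_mul (map_monomial_mem (lt_add_one _) 1) (ht r hr) (by omega)
    · exact weightFiltration_mul (hs r hr) (map_monomial_mem (lt_add_one _) 1) (by omega)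
    · rw [Finset.HasAntidiagonal.mem_antidiagonal] at hij
      exact weightFiltration_mul (hs _ (by omega)) (ht _ (by omega)) (by omega)
  | single v e =>
    induction e generalizing r with
    | zero =>
      have : (MvPolynomial.monomial (Finsupp.single v 0)) (1 : k) = 1 := by
        rw [Finsupp.single_zero]; rfl
      rw [this, map_one, coeffOp_one_sub]
      exact zero_mem _
    | succ e ih =>
      have e1 : MvPolynomial.monomial (Finsupp.single v (e + 1)) (1 : k)
          = MvPolynomial.monomial (Finsupp.single v e) 1 * MvPolynomial.X v := by
        rw [MvPolynomial.X, MvPolynomial.monomial_mul, one_mul, Finsupp.single_add]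
      rw [e1, map_mul, coeffOp_mul_sub, Finsupp.single_add, map_add]
      have hw : Finsupp.weight w (Finsupp.single v 1) = w v := by
        rw [Finsupp.weight_single, one_smul]
      rw [hw]
      push_cast
      refine add_mem (add_mem ?_ ?_) (Submodule.sum_mem _ fun ij hij => ?_)
      · exact weightFiltration_mul (map_monomial_mem (lt_add_one _) 1) (hX r hr v) (by omega)
      · exact weightFiltration_mul (ih r hr) (map_X_mem (lt_add_one _)) (by omega)
      · rw [Finset.HasAntidiagonal.mem_antidiagonal] at hij
        exact weightFiltration_mul (ih _ (by omega)) (hX _ (by omega) v) (by omega)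

/-- Operations of small degree that lower the weight of the generators lower the weight
filtration. -/
theorem coeffOp_sub_mem
    (hX : ∀ r < B, ∀ v, coeffOp E r (q (MvPolynomial.X v))
      - (if r = 0 then q (MvPolynomial.X v) else 0) ∈ weightFiltration q w J (w v))
    (hJ : ∀ r < B, ∀ f ∈ J, coeffOp E r f ∈ J) {m : ℤ} {f : O}
    (hf : f ∈ weightFiltration q w J (m + 1)) {r : ℕ} (hr : r < B) :
    coeffOp E r f - (if r = 0 then f else 0) ∈ weightFiltration q w J m := by
  induction hf using weightFiltration_induction with
  | hJ f hf =>
    refine mem_weightFiltration_of_mem_ideal (J.sub_mem (hJ r hr f hf) ?_)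
    split_ifs
    · exact hf
    · exact J.zero_mem
  | hadd f g _ _ hf hg =>
    have e : coeffOp E r (f + g) - (if r = 0 then f + g else 0)
        = (coeffOp E r f - if r = 0 then f else 0) + (coeffOp E r g - if r = 0 then g else 0) := by
      rw [map_add]
      split_ifs <;> ring
    rw [e]
    exact add_mem hf hg
  | hsmul c f _ hf =>
    have e : coeffOp E r (c • f) - (if r = 0 then c • f else 0)
        = c • (coeffOp E r f - if r = 0 then f else 0) := by
      rw [map_smul, smul_sub]
      split_ifs <;> simp
    rw [e]
    exact Submodule.smul_mem _ _ hf
  | hq s hs => exact weightFiltration_mono (by omega) (coeffOp_monomial_sub_mem E hX s r hr)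

/-- The leading term of the operations on the weight filtration is a derivation. -/
theorem coeffOp_sub_derivation_mem
    (hX : ∀ r < B, ∀ v, coeffOp E r (q (MvPolynomial.X v))
      - (if r = 0 then q (MvPolynomial.X v) else 0) ∈ weightFiltration q w J (w v))
    {r : ℕ} (hr : r < B) (D : Derivation k (MvPolynomial σ k) (MvPolynomial σ k))
    (hD : ∀ v, coeffOp E r (q (MvPolynomial.X v)) - (if r = 0 then q (MvPolynomial.X v) else 0)
      - q (D (MvPolynomial.X v)) ∈ weightFiltration q w J (w v - 1))
    {m : ℕ} {g : MvPolynomial σ k} (hg : MvPolynomial.IsWeightedHomogeneous w g (m + 1)) :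
    coeffOp E r (q g) - (if r = 0 then q g else 0) - q (D g) ∈ weightFiltration q w J m := by
  have key : ∀ s : σ →₀ ℕ, coeffOp E r (q (MvPolynomial.monomial s 1))
      - (if r = 0 then q (MvPolynomial.monomial s 1) else 0)
      - q (D (MvPolynomial.monomial s 1))
      ∈ weightFiltration q w J (Finsupp.weight w s - 1) := by
    have hmul : ∀ (s t : σ →₀ ℕ), coeffOp E r (q (MvPolynomial.monomial s 1))
          - (if r = 0 then q (MvPolynomial.monomial s 1) else 0)
          - q (D (MvPolynomial.monomial s 1)) ∈ weightFiltration q w J (Finsupp.weight w s - 1) →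
        coeffOp E r (q (MvPolynomial.monomial t 1))
          - (if r = 0 then q (MvPolynomial.monomial t 1) else 0)
          - q (D (MvPolynomial.monomial t 1)) ∈ weightFiltration q w J (Finsupp.weight w t - 1) →
        coeffOp E r (q (MvPolynomial.monomial (s + t) 1))
          - (if r = 0 then q (MvPolynomial.monomial (s + t) 1) else 0)
          - q (D (MvPolynomial.monomial (s + t) 1))
          ∈ weightFiltration q w J (Finsupp.weight w (s + t) - 1) := by
      intro s t hs ht
      have e : MvPolynomial.monomial (s + t) (1 : k)
          = MvPolynomial.monomial s 1 * MvPolynomial.monomial t 1 := by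
        rw [MvPolynomial.monomial_mul, one_mul]
      rw [e, map_mul, coeffOp_mul_sub, Derivation.leibniz, smul_eq_mul, smul_eq_mul, map_add,
        map_add, map_mul, map_mul]
      have e2 : ∀ A B a b u v c : O, a * A + B * b + c - (a * u + b * v)
          = a * (A - u) + (B - v) * b + c := fun A B a b u v c => by ring
      rw [e2]
      push_cast
      refine add_mem (add_mem ?_ ?_) (Submodule.sum_mem _ fun ij hij => ?_)
      · exact weightFiltration_mul (map_monomial_mem (lt_add_one _) 1) ht (by omega)
      · exact weightFiltration_mul hs (map_monomial_mem (lt_add_one _) 1) (by omega)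
      -- The cross terms drop by two, hence fall into the error term.
      · rw [Finset.HasAntidiagonal.mem_antidiagonal] at hij
        exact weightFiltration_mul (coeffOp_monomial_sub_mem E hX s _ (by omega))
          (coeffOp_monomial_sub_mem E hX t _ (by omega)) (by omega)
    have h0 : coeffOp E r (q (MvPolynomial.monomial 0 1))
        - (if r = 0 then q (MvPolynomial.monomial 0 1) else 0)
        - q (D (MvPolynomial.monomial 0 1))
        ∈ weightFiltration q w J (Finsupp.weight w (0 : σ →₀ ℕ) - 1) := by
      have : (MvPolynomial.monomial (0 : σ →₀ ℕ)) (1 : k) = 1 := rfl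
      rw [this, map_one, coeffOp_one_sub, Derivation.map_one_eq_zero, map_zero q, sub_self]
      exact zero_mem _
    intro s
    induction s using Finsupp.induction_linear with
    | zero => exact h0
    | add s t hs ht => exact hmul s t hs ht
    | single v e =>
      induction e with
      | zero => rw [Finsupp.single_zero]; exact h0
      | succ e ih =>
        rw [Finsupp.single_add]
        refine hmul _ _ ih ?_
        have := hD v
        rwa [Finsupp.weight_single, one_smul]
  rw [g.as_sum]
  have e : ∀ t : Finset (σ →₀ ℕ), coeffOp E r (q (∑ s ∈ t, MvPolynomial.monomial s (g.coeff s)))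
      - (if r = 0 then q (∑ s ∈ t, MvPolynomial.monomial s (g.coeff s)) else 0)
      - q (D (∑ s ∈ t, MvPolynomial.monomial s (g.coeff s)))
      = ∑ s ∈ t, g.coeff s • (coeffOp E r (q (MvPolynomial.monomial s 1))
      - (if r = 0 then q (MvPolynomial.monomial s 1) else 0)
      - q (D (MvPolynomial.monomial s 1))) := by
    intro t
    have e : ∀ s, MvPolynomial.monomial s (g.coeff s) = g.coeff s • MvPolynomial.monomial s 1 := by
      intro s
      rw [MvPolynomial.smul_monomial, smul_eq_mul, mul_one]
    simp only [e, map_sum, map_smul, smul_sub, Finset.sum_sub_distrib]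
    split_ifs <;> simp
  rw [e]
  refine Submodule.sum_mem _ fun s hs => Submodule.smul_mem _ _ ?_
  have := hg (MvPolynomial.mem_support_iff.1 hs)
  exact weightFiltration_mono (by omega) (key s)

end Operations

end Weight

end

noncomputable section

/-! ### Derivations of the coordinate ring of the unitriangular group -/

/-- A derivation that lowers the weight of every generator by `e` lowers the weight of every
monomial by `e`. -/
theorem exists_weight_of_mem_support_mkDerivation {k σ : Type*} [CommRing k] {w : σ → ℕ} {e : ℕ}
    {f : σ → MvPolynomial σ k} (hf : ∀ v, ∀ u ∈ (f v).support, Finsupp.weight w u + e = w v)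
    {g : MvPolynomial σ k} {t : σ →₀ ℕ} (ht : t ∈ (MvPolynomial.mkDerivation k f g).support) :
    ∃ s ∈ g.support, Finsupp.weight w t + e = Finsupp.weight w s := by
  classical
  rw [g.as_sum, map_sum] at ht
  obtain ⟨s, hs, ht⟩ := Finset.mem_biUnion.1 (MvPolynomial.support_sum ht)
  refine ⟨s, hs, ?_⟩
  rw [MvPolynomial.mkDerivation_monomial] at ht
  replace ht := MvPolynomial.support_smul ht
  obtain ⟨v, hv, ht⟩ := Finset.mem_biUnion.1 (MvPolynomial.support_sum ht)
  simp only [smul_eq_mul] at ht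
  obtain ⟨a, ha, u, hu, rfl⟩ := Finset.mem_add.1 (MvPolynomial.support_mul _ _ ht)
  rw [Finset.mem_singleton.1 (MvPolynomial.support_monomial_subset ha), map_add, add_assoc,
    hf v u hu]
  have h1 : s - Finsupp.single v 1 + Finsupp.single v 1 = s :=
    tsub_add_cancel_of_le (Finsupp.single_le_iff.2
      (Nat.one_le_iff_ne_zero.2 (Finsupp.mem_support_iff.1 hv)))
  conv_rhs => rw [← h1, map_add, Finsupp.weight_single, one_smul]

/-- The polynomials without monomials that have all exponents less than `p`. -/
def powerIdeal (k σ : Type*) [CommRing k] (p : ℕ) : Ideal (MvPolynomial σ k) where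
  carrier := {g | ∀ s : σ →₀ ℕ, (∀ v, s v < p) → g.coeff s = 0}
  zero_mem' s _ := MvPolynomial.coeff_zero s
  add_mem' {f g} hf hg s hs := by rw [MvPolynomial.coeff_add, hf s hs, hg s hs, add_zero]
  smul_mem' f g hg s hs := by
    classical
    rw [smul_eq_mul, MvPolynomial.coeff_mul]
    refine Finset.sum_eq_zero fun ij hij => ?_
    rw [Finset.HasAntidiagonal.mem_antidiagonal] at hij
    rw [hg ij.2, mul_zero]
    intro v
    refine lt_of_le_of_lt ?_ (hs v)
    rw [← hij, Finsupp.add_apply]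
    exact Nat.le_add_left _ _

/-- A polynomial with vanishing constant term lies in the ideal of polynomials without reduced
monomials if its partial derivatives do. -/
theorem mem_powerIdeal_of_pderiv {k σ : Type*} [Field k] {p : ℕ} [CharP k p]
    {g : MvPolynomial σ k} (h0 : g.coeff 0 = 0)
    (h : ∀ v, MvPolynomial.pderiv v g ∈ powerIdeal k σ p) : g ∈ powerIdeal k σ p := by
  intro s hs
  by_cases h1 : s = 0
  · rw [h1, h0]
  obtain ⟨v, hv⟩ := Finsupp.ne_iff.1 h1
  rw [Finsupp.zero_apply] at hv
  have e : s - Finsupp.single v 1 + Finsupp.single v 1 = s :=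
    tsub_add_cancel_of_le (Finsupp.single_le_iff.2 (Nat.one_le_iff_ne_zero.2 hv))
  have h2 := h v (s - Finsupp.single v 1) fun u =>
    lt_of_le_of_lt (by rw [Finsupp.tsub_apply]; exact Nat.sub_le _ _) (hs u)
  rw [MvPolynomial.coeff_pderiv, e, mul_eq_zero] at h2
  -- The derivative multiplies the coefficient of `s` by the exponent `s v`, which is invertible
  -- since `0 < s v < p`.
  refine h2.resolve_right fun h3 => ?_
  rw [Finsupp.tsub_apply, Finsupp.single_eq_same, ← Nat.cast_add_one,
    Nat.sub_add_cancel (Nat.one_le_iff_ne_zero.2 hv), CharP.cast_eq_zero_iff k p] at h3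
  exact absurd (Nat.le_of_dvd (Nat.pos_of_ne_zero hv) h3) (not_le.2 (hs v))

/-- The positions above the diagonal of a matrix. -/
abbrev Root (d : ℕ) : Type := {v : Fin (d + 1) × Fin (d + 1) // v.1 < v.2}

/-- The distance of a position from the diagonal. -/
def Root.height {d : ℕ} (v : Root d) : ℕ := (v.1.2 : ℕ) - v.1.1

theorem Root.height_pos {d : ℕ} (v : Root d) : 0 < v.height :=
  Nat.sub_pos_of_lt v.2

section RootPolynomial

variable (k : Type*) [Field k] {d : ℕ}

/-- The entries of the generic upper unitriangular matrix. -/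
def rootVar (a b : Fin (d + 1)) : MvPolynomial (Root d) k :=
  if h : a < b then MvPolynomial.X ⟨(a, b), h⟩ else if a = b then 1 else 0

variable {k}

theorem rootVar_of_lt {a b : Fin (d + 1)} (h : a < b) :
    rootVar k a b = MvPolynomial.X ⟨(a, b), h⟩ := dif_pos h

theorem rootVar_self (a : Fin (d + 1)) : rootVar k a a = 1 := by
  rw [rootVar, dif_neg (lt_irrefl a), if_pos rfl]

theorem rootVar_of_gt {a b : Fin (d + 1)} (h : b < a) : rootVar k a b = 0 := by
  rw [rootVar, dif_neg h.not_gt, if_neg h.ne']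

theorem weight_of_mem_support_rootVar {a b : Fin (d + 1)} {u : Root d →₀ ℕ}
    (hu : u ∈ (rootVar k a b).support) :
    a ≤ b ∧ Finsupp.weight Root.height u + a = b := by
  rcases lt_trichotomy a b with h | rfl | h
  · rw [rootVar_of_lt h, MvPolynomial.support_X, Finset.mem_singleton] at hu
    rw [hu, Finsupp.weight_single, one_smul]
    exact ⟨h.le, Nat.sub_add_cancel (Fin.le_def.1 h.le)⟩
  · rw [rootVar_self, MvPolynomial.support_one, Finset.mem_singleton] at hu
    rw [hu, map_zero, zero_add]
    exact ⟨le_rfl, rfl⟩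
  · rw [rootVar_of_gt h] at hu
    simp at hu

variable (k) in
/-- The derivation replacing the column `j` by the column `i`. -/
def rootDer (i j : Fin (d + 1)) :
    Derivation k (MvPolynomial (Root d) k) (MvPolynomial (Root d) k) :=
  MvPolynomial.mkDerivation k fun v => if v.1.2 = j then rootVar k v.1.1 i else 0

theorem rootDer_X (i j : Fin (d + 1)) (v : Root d) : rootDer k i j (MvPolynomial.X v)
    = if v.1.2 = j then rootVar k v.1.1 i else 0 := by
  rw [rootDer, MvPolynomial.mkDerivation_X]

theorem rootDer_rootVar {i j : Fin (d + 1)} (hij : i < j) (a b : Fin (d + 1)) :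
    rootDer k i j (rootVar k a b) = if b = j then rootVar k a i else 0 := by
  rcases lt_trichotomy a b with h | rfl | h
  · rw [rootVar_of_lt h, rootDer_X]
  · rw [rootVar_self, Derivation.map_one_eq_zero]
    split_ifs with h
    · rw [h, rootVar_of_gt hij]
    · rfl
  · rw [rootVar_of_gt h, map_zero]
    split_ifs with h'
    · rw [rootVar_of_gt (hij.trans (h' ▸ h))]
    · rfl

theorem exists_weight_of_mem_support_rootDer {i j : Fin (d + 1)} (hij : i < j)
    {g : MvPolynomial (Root d) k} {t : Root d →₀ ℕ} (ht : t ∈ (rootDer k i j g).support) :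
    ∃ s ∈ g.support, Finsupp.weight Root.height t + ((j : ℕ) - i)
      = Finsupp.weight Root.height s := by
  refine exists_weight_of_mem_support_mkDerivation (fun v u hu => ?_) ht
  split_ifs at hu with h
  · have h1 := weight_of_mem_support_rootVar hu
    rw [Root.height, h]
    have h2 := Fin.lt_def.1 hij
    have h3 := Fin.le_def.1 h1.1
    omega
  · simp at hu

/-- The bracket relation of the elementary matrices. It makes the simple roots generate all the
others. -/
theorem rootDer_commutator {i j l : Fin (d + 1)} (hij : i < j) (hjl : j < l)
    (g : MvPolynomial (Root d) k) :
    rootDer k i l g = rootDer k i j (rootDer k j l g) - rootDer k j l (rootDer k i j g) := by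
  have : rootDer k i l = ⁅rootDer k i j, rootDer k j l⁆ := by
    refine MvPolynomial.derivation_ext fun v => ?_
    rw [Derivation.commutator_apply, rootDer_X, rootDer_X, rootDer_X]
    by_cases h1 : v.1.2 = l
    · rw [if_pos h1, if_pos h1, if_neg (by rw [h1]; exact hjl.ne'), map_zero, sub_zero,
        rootDer_rootVar hij, if_pos rfl]
    · rw [if_neg h1, if_neg h1, map_zero, zero_sub]
      split_ifs with h2
      · rw [rootDer_rootVar hjl, if_neg (hij.trans hjl).ne, neg_zero]
      · rw [map_zero, neg_zero]
  rw [this, Derivation.commutator_apply]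

theorem Derivation.sum_apply {ι R A M : Type*} [CommRing R] [CommRing A] [Algebra R A]
    [AddCommGroup M] [Module A M] [Module R M] (s : Finset ι) (D : ι → Derivation R A M) (a : A) :
    (∑ i ∈ s, D i) a = ∑ i ∈ s, D i a := by
  rw [← Derivation.coeFnAddMonoidHom_apply, map_sum, Finset.sum_apply]
  rfl

/-- For a fixed column `j` the matrix relating these derivations to the partial derivatives is
unitriangular: the coefficient is `1` for `a = i` and `0` for `a > i`. -/
theorem rootDer_eq_sum (i j : Fin (d + 1)) (g : MvPolynomial (Root d) k) :
    rootDer k i j g = ∑ a, if h : a < j then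
      rootVar k a i * MvPolynomial.pderiv (⟨(a, j), h⟩ : Root d) g else 0 := by
  let D (a : Fin (d + 1)) : Derivation k (MvPolynomial (Root d) k) (MvPolynomial (Root d) k) :=
    if h : a < j then rootVar k a i • MvPolynomial.pderiv (⟨(a, j), h⟩ : Root d) else 0
  have hD : ∀ a g, D a g = if h : a < j then
      rootVar k a i * MvPolynomial.pderiv (⟨(a, j), h⟩ : Root d) g else 0 := by
    intro a g
    by_cases h : a < j
    · rw [dif_pos h]
      simp only [D, dif_pos h, Derivation.smul_apply, smul_eq_mul]
    · rw [dif_neg h]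
      simp only [D, dif_neg h, Derivation.zero_apply]
  have : rootDer k i j = ∑ a, D a := by
    refine MvPolynomial.derivation_ext fun v => ?_
    rw [rootDer_X, Derivation.sum_apply]
    obtain ⟨⟨a, b⟩, hab⟩ := v
    rw [Finset.sum_eq_single a]
    · rw [hD]
      split_ifs with h h' h'
      · subst h
        rw [MvPolynomial.pderiv_X_self, mul_one]
      · subst h
        exact absurd hab h'
      · rw [MvPolynomial.pderiv_X_of_ne, mul_zero]
        intro h1
        exact h (congrArg (fun v : Root d => v.1.2) h1)
      · rfl
    · intro c _ hc
      rw [hD]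
      split_ifs
      · rw [MvPolynomial.pderiv_X_of_ne, mul_zero]
        intro h1
        exact hc (congrArg (fun v : Root d => v.1.1) h1).symm
      · rfl
    · intro h
      exact absurd (Finset.mem_univ a) h
  rw [this, Derivation.sum_apply]
  exact Finset.sum_congr rfl fun a _ => hD a g

/-- The composite of the derivations for the simple roots of a list. -/
def wordDer : List (Fin d) → MvPolynomial (Root d) k → MvPolynomial (Root d) k
  | [], g => g
  | i :: l, g => wordDer l (rootDer k i.castSucc i.succ g)

theorem wordDer_sub (l : List (Fin d)) (f g : MvPolynomial (Root d) k) :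
    wordDer l (f - g) = wordDer l f - wordDer l g := by
  induction l generalizing f g with
  | nil => rfl
  | cons i l ih => rw [wordDer, map_sub, ih]; rfl

/-- The polynomials whose images under all composites of derivations have vanishing constant
term. -/
def WordKilled (g : MvPolynomial (Root d) k) : Prop :=
  ∀ l : List (Fin d), (wordDer l g).coeff 0 = 0

theorem WordKilled.sub {f g : MvPolynomial (Root d) k} (hf : WordKilled f) (hg : WordKilled g) :
    WordKilled (f - g) := fun l => by
  rw [wordDer_sub, MvPolynomial.coeff_sub, hf l, hg l, sub_zero]

theorem WordKilled.rootDer_simple {g : MvPolynomial (Root d) k} (hg : WordKilled g) (i : Fin d) :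
    WordKilled (_root_.rootDer k i.castSucc i.succ g) := by
  intro l
  have h := hg (i :: l)
  rw [wordDer] at h
  exact h

theorem wordKilled_rootDer {g : MvPolynomial (Root d) k} (hg : WordKilled g)
    {i j : Fin (d + 1)} (hij : i < j) : WordKilled (rootDer k i j g) := by
  induction j using Fin.induction generalizing g with
  | zero => exact absurd hij (Fin.not_lt_zero i)
  | succ j ih =>
    rcases lt_or_eq_of_le (Fin.le_castSucc_iff.2 hij) with h | h
    · rw [rootDer_commutator h (Fin.castSucc_lt_succ (i := j))]
      exact (ih (hg.rootDer_simple j) h).sub ((ih hg h).rootDer_simple j)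
    · rw [h]
      exact hg.rootDer_simple j

/-- Induction on the weight. All root derivatives of `g` are again killed and have smaller weight,
so they lie in the ideal. By triangularity so do all partial derivatives, and then so does `g`,
whose constant term is the case of the empty word. -/
theorem WordKilled.mem_powerIdeal {p : ℕ} [CharP k p] {g : MvPolynomial (Root d) k}
    (hg : WordKilled g) : g ∈ powerIdeal k (Root d) p := by
  suffices ∀ m : ℕ, ∀ g : MvPolynomial (Root d) k, WordKilled g →
      (∀ s ∈ g.support, Finsupp.weight Root.height s < m) → g ∈ powerIdeal k (Root d) p from
    this _ g hg fun s hs => Nat.lt_succ_of_le (Finset.le_sup hs)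
  clear hg g
  intro m
  induction m with
  | zero =>
    intro g _ hs
    have : g = 0 := MvPolynomial.support_eq_empty.1
      (Finset.eq_empty_of_forall_notMem fun s h => Nat.not_lt_zero _ (hs s h))
    rw [this]
    exact zero_mem _
  | succ m ih =>
    intro g hg hs
    refine mem_powerIdeal_of_pderiv (hg []) ?_
    have h1 : ∀ i j : Fin (d + 1), i < j → rootDer k i j g ∈ powerIdeal k (Root d) p := by
      intro i j hij
      refine ih _ (wordKilled_rootDer hg hij) fun t ht => ?_
      obtain ⟨s, hs', h⟩ := exists_weight_of_mem_support_rootDer hij ht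
      have := hs s hs'
      have := Fin.lt_def.1 hij
      omega
    rintro ⟨⟨i, j⟩, hij⟩
    replace hij : i < j := hij
    induction i using WellFoundedLT.induction with
    | _ i ih' =>
    have h2 := h1 i j hij
    rw [rootDer_eq_sum, ← Finset.add_sum_erase _ _ (Finset.mem_univ i), dif_pos hij,
      rootVar_self, one_mul] at h2
    -- Solving the triangular system: rows `a < i` are known by induction, and rows `a > i` have
    -- coefficient zero.
    refine (Submodule.add_mem_iff_left _ (Ideal.sum_mem _ fun a ha => ?_)).1 h2
    split_ifs with h
    · rcases lt_or_gt_of_ne (Finset.ne_of_mem_erase ha) with h3 | h3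
      · exact Ideal.mul_mem_left _ _ (ih' a h3 h h)
      · rw [rootVar_of_gt h3, zero_mul]
        exact zero_mem _
    · exact zero_mem _

theorem rootDer_isWeightedHomogeneous (i : Fin d) {m : ℕ} {g : MvPolynomial (Root d) k}
    (hg : MvPolynomial.IsWeightedHomogeneous Root.height g (m + 1)) :
    MvPolynomial.IsWeightedHomogeneous Root.height (rootDer k i.castSucc i.succ g) m := by
  intro t ht
  obtain ⟨s, hs, h⟩ := exists_weight_of_mem_support_rootDer (Fin.castSucc_lt_succ (i := i))
    (MvPolynomial.mem_support_iff.2 ht)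
  have := hg (MvPolynomial.mem_support_iff.1 hs)
  simp only [Fin.val_succ, Fin.val_castSucc] at h
  omega

theorem rootDer_eq_zero (i : Fin d) {g : MvPolynomial (Root d) k}
    (hg : MvPolynomial.IsWeightedHomogeneous Root.height g 0) :
    rootDer k i.castSucc i.succ g = 0 := by
  refine MvPolynomial.support_eq_empty.1 (Finset.eq_empty_of_forall_notMem fun t ht => ?_)
  obtain ⟨s, hs, h⟩ := exists_weight_of_mem_support_rootDer (Fin.castSucc_lt_succ (i := i)) ht
  have := hg (MvPolynomial.mem_support_iff.1 hs)
  simp only [Fin.val_succ, Fin.val_castSucc] at h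
  omega

theorem wordDer_zero (l : List (Fin d)) : wordDer l (0 : MvPolynomial (Root d) k) = 0 := by
  induction l with
  | nil => rfl
  | cons i l ih => rw [wordDer, map_zero, ih]

theorem coeff_wordDer_of_ne {l : List (Fin d)} {m : ℕ} (h : l.length ≠ m)
    {g : MvPolynomial (Root d) k} (hg : MvPolynomial.IsWeightedHomogeneous Root.height g m) :
    (wordDer l g).coeff 0 = 0 := by
  induction l generalizing m g with
  | nil =>
    refine hg.coeff_eq_zero 0 ?_
    rw [map_zero]
    exact h
  | cons i l ih =>
    rw [wordDer]
    cases m with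
    | zero => rw [rootDer_eq_zero i hg, wordDer_zero, MvPolynomial.coeff_zero]
    | succ m => exact ih (by simpa using h) (rootDer_isWeightedHomogeneous i hg)

/-- A homogeneous polynomial has no reduced monomials if it is killed by all composites of
derivations. -/
theorem mem_powerIdeal_of_wordDer {p : ℕ} [CharP k p] {m : ℕ} {g : MvPolynomial (Root d) k}
    (hg : MvPolynomial.IsWeightedHomogeneous Root.height g m)
    (h : ∀ l : List (Fin d), l.length = m → (wordDer l g).coeff 0 = 0) :
    g ∈ powerIdeal k (Root d) p := by
  refine WordKilled.mem_powerIdeal fun l => ?_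
  by_cases hl : l.length = m
  · exact h l hl
  · exact coeff_wordDer_of_ne hl hg

/-- Polynomials without reduced monomials have lower weight if the `p`th powers of the
generators do. -/
theorem map_mem_weightFiltration_of_mem_powerIdeal {σ O : Type*} [CommRing O] [Algebra k O]
    {q : MvPolynomial σ k →ₐ[k] O} {w : σ → ℕ} {J : Ideal O} {p : ℕ}
    (hp : ∀ v, q (MvPolynomial.X v) ^ p ∈ weightFiltration q w J (p * w v : ℕ))
    {m : ℕ} {g : MvPolynomial σ k} (hg : MvPolynomial.IsWeightedHomogeneous w g m)
    (h : g ∈ powerIdeal k σ p) : q g ∈ weightFiltration q w J m := by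
  rw [g.as_sum, map_sum]
  refine Submodule.sum_mem _ fun s hs => ?_
  have hs' := MvPolynomial.mem_support_iff.1 hs
  obtain ⟨v, hv⟩ : ∃ v, p ≤ s v := by
    by_contra! hc
    exact hs' (h s hc)
  have e : s - Finsupp.single v p + Finsupp.single v p = s :=
    tsub_add_cancel_of_le (Finsupp.single_le_iff.2 hv)
  have e2 : MvPolynomial.monomial s (g.coeff s)
      = MvPolynomial.monomial (s - Finsupp.single v p) (g.coeff s) * MvPolynomial.X v ^ p := by
    rw [MvPolynomial.X_pow_eq_monomial, MvPolynomial.monomial_mul, mul_one, e]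
  have e3 : Finsupp.weight w (s - Finsupp.single v p) + p * w v = m := by
    rw [← hg hs', ← smul_eq_mul, ← Finsupp.weight_single, ← map_add, e]
  rw [e2, map_mul, map_pow]
  exact weightFiltration_mul (map_monomial_mem (lt_add_one _) _) (hp v) (by omega)

end RootPolynomial

end

noncomputable section

/-! ### Augmented algebras in duality with the coordinate ring of the unitriangular group -/

/-- A pairing of an augmented algebra `A` with generators `gen i` and a commutative algebra `O` on
which `A` acts from the right. Modulo an ideal, `O` is filtered by the weight of polynomials in
the entries of the generic upper unitriangular matrix. The augmentation ideal lowers the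
filtration, and the leading terms of the operations of the generators are the derivations of the
simple roots. -/
structure RootModel {k A : Type*} [Field k] [Ring A] [Algebra k A] (ε : A →ₐ[k] k)
    (d p : ℕ) (O : Type*) [CommRing O] [Algebra k O] where
  /-- the right action -/
  act : A →ₐ[k] (Module.End k O)ᵐᵒᵖ
  /-- the evaluation at the base point -/
  ev : O →ₐ[k] k
  /-- the coordinates -/
  coord : MvPolynomial (Root d) k →ₐ[k] O
  /-- the ideal pairing to zero with `A` -/
  ideal : Ideal O
  /-- the generators for the simple roots -/
  gen : Fin d → A
  ev_ideal : ∀ f ∈ ideal, ev f = 0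
  act_sub_mem : ∀ (x : A) (m : ℤ) (f : O), f ∈ weightFiltration coord Root.height ideal (m + 1) →
    (act x).unop f - ε x • f ∈ weightFiltration coord Root.height ideal m
  counit_gen : ∀ i, ε (gen i) = 0
  act_gen_sub_mem : ∀ (i : Fin d) (m : ℕ) (g : MvPolynomial (Root d) k),
    MvPolynomial.IsWeightedHomogeneous Root.height g (m + 1) →
    (act (gen i)).unop (coord g) - coord (rootDer k i.castSucc i.succ g)
      ∈ weightFiltration coord Root.height ideal m
  coord_pow_mem : ∀ v, coord (MvPolynomial.X v) ^ p
    ∈ weightFiltration coord Root.height ideal (p * v.height : ℕ)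
  exists_coord : ∀ f, ∃ g, f - coord g ∈ ideal
  eq_zero : ∀ x, (∀ f, ev ((act x).unop f) = 0) → x = 0

namespace RootModel

variable {k A O : Type*} [Field k] [Ring A] [Algebra k A] [CommRing O] [Algebra k O]
  {ε : A →ₐ[k] k} {d p : ℕ} (M : RootModel ε d p O)

/-- The weight filtration of a model. -/
def filt (m : ℤ) : Submodule k O := weightFiltration M.coord Root.height M.ideal m

/-- The pairing of a model. -/
def pair : A →ₗ[k] O →ₗ[k] k :=
  LinearMap.mk₂ k (fun x f => M.ev ((M.act x).unop f))
    (fun x y f => by simp) (fun c x f => by simp) (fun x f g => by simp) (fun c x f => by simp)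

theorem pair_apply (x : A) (f : O) : M.pair x f = M.ev ((M.act x).unop f) := rfl

theorem pair_one (f : O) : M.pair 1 f = M.ev f := by
  rw [pair_apply, map_one]
  rfl

theorem pair_mul (x y : A) (f : O) : M.pair (x * y) f = M.pair y ((M.act x).unop f) := by
  rw [pair_apply, map_mul, MulOpposite.unop_mul, Module.End.mul_apply, pair_apply]

theorem mem_filt_zero {f : O} : f ∈ M.filt 0 ↔ f ∈ M.ideal :=
  ⟨weightFiltration_of_nonpos le_rfl, mem_weightFiltration_of_mem_ideal⟩

theorem filt_mono {a b : ℤ} (h : a ≤ b) : M.filt a ≤ M.filt b := weightFiltration_mono h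

theorem act_mem_filt {x : A} (hx : ε x = 0) {m : ℤ} {f : O} (hf : f ∈ M.filt (m + 1)) :
    (M.act x).unop f ∈ M.filt m := by
  have h := M.act_sub_mem x m f hf
  rwa [hx, zero_smul, sub_zero] at h

theorem act_mem_ideal (x : A) {f : O} (hf : f ∈ M.ideal) : (M.act x).unop f ∈ M.ideal := by
  have h := M.act_sub_mem x (-1) f (mem_weightFiltration_of_mem_ideal hf)
  have h' := weightFiltration_of_nonpos (by norm_num) h
  rw [Algebra.smul_def] at h'
  exact (Submodule.sub_mem_iff_left _ (M.ideal.mul_mem_left _ hf)).1 h'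

theorem pair_ideal (x : A) {f : O} (hf : f ∈ M.ideal) : M.pair x f = 0 :=
  M.ev_ideal _ (M.act_mem_ideal x hf)

/-- Each of the `m` factors lowers the filtration by one, so `f` ends up in the ideal. -/
theorem pair_eq_zero_of_mem {m : ℕ} {x : A} (hx : x ∈ augFiltration ε m) {f : O}
    (hf : f ∈ M.filt m) : M.pair x f = 0 := by
  induction m generalizing x f with
  | zero => exact M.pair_ideal x (M.mem_filt_zero.1 (by exact_mod_cast hf))
  | succ m ih =>
    induction hx using E0.aug_succ_induction with
    | hmul a b ha hb =>
      rw [pair_mul]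
      refine ih hb (M.act_mem_filt (E0.counit_eq_zero one_pos ha) ?_)
      exact_mod_cast hf
    | hadd x y _ _ hx hy => rw [map_add, LinearMap.add_apply, hx, hy, add_zero]

/-- The product of the generators in a list. -/
def genWord (l : List (Fin d)) : A := (l.map M.gen).prod

theorem genWord_cons (i : Fin d) (l : List (Fin d)) :
    M.genWord (i :: l) = M.gen i * M.genWord l := by
  simp [genWord]

theorem gen_mem (i : Fin d) : M.gen i ∈ augFiltration ε 1 := E0.mem_aug_one (M.counit_gen i)

theorem genWord_mem (l : List (Fin d)) : M.genWord l ∈ augFiltration ε l.length := by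
  induction l with
  | nil => exact augFiltration_zero_eq_top _ _
  | cons i l ih =>
    rw [genWord_cons, List.length_cons, add_comm]
    exact augFiltration_mul_mem (M.gen_mem i) ih

/-- The generators act as derivations up to terms of lower filtration, and the remaining letters of
the word annihilate these terms. The value no longer depends on the model. -/
theorem pair_genWord (l : List (Fin d)) {g : MvPolynomial (Root d) k}
    (hg : MvPolynomial.IsWeightedHomogeneous Root.height g l.length) :
    M.pair (M.genWord l) (M.coord g) = (wordDer l g).coeff 0 := by
  induction l generalizing g with
  | nil =>
    -- All heights are positive, so weight zero means constant.
    have h : g = MvPolynomial.C (g.coeff 0) := by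
      ext s
      rw [MvPolynomial.coeff_C]
      split_ifs with hs
      · rw [hs]
      · refine hg.coeff_eq_zero s fun h0 => hs ?_
        ext v
        by_contra hv
        have := Finsupp.le_weight_of_ne_zero' Root.height (s := v) (f := s) fun h => hv h.symm
        have := v.height_pos
        rw [List.length_nil] at h0
        omega
    have e : M.genWord [] = 1 := rfl
    rw [e, pair_one, wordDer, h, MvPolynomial.coeff_zero_C]
    rw [← MvPolynomial.algebraMap_eq, AlgHom.commutes, AlgHom.commutes]
    rfl
  | cons i l ih =>
    rw [genWord_cons, pair_mul, wordDer, ← ih (rootDer_isWeightedHomogeneous i hg), ← sub_eq_zero,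
      ← map_sub]
    exact M.pair_eq_zero_of_mem (M.genWord_mem l) (M.act_gen_sub_mem i _ g hg)

theorem exists_mem_filt (f : O) : ∃ m : ℕ, f ∈ M.filt m := by
  obtain ⟨g, hg⟩ := M.exists_coord f
  refine ⟨g.support.sup (Finsupp.weight Root.height) + 1, ?_⟩
  rw [← sub_add_cancel f (M.coord g)]
  refine add_mem (mem_weightFiltration_of_mem_ideal hg) (map_mem_weightFiltration ?_)
  rw [weightLT, MvPolynomial.mem_restrictSupport_iff]
  intro s hs
  have := Finset.le_sup (f := Finsupp.weight Root.height) hs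
  change (Finsupp.weight Root.height s : ℤ) < _
  push_cast
  omega

/-- A monomial with an exponent at least `p` can be rewritten in lower weight; the process stops at
weight zero. This bounds the dimension of the dual. -/
theorem exists_reduced {m : ℕ} {f : O} (hf : f ∈ M.filt m) :
    ∃ g ∈ MvPolynomial.restrictSupport k {s : Root d →₀ ℕ | ∀ v, s v < p},
      f - M.coord g ∈ M.ideal := by
  induction m using Nat.strong_induction_on generalizing f with
  | _ m ih =>
    induction hf using weightFiltration_induction with
    | hJ f hf => exact ⟨0, zero_mem _, by rwa [map_zero, sub_zero]⟩
    | hadd f f' _ _ h h' =>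
      obtain ⟨g, hg, h⟩ := h
      obtain ⟨g', hg', h'⟩ := h'
      refine ⟨g + g', add_mem hg hg', ?_⟩
      rw [map_add, add_sub_add_comm]
      exact add_mem h h'
    | hsmul c f _ h =>
      obtain ⟨g, hg, h⟩ := h
      refine ⟨c • g, Submodule.smul_mem _ _ hg, ?_⟩
      rw [map_smul, ← smul_sub, Algebra.smul_def]
      exact M.ideal.mul_mem_left _ h
    | hq s hs =>
      by_cases h : ∀ v, s v < p
      · refine ⟨MvPolynomial.monomial s 1, ?_, ?_⟩
        · rw [MvPolynomial.mem_restrictSupport_iff]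
          intro t ht
          rw [Finset.mem_singleton.1 (MvPolynomial.support_monomial_subset ht)]
          exact h
        · rw [sub_self]
          exact zero_mem _
      · refine ih (Finsupp.weight Root.height s) (by exact_mod_cast hs) ?_
        refine map_mem_weightFiltration_of_mem_powerIdeal M.coord_pow_mem
          (MvPolynomial.isWeightedHomogeneous_monomial _ s 1 rfl) fun t ht => ?_
        rw [MvPolynomial.coeff_monomial, if_neg]
        rintro rfl
        exact h ht

/-- The pairing modulo the ideal. -/
def quotPair : A →ₗ[k] (O ⧸ M.ideal.restrictScalars k) →ₗ[k] k where
  toFun x := Submodule.liftQ _ (M.pair x) fun _ hf => M.pair_ideal x hf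
  map_add' x y := by
    refine Submodule.linearMap_qext _ (LinearMap.ext fun f => ?_)
    change M.pair (x + y) f = M.pair x f + M.pair y f
    rw [map_add, LinearMap.add_apply]
  map_smul' c x := by
    refine Submodule.linearMap_qext _ (LinearMap.ext fun f => ?_)
    change M.pair (c • x) f = c • M.pair x f
    rw [map_smul, LinearMap.smul_apply]

/-! ### Perfect duality between the two filtrations. -/

section Char

variable [CharP k p]

/-- An element of filtration `m` which pairs to zero with the words of length `m` has filtration
one less. -/
theorem mem_filt_of_genWord {m : ℕ} {f : O} (hf : f ∈ M.filt (m + 1))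
    (h : ∀ l : List (Fin d), l.length = m → M.pair (M.genWord l) f = 0) : f ∈ M.filt m := by
  obtain ⟨g, hg, hfg⟩ := exists_sub_mem_weightFiltration hf
  have h1 : g ∈ powerIdeal k (Root d) p := by
    refine mem_powerIdeal_of_wordDer hg fun l hl => ?_
    subst hl
    rw [← M.pair_genWord l hg]
    -- The remainder `f - coord g` pairs to zero with words of length `m`, so the hypothesis on `f`
    -- passes to its leading form `g`.
    have := M.pair_eq_zero_of_mem (M.genWord_mem l) hfg
    rw [map_sub, h l rfl, zero_sub, neg_eq_zero] at this
    exact this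
  rw [← sub_add_cancel f (M.coord g)]
  exact add_mem hfg (map_mem_weightFiltration_of_mem_powerIdeal M.coord_pow_mem hg h1)

/-- Every `f` lies in some step of the filtration. Words of length `m + j` lie in `I ^ m`, so `f`
descends one step at a time down to `m`. -/
theorem mem_filt_of_augFiltration {m : ℕ} {f : O}
    (h : ∀ x ∈ augFiltration ε m, M.pair x f = 0) : f ∈ M.filt m := by
  obtain ⟨N, hN⟩ := M.exists_mem_filt f
  have key : ∀ j : ℕ, f ∈ M.filt (m + j : ℕ) → f ∈ M.filt m := by
    intro j
    induction j with
    | zero => exact fun h => h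
    | succ j ih =>
      intro hj
      refine ih (M.mem_filt_of_genWord (by exact_mod_cast hj) fun l hl => h _ ?_)
      exact E0.aug_anti (by omega) (M.genWord_mem l)
  exact key N (M.filt_mono (by push_cast; omega) hN)

theorem finite_quotient : Module.Finite k (O ⧸ M.ideal.restrictScalars k) := by
  let R := MvPolynomial.restrictSupport k {s : Root d →₀ ℕ | ∀ v, s v < p}
  have h1 : {s : Root d →₀ ℕ | ∀ v, s v < p}.Finite := by
    refine Set.Finite.of_injOn (f := fun s : Root d →₀ ℕ => (s : Root d → ℕ))
      (t := Set.pi Set.univ fun _ => Set.Iio p) ?_ DFunLike.coe_injective.injOn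
      (Set.Finite.pi fun _ => Set.finite_Iio p)
    intro s hs v _
    exact hs v
  have : Finite {s : Root d →₀ ℕ | ∀ v, s v < p} := h1
  have : Module.Finite k R := Module.Finite.of_basis (MvPolynomial.basisRestrictSupport k _)
  refine Module.Finite.of_surjective
    ((M.ideal.restrictScalars k).mkQ.comp (M.coord.toLinearMap.comp R.subtype)) fun f => ?_
  obtain ⟨f, rfl⟩ := Submodule.mkQ_surjective _ f
  obtain ⟨m, hm⟩ := M.exists_mem_filt f
  obtain ⟨g, hg, h⟩ := M.exists_reduced hm
  refine ⟨⟨g, hg⟩, ?_⟩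
  refine ((Submodule.Quotient.eq _).2 ?_).symm
  exact h

/-- The quotient is finite-dimensional and the pairing is injective on both sides: on `A` by
assumption, on the quotient by the case `m = 0` of the preceding descent. -/
theorem isPerfPair : M.quotPair.IsPerfPair := by
  have := M.finite_quotient
  refine LinearMap.IsPerfPair.of_injective' ?_ ?_
  · rw [injective_iff_map_eq_zero]
    intro x hx
    refine M.eq_zero x fun f => ?_
    exact LinearMap.congr_fun hx (Submodule.Quotient.mk f)
  · rw [injective_iff_map_eq_zero]
    intro f hf
    obtain ⟨f, rfl⟩ := Submodule.Quotient.mk_surjective _ f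
    rw [Submodule.Quotient.mk_eq_zero]
    refine M.mem_filt_zero.1 ?_
    exact_mod_cast M.mem_filt_of_augFiltration (m := 0) fun x _ => LinearMap.congr_fun hf x

theorem exists_pair_eq_left (φ : A →ₗ[k] k) : ∃ f, ∀ x, M.pair x f = φ x := by
  obtain ⟨f, hf⟩ := M.isPerfPair.bijective_right.2 φ
  obtain ⟨f, rfl⟩ := Submodule.Quotient.mk_surjective _ f
  exact ⟨f, fun x => LinearMap.congr_fun hf x⟩

theorem exists_pair_eq_right (ψ : O →ₗ[k] k) (hψ : ∀ f ∈ M.ideal, ψ f = 0) :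
    ∃ x, ∀ f, M.pair x f = ψ f := by
  obtain ⟨x, hx⟩ := M.isPerfPair.bijective_left.2 (Submodule.liftQ _ ψ fun f hf => hψ f hf)
  exact ⟨x, fun f => LinearMap.congr_fun hx (Submodule.Quotient.mk f)⟩

/-- The powers of the augmentation ideal are the annihilators of the weight filtration. -/
theorem mem_augFiltration_iff {m : ℕ} {x : A} :
    x ∈ augFiltration ε m ↔ ∀ f ∈ M.filt m, M.pair x f = 0 := by
  refine ⟨fun hx f hf => M.pair_eq_zero_of_mem hx hf, fun h => ?_⟩
  by_contra hx
  -- A functional separating `x` from `I ^ m` is the pairing with some `f`. This `f` annihilates `I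
  -- ^ m`, hence lies in step `m`, contrary to the assumption on `x`.
  obtain ⟨φ, hφ, hφ'⟩ := Submodule.exists_le_ker_of_notMem hx
  obtain ⟨f, hf⟩ := M.exists_pair_eq_left φ
  refine hφ ?_
  rw [← hf]
  refine h f (M.mem_filt_of_augFiltration fun y hy => ?_)
  rw [hf]
  exact hφ' hy

/-- The powers of the augmentation ideal are generated by words in the generators. -/
theorem exists_span_genWord {m : ℕ} {x : A} (hx : x ∈ augFiltration ε m) :
    ∃ y ∈ Submodule.span k (M.genWord '' {l | l.length = m}), x - y ∈ augFiltration ε (m + 1) := by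
  suffices h : x ∈ Submodule.span k (M.genWord '' {l | l.length = m})
      ⊔ augFiltration ε (m + 1) by
    obtain ⟨y, hy, z, hz, rfl⟩ := Submodule.mem_sup.1 h
    exact ⟨y, hy, by rwa [add_sub_cancel_left]⟩
  by_contra hx'
  obtain ⟨φ, hφ, hφ'⟩ := Submodule.exists_le_ker_of_notMem hx'
  obtain ⟨f, hf⟩ := M.exists_pair_eq_left φ
  refine hφ ?_
  rw [← hf]
  refine M.pair_eq_zero_of_mem hx (M.mem_filt_of_genWord ?_ fun l hl => ?_)
  · refine M.mem_filt_of_augFiltration (m := m + 1) fun y hy => ?_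
    rw [hf]
    exact hφ' (Submodule.mem_sup_right hy)
  · rw [hf]
    exact hφ' (Submodule.mem_sup_left (Submodule.subset_span ⟨l, hl, rfl⟩))

end Char

end RootModel

end

noncomputable section

/-! ### Comparison of the associated graded algebras -/

/-- Two surjections with the same kernel have isomorphic images. -/
theorem exists_algEquiv_of_ker {k F A B : Type*} [CommRing k] [Ring F] [Ring A] [Ring B]
    [Algebra k F] [Algebra k A] [Algebra k B] (f : F →ₐ[k] A) (g : F →ₐ[k] B)
    (hf : Function.Surjective f) (hg : Function.Surjective g) (h : ∀ z, f z = 0 ↔ g z = 0) :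
    ∃ e : A ≃ₐ[k] B, ∀ z, e (f z) = g z := by
  have h' : ∀ y z, f y = f z ↔ g y = g z := fun y z => by
    rw [← sub_eq_zero, ← map_sub, h, map_sub, sub_eq_zero]
  let s := Function.surjInv hf
  have hs : ∀ a, f (s a) = a := Function.surjInv_eq hf
  have hgs : ∀ z, g (s (f z)) = g z := fun z => (h' _ _).1 (hs _)
  let e : A →ₐ[k] B :=
    { toFun := fun a => g (s a)
      map_one' := by rw [← map_one f, hgs, map_one]
      map_mul' := fun a b => by
        conv_lhs => rw [← hs a, ← hs b, ← map_mul, hgs, map_mul]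
      map_zero' := by rw [← map_zero f, hgs, map_zero]
      map_add' := fun a b => by
        conv_lhs => rw [← hs a, ← hs b, ← map_add, hgs, map_add]
      commutes' := fun c => by rw [← f.commutes c, hgs, g.commutes] }
  have he : Function.Bijective e := by
    constructor
    · intro a b hab
      have := (h' (s a) (s b)).2 hab
      rwa [hs, hs] at this
    · intro b
      obtain ⟨z, rfl⟩ := hg b
      exact ⟨f z, hgs z⟩
  exact ⟨AlgEquiv.ofBijective e he, hgs⟩

/-- The product of the generators of a free algebra in a list. -/
def freeWord (k : Type*) [CommRing k] {ι : Type*} (l : List ι) : FreeAlgebra k ι :=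
  (l.map (FreeAlgebra.ι k)).prod

theorem span_freeWord (k : Type*) [CommRing k] (ι : Type*) :
    Submodule.span k (Set.range (freeWord k (ι := ι))) = ⊤ := by
  rw [eq_top_iff]
  rintro x -
  induction x using FreeAlgebra.induction with
  | grade0 r =>
    rw [Algebra.algebraMap_eq_smul_one]
    exact Submodule.smul_mem _ _ (Submodule.subset_span ⟨[], rfl⟩)
  | grade1 r => exact Submodule.subset_span ⟨[r], by simp [freeWord]⟩
  | add x y hx hy => exact add_mem hx hy
  | mul x y hx hy =>
    have := Submodule.mul_mem_mul hx hy
    rw [Submodule.span_mul_span] at this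
    refine Submodule.span_mono ?_ this
    rintro _ ⟨_, ⟨l, rfl⟩, _, ⟨m, rfl⟩, rfl⟩
    exact ⟨l ++ m, by simp [freeWord]⟩

theorem E0.exists_eq_sum {k A : Type*} [CommRing k] [Ring A] [Algebra k A] {ε : A →ₐ[k] k}
    (z : E0 ε) : ∃ (N : ℕ) (x : ∀ m, augFiltration ε m), ∀ N', N ≤ N' →
      z = ∑ m ∈ Finset.range N', E0.cls ε m (x m) := by
  induction z using E0.induction with
  | h0 => exact ⟨0, 0, fun N' _ => (Finset.sum_eq_zero fun m _ => E0.cls_zero m).symm⟩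
  | hcls j x =>
    refine ⟨j + 1, Function.update 0 j x, fun N' hN => ?_⟩
    rw [Finset.sum_eq_single j, Function.update_self]
    · intro m _ hm
      rw [Function.update_of_ne hm]
      exact E0.cls_zero m
    · intro h
      exact absurd (Finset.mem_range.2 hN) h
  | hadd y z hy hz =>
    obtain ⟨N, x, h⟩ := hy
    obtain ⟨N', x', h'⟩ := hz
    refine ⟨max N N', x + x', fun L hL => ?_⟩
    rw [h L (le_trans (le_max_left _ _) hL), h' L (le_trans (le_max_right _ _) hL),
      ← Finset.sum_add_distrib]
    exact Finset.sum_congr rfl fun m _ => (E0.cls_add m (x m) (x' m)).symm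

namespace RootModel

variable {k A O : Type*} [Field k] [Ring A] [Algebra k A] [CommRing O] [Algebra k O]
  {ε : A →ₐ[k] k} {d p : ℕ} (M : RootModel ε d p O)

/-- The map from the free algebra to the associated graded algebra. -/
def ofFree : FreeAlgebra k (Fin d) →ₐ[k] E0 ε :=
  FreeAlgebra.lift k fun i => E0.cls ε 1 ⟨M.gen i, M.gen_mem i⟩

theorem ofFree_freeWord (l : List (Fin d)) :
    M.ofFree (freeWord k l) = E0.cls ε l.length ⟨M.genWord l, M.genWord_mem l⟩ := by
  induction l with
  | nil => exact (map_one M.ofFree).trans E0.one_eq_cls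
  | cons i l ih =>
    have e : freeWord k (i :: l) = FreeAlgebra.ι k i * freeWord k l := by simp [freeWord]
    rw [e, map_mul, ih, ofFree, FreeAlgebra.lift_ι_apply, E0.cls_mul]
    exact E0.cls_congr (by rw [List.length_cons, add_comm]) _ _ (M.genWord_cons i l).symm

/-- The pairing of the associated graded algebra with polynomials. -/
def grPair : E0 ε →ₗ[k] MvPolynomial (Root d) k →ₗ[k] k :=
  E0.desc (fun m => ((LinearMap.lcomp k k (M.coord.toLinearMap.comp
      (MvPolynomial.weightedHomogeneousComponent Root.height m))).comp M.pair).comp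
      (augFiltration ε m).subtype) (by
    intro m x hx
    refine LinearMap.ext fun g => ?_
    refine M.pair_eq_zero_of_mem hx ?_
    have := IsWeightedHomogeneous.mem_weightLT
      (MvPolynomial.weightedHomogeneousComponent_isWeightedHomogeneous (w := Root.height) m g)
    exact_mod_cast map_mem_weightFiltration this)

theorem grPair_cls (m : ℕ) (x : augFiltration ε m) (g : MvPolynomial (Root d) k) :
    M.grPair (E0.cls ε m x) g
      = M.pair x (M.coord (MvPolynomial.weightedHomogeneousComponent Root.height m g)) :=
  LinearMap.congr_fun (E0.desc_cls _ _ m x) g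

/-- The right side does not involve the model; this is what makes two models comparable. -/
theorem grPair_ofFree_freeWord (l : List (Fin d)) (g : MvPolynomial (Root d) k) :
    M.grPair (M.ofFree (freeWord k l)) g = (wordDer l
      (MvPolynomial.weightedHomogeneousComponent Root.height l.length g)).coeff 0 := by
  rw [ofFree_freeWord, grPair_cls]
  exact M.pair_genWord l
    (MvPolynomial.weightedHomogeneousComponent_isWeightedHomogeneous l.length g)

/-- An element dual to the coordinate of the root `v`. -/
def IsRootVector (v : Root d) (x : A) : Prop :=
  ∀ s : Root d →₀ ℕ, Finsupp.weight Root.height s ≤ v.height →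
    M.pair x (M.coord (MvPolynomial.monomial s 1)) = if s = Finsupp.single v 1 then 1 else 0

theorem IsRootVector.pair_eq {M : RootModel ε d p O} {v : Root d} {x : A}
    (hx : M.IsRootVector v x) {A' O' : Type*} [Ring A'] [Algebra k A'] [CommRing O'] [Algebra k O']
    {ε' : A' →ₐ[k] k} {M' : RootModel ε' d p O'} {y : A'} (hy : M'.IsRootVector v y)
    {g : MvPolynomial (Root d) k}
    (hg : MvPolynomial.IsWeightedHomogeneous Root.height g v.height) :
    M.pair x (M.coord g) = M'.pair y (M'.coord g) := by
  rw [g.as_sum]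
  simp only [map_sum]
  refine Finset.sum_congr rfl fun s hs => ?_
  have e : MvPolynomial.monomial s (g.coeff s) = g.coeff s • MvPolynomial.monomial s 1 := by
    rw [MvPolynomial.smul_monomial, smul_eq_mul, mul_one]
  have h := (hg (MvPolynomial.mem_support_iff.1 hs)).le
  rw [e, map_smul, map_smul, map_smul, map_smul, hx s h, hy s h]

section Char

variable [CharP k p]

theorem IsRootVector.mem_augFiltration {M : RootModel ε d p O} {v : Root d} {x : A}
    (hx : M.IsRootVector v x) : x ∈ augFiltration ε v.height := by
  refine M.mem_augFiltration_iff.2 fun f hf => ?_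
  induction hf using weightFiltration_induction with
  | hJ f hf => exact M.pair_ideal x hf
  | hq s hs =>
    rw [hx s (by omega), if_neg]
    rintro rfl
    rw [Finsupp.weight_single, one_smul] at hs
    exact lt_irrefl _ hs
  | hadd f g _ _ hf hg => rw [map_add, hf, hg, add_zero]
  | hsmul c f _ hf => rw [map_smul, hf, smul_zero]

theorem cls_eq_zero_of_pair {m : ℕ} {x : augFiltration ε m}
    (h : ∀ g, MvPolynomial.IsWeightedHomogeneous Root.height g m → M.pair x (M.coord g) = 0) :
    E0.cls ε m x = 0 := by
  refine E0.cls_eq_zero x (M.mem_augFiltration_iff.2 fun f hf => ?_)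
  obtain ⟨g, hg, hfg⟩ := exists_sub_mem_weightFiltration (m := m) (by exact_mod_cast hf)
  have h1 := M.pair_eq_zero_of_mem x.2 hfg
  rw [map_sub, h g hg, sub_zero] at h1
  exact h1

/-- Homogeneous polynomials of weight `m` detect `I ^ m / I ^ (m + 1)` by `cls_eq_zero_of_pair`, and
taking homogeneous components separates the degrees. -/
theorem grPair_injective : Function.Injective M.grPair := by
  rw [injective_iff_map_eq_zero]
  intro z hz
  obtain ⟨N, x, hN⟩ := E0.exists_eq_sum z
  obtain rfl := hN N le_rfl
  refine Finset.sum_eq_zero fun m hm => M.cls_eq_zero_of_pair fun g hg => ?_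
  have h := LinearMap.congr_fun hz g
  rw [map_sum, LinearMap.sum_apply, LinearMap.zero_apply, Finset.sum_eq_single m] at h
  · rwa [grPair_cls, hg.weightedHomogeneousComponent_same] at h
  · intro m' _ hne
    rw [grPair_cls, hg.weightedHomogeneousComponent_ne _ hne, map_zero, map_zero]
  · intro h'
    exact absurd hm h'

theorem component_eq_map (m : ℕ) : E0.component ε m
    = (Submodule.span k (freeWord k '' {l : List (Fin d) | l.length = m})).map
      M.ofFree.toLinearMap := by
  refine le_antisymm ?_ ?_
  · rintro _ ⟨x, rfl⟩
    obtain ⟨x, rfl⟩ := grMk_surjective ε m x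
    obtain ⟨y, hy, hxy⟩ := M.exists_span_genWord x.2
    have key : ∀ y ∈ Submodule.span k (M.genWord '' {l | l.length = m}),
        ∃ h : y ∈ augFiltration ε m, E0.cls ε m ⟨y, h⟩ ∈
          (Submodule.span k (freeWord k '' {l : List (Fin d) | l.length = m})).map
            M.ofFree.toLinearMap := by
      intro y hy
      induction hy using Submodule.span_induction with
      | mem y hy =>
        obtain ⟨l, rfl, rfl⟩ := hy
        exact ⟨M.genWord_mem l, _, Submodule.subset_span ⟨l, rfl, rfl⟩, M.ofFree_freeWord l⟩
      | zero => exact ⟨zero_mem _, (E0.cls_zero (ε := ε) m).symm ▸ zero_mem _⟩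
      | add y z _ _ hy hz =>
        obtain ⟨h, hy⟩ := hy
        obtain ⟨h', hz⟩ := hz
        exact ⟨add_mem h h', (E0.cls_add m ⟨y, h⟩ ⟨z, h'⟩) ▸ add_mem hy hz⟩
      | smul c y _ hy =>
        obtain ⟨h, hy⟩ := hy
        exact ⟨Submodule.smul_mem _ c h,
          (E0.cls_smul m c ⟨y, h⟩) ▸ Submodule.smul_mem _ c hy⟩
    obtain ⟨h, hy⟩ := key y hy
    have e : E0.cls ε m x = E0.cls ε m ⟨y, h⟩ := by
      have h0 := E0.cls_eq_zero (x - ⟨y, h⟩) hxy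
      have h1 := E0.cls_add m (x - ⟨y, h⟩) ⟨y, h⟩
      rwa [sub_add_cancel, h0, zero_add] at h1
    change E0.cls ε m x ∈ _
    rw [e]
    exact hy
  · rw [Submodule.map_span_le]
    rintro _ ⟨l, rfl, rfl⟩
    exact ⟨grMk ε l.length _, (M.ofFree_freeWord l).symm⟩

theorem ofFree_surjective : Function.Surjective M.ofFree := by
  intro z
  induction z using E0.induction with
  | h0 => exact ⟨0, map_zero _⟩
  | hcls m x =>
    have : E0.cls ε m x ∈ E0.component ε m := ⟨grMk ε m x, rfl⟩
    rw [M.component_eq_map] at this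
    obtain ⟨z, -, hz⟩ := this
    exact ⟨z, hz⟩
  | hadd x y hx hy =>
    obtain ⟨z, rfl⟩ := hx
    obtain ⟨z', rfl⟩ := hy
    exact ⟨z + z', map_add _ _ _⟩

/-- Both graded algebras are quotients of the free algebra on the simple roots, and by injectivity
of `grPair` both kernels consist of the elements with vanishing model-independent pairing. -/
theorem exists_algEquiv {A' O' : Type*} [Ring A'] [Algebra k A'] [CommRing O'] [Algebra k O']
    {ε' : A' →ₐ[k] k} (M' : RootModel ε' d p O') :
    ∃ Φ : E0 ε ≃ₐ[k] E0 ε',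
      (∀ m, (E0.component ε m).map Φ.toLinearMap = E0.component ε' m) ∧
      ∀ (m : ℕ) (x : augFiltration ε m) (y : augFiltration ε' m),
        (∀ g, MvPolynomial.IsWeightedHomogeneous Root.height g m →
          M.pair x (M.coord g) = M'.pair y (M'.coord g)) →
        Φ (E0.cls ε m x) = E0.cls ε' m y := by
  have h : ∀ z, M.grPair (M.ofFree z) = M'.grPair (M'.ofFree z) := by
    intro z
    have hz : z ∈ Submodule.span k (Set.range (freeWord k (ι := Fin d))) := by
      rw [span_freeWord]
      trivial
    induction hz using Submodule.span_induction with
    | mem z hz =>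
      obtain ⟨l, rfl⟩ := hz
      refine LinearMap.ext fun g => ?_
      rw [grPair_ofFree_freeWord, grPair_ofFree_freeWord]
    | zero => simp
    | add y z _ _ hy hz => simp only [map_add, hy, hz]
    | smul c y _ hy => simp only [map_smul, hy]
  obtain ⟨Φ, hΦ⟩ := exists_algEquiv_of_ker M.ofFree M'.ofFree M.ofFree_surjective
    M'.ofFree_surjective fun z => by
      rw [← map_eq_zero_iff _ M.grPair_injective, h, map_eq_zero_iff _ M'.grPair_injective]
  refine ⟨Φ, fun m => ?_, fun m x y hxy => ?_⟩
  · rw [M.component_eq_map, M'.component_eq_map, ← Submodule.map_comp]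
    congr 1
    exact LinearMap.ext hΦ
  · obtain ⟨z, hz⟩ := M.ofFree_surjective (E0.cls ε m x)
    refine M'.grPair_injective ?_
    rw [← hz, hΦ, ← h, hz]
    refine LinearMap.ext fun g => ?_
    rw [grPair_cls, grPair_cls]
    exact hxy _ (MvPolynomial.weightedHomogeneousComponent_isWeightedHomogeneous m g)

end Char

end RootModel

end

noncomputable section

/-! ### The group algebra of the unitriangular group -/

theorem rootVar_mem_weightLT {k : Type*} [Field k] {d : ℕ} {a b : Fin (d + 1)} {m : ℤ}
    (h : (b : ℤ) - a < m) : rootVar k a b ∈ weightLT k Root.height m := by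
  rw [weightLT, MvPolynomial.mem_restrictSupport_iff]
  intro u hu
  have h1 := (weight_of_mem_support_rootVar hu).2
  change (Finsupp.weight Root.height u : ℤ) < m
  omega

/-- A monomial divisible by the generator of a root `v` whose weight is at most the height of `v`
is that generator. -/
theorem eq_single_of_weight_le {d : ℕ} {v : Root d} {s : Root d →₀ ℕ}
    (hs : Finsupp.weight Root.height s ≤ v.height) (hv : v ∈ s.support) :
    s = Finsupp.single v 1 := by
  have e : s - Finsupp.single v 1 + Finsupp.single v 1 = s :=
    tsub_add_cancel_of_le (Finsupp.single_le_iff.2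
      (Nat.one_le_iff_ne_zero.2 (Finsupp.mem_support_iff.1 hv)))
  suffices h : s - Finsupp.single v 1 = 0 by rwa [h, zero_add, eq_comm] at e
  rw [← e, map_add, Finsupp.weight_single, one_smul] at hs
  ext u
  by_contra hu
  have h1 := Finsupp.le_weight_of_ne_zero' Root.height hu
  have h2 := u.height_pos
  omega

namespace UGroup

variable {p d : ℕ} [hp : Fact p.Prime]

local notation "𝒰" => unitriangularGroup p (d + 1)

/-- The entries of the inverse matrix, as functions on the unitriangular group. -/
def invEntry (a b : Fin (d + 1)) : 𝒰 → ZMod p := fun h =>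
  (((h⁻¹ : 𝒰) : (Matrix (Fin (d + 1)) (Fin (d + 1)) (ZMod p))ˣ) :
    Matrix (Fin (d + 1)) (Fin (d + 1)) (ZMod p)) a b

theorem invEntry_of_gt {a b : Fin (d + 1)} (h : b < a) : invEntry (p := p) a b = 0 :=
  funext fun g => (g⁻¹ : 𝒰).2.1 a b h

theorem invEntry_self (a : Fin (d + 1)) : invEntry (p := p) a a = 1 :=
  funext fun g => (g⁻¹ : 𝒰).2.2 a

/-- The reason for inverse entries: left translation by `g`, which gives a right action on
functions, becomes an operation on the columns of the generic matrix, as in `rootDer`. -/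
theorem invEntry_mul (g h : 𝒰) (a b : Fin (d + 1)) :
    invEntry a b (g * h) = ∑ c, invEntry a c h * invEntry c b g := by
  rw [invEntry, mul_inv_rev, Subgroup.coe_mul, Units.val_mul, Matrix.mul_apply]
  rfl

variable (p d) in
/-- The coordinate ring of the unitriangular group. -/
def coord : MvPolynomial (Root d) (ZMod p) →ₐ[ZMod p] (𝒰 → ZMod p) :=
  MvPolynomial.aeval fun v => invEntry v.1.1 v.1.2

theorem coord_X (v : Root d) : coord p d (MvPolynomial.X v) = invEntry v.1.1 v.1.2 := by
  rw [coord, MvPolynomial.aeval_X]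

theorem coord_rootVar (a b : Fin (d + 1)) :
    coord p d (rootVar (ZMod p) a b) = invEntry a b := by
  rcases lt_trichotomy a b with h | rfl | h
  · rw [rootVar_of_lt h, coord_X]
  · rw [rootVar_self, map_one, invEntry_self]
  · rw [rootVar_of_gt h, map_zero, invEntry_of_gt h]

theorem coord_apply (g : MvPolynomial (Root d) (ZMod p)) (h : 𝒰) :
    coord p d g h = MvPolynomial.eval (fun v : Root d => invEntry v.1.1 v.1.2 h) g := by
  have : (Pi.evalAlgHom (ZMod p) (fun _ : 𝒰 => ZMod p) h).comp (coord p d)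
      = MvPolynomial.aeval fun v : Root d => invEntry v.1.1 v.1.2 h := by
    refine MvPolynomial.algHom_ext fun v => ?_
    rw [AlgHom.comp_apply, coord_X, MvPolynomial.aeval_X]
    rfl
  have h2 := AlgHom.congr_fun this g
  exact h2

/-- Left translation of functions. -/
def translate (g : 𝒰) : (𝒰 → ZMod p) →ₐ[ZMod p] (𝒰 → ZMod p) :=
  AlgHom.pi (R := ZMod p) fun h => Pi.evalAlgHom (ZMod p) (fun _ : 𝒰 => ZMod p) (g * h)

theorem translate_apply (g h : 𝒰) (f : 𝒰 → ZMod p) : translate g f h = f (g * h) := rfl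

variable (p d) in
/-- The right action of the group algebra on functions. -/
def act : UGroupAlgebra p (d + 1) →ₐ[ZMod p] (Module.End (ZMod p) (𝒰 → ZMod p))ᵐᵒᵖ :=
  MonoidAlgebra.lift (ZMod p) _ _
    { toFun := fun g => MulOpposite.op (translate g).toLinearMap
      map_one' := by
        rw [← MulOpposite.op_one]
        congr 1
        refine LinearMap.ext fun f => funext fun h => ?_
        change f (1 * h) = f h
        rw [one_mul]
      map_mul' := fun g g' => by
        rw [← MulOpposite.op_mul]
        congr 1
        refine LinearMap.ext fun f => funext fun h => ?_
        change f (g * g' * h) = f (g * (g' * h))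
        rw [mul_assoc] }

theorem act_of (g : 𝒰) (f : 𝒰 → ZMod p) :
    (act p d (MonoidAlgebra.of (ZMod p) 𝒰 g)).unop f = translate g f := by
  rw [act, MonoidAlgebra.lift_of]
  rfl

theorem counit_of (g : 𝒰) :
    (UHopf p (d + 1)).counit (MonoidAlgebra.of (ZMod p) 𝒰 g) = 1 := by
  change Coalgebra.counit (R := ZMod p) (MonoidAlgebra.of (ZMod p) 𝒰 g) = 1
  rw [MonoidAlgebra.of_apply, MonoidAlgebra.counit_single]
  rfl

local notation "filt" => weightFiltration (coord p d) Root.height (⊥ : Ideal (𝒰 → ZMod p))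

/-- Translation changes column `b` by multiples of the columns `c < b`, whose entries in the same
row have lower weight. -/
theorem translate_X_sub_mem (g : 𝒰) (v : Root d) :
    translate g (coord p d (MvPolynomial.X v)) - coord p d (MvPolynomial.X v)
      ∈ filt (v.height : ℤ) := by
  obtain ⟨⟨a, b⟩, hab⟩ := v
  replace hab : a < b := hab
  have e : translate g (coord p d (MvPolynomial.X ⟨(a, b), hab⟩))
      - coord p d (MvPolynomial.X ⟨(a, b), hab⟩)
      = ∑ c ∈ Finset.univ.erase b, invEntry c b g • coord p d (rootVar (ZMod p) a c) := by
    funext h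
    rw [Pi.sub_apply, translate_apply, coord_X, invEntry_mul, Finset.sum_apply,
      ← Finset.add_sum_erase _ _ (Finset.mem_univ b), invEntry_self]
    simp only [Pi.one_apply, mul_one, add_sub_cancel_left, coord_rootVar, Pi.smul_apply,
      smul_eq_mul]
    exact Finset.sum_congr rfl fun c _ => mul_comm _ _
  rw [e]
  refine Submodule.sum_mem _ fun c hc => ?_
  rcases lt_or_gt_of_ne (Finset.ne_of_mem_erase hc) with h | h
  · refine Submodule.smul_mem _ _ (map_mem_weightFiltration (rootVar_mem_weightLT ?_))
    have h1 := Fin.lt_def.1 h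
    have h2 := Fin.lt_def.1 hab
    simp only [Root.height]
    omega
  · rw [invEntry_of_gt h, Pi.zero_apply, zero_smul]
    exact zero_mem _

theorem coeffOp_translate (g : 𝒰) (f : 𝒰 → ZMod p) :
    coeffOp ((Polynomial.CAlgHom (R := ZMod p)).comp (translate g)) 0 f = translate g f := by
  simp [coeffOp_apply]

/-- A translation is treated as a total operation with only a constant term, so the general lemmas
apply with `B = 1`. -/
theorem translate_sub_mem (g : 𝒰) {m : ℤ} {f : 𝒰 → ZMod p} (hf : f ∈ filt (m + 1)) :
    translate g f - f ∈ filt m := by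
  have h := coeffOp_sub_mem ((Polynomial.CAlgHom (R := ZMod p)).comp (translate g)) (B := 1)
    (fun r hr v => by
      obtain rfl : r = 0 := by omega
      rw [coeffOp_translate, if_pos rfl]
      exact translate_X_sub_mem g v)
    (fun r hr f hf => by
      rw [Ideal.mem_bot] at hf
      rw [hf, map_zero]
      exact zero_mem _) hf one_pos
  rwa [coeffOp_translate, if_pos rfl] at h

theorem invEntry_elem {i j : Fin (d + 1)} (hij : i < j) (a b : Fin (d + 1)) (h : 𝒰) :
    invEntry a b (elemUnitriangular p hij * h)
      = invEntry a b h - if b = j then invEntry a i h else 0 := by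
  have : invEntry a b (elemUnitriangular p hij * h)
      = ((((h⁻¹ : 𝒰) : (Matrix (Fin (d + 1)) (Fin (d + 1)) (ZMod p))ˣ) :
        Matrix (Fin (d + 1)) (Fin (d + 1)) (ZMod p)) * Matrix.transvection i j (-1) :
          Matrix (Fin (d + 1)) (Fin (d + 1)) (ZMod p)) a b := by
    rw [invEntry, mul_inv_rev, Subgroup.coe_mul, Units.val_mul]
    rfl
  rw [this]
  split_ifs with hb
  · subst hb
    rw [Matrix.mul_transvection_apply_same, neg_one_mul, ← sub_eq_add_neg]
    rfl
  · rw [Matrix.mul_transvection_apply_of_ne _ _ _ _ hb, sub_zero]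
    rfl

theorem fElem_act {i j : Fin (d + 1)} (hij : i < j) (f : 𝒰 → ZMod p) :
    (act p d (fElem p hij)).unop f = f - translate (elemUnitriangular p hij) f := by
  rw [fElem, map_sub, map_one, MulOpposite.unop_sub, LinearMap.sub_apply, act_of]
  rfl

/-- Translation by `E_{i,i+1}` subtracts column `i` from column `i + 1` of the inverse, so its
leading term is minus the derivation. The sign in `1 - E_{i,i+1}` turns this into the derivation
itself. -/
theorem fElem_act_sub_mem (i : Fin d) (m : ℕ) {g : MvPolynomial (Root d) (ZMod p)}
    (hg : MvPolynomial.IsWeightedHomogeneous Root.height g (m + 1)) :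
    (act p d (fElem p (Fin.castSucc_lt_succ (i := i)))).unop (coord p d g)
      - coord p d (rootDer (ZMod p) i.castSucc i.succ g) ∈ filt (m : ℤ) := by
  have hi := Fin.castSucc_lt_succ (i := i)
  have h := coeffOp_sub_derivation_mem (q := coord p d) (w := Root.height) (J := ⊥)
    ((Polynomial.CAlgHom (R := ZMod p)).comp (translate (elemUnitriangular p hi))) (B := 1)
    (fun r hr v => by
      obtain rfl : r = 0 := by omega
      rw [coeffOp_translate, if_pos rfl]
      exact translate_X_sub_mem _ v) one_pos (-rootDer (ZMod p) i.castSucc i.succ)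
    (fun v => by
      rw [coeffOp_translate, if_pos rfl, Derivation.neg_apply, map_neg, sub_neg_eq_add]
      have e : translate (elemUnitriangular p hi) (coord p d (MvPolynomial.X v))
          - coord p d (MvPolynomial.X v)
          + coord p d (rootDer (ZMod p) i.castSucc i.succ (MvPolynomial.X v)) = 0 := by
        funext h
        rw [Pi.add_apply, Pi.sub_apply, translate_apply, coord_X, invEntry_elem, rootDer_X]
        split_ifs
        · rw [coord_rootVar]
          simp
        · simp
      rw [e]
      exact zero_mem _) hg
  rw [coeffOp_translate, if_pos rfl, Derivation.neg_apply, map_neg, sub_neg_eq_add] at h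
  rw [fElem_act, ← neg_mem_iff]
  convert h using 1
  ring

/-- Entries embed the group in a finite affine space over `F_p`, where every function is polynomial.
-/
theorem exists_coord (f : 𝒰 → ZMod p) : ∃ g, coord p d g = f := by
  let entries : 𝒰 → Root d → ZMod p := fun h v => invEntry v.1.1 v.1.2 h
  have hinj : Function.Injective entries := by
    intro g h hgh
    rw [← inv_inj]
    refine Subtype.ext (Units.ext (Matrix.ext fun a b => ?_))
    change invEntry a b g = invEntry a b h
    rcases lt_trichotomy a b with hab | rfl | hab
    · exact congrFun hgh ⟨(a, b), hab⟩
    · rw [invEntry_self]; rfl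
    · rw [invEntry_of_gt hab]; rfl
  have h1 := MvPolynomial.map_restrict_dom_evalₗ (ZMod p) (Root d)
  obtain ⟨g, -, hg⟩ : Function.extend entries f 0 ∈
      (MvPolynomial.restrictDegree (Root d) (ZMod p) (Fintype.card (ZMod p) - 1)).map
        (MvPolynomial.evalₗ (ZMod p) (Root d)) := by
    rw [h1]
    trivial
  refine ⟨g, funext fun h => ?_⟩
  rw [coord_apply, ← hinj.extend_apply f 0 h, ← hg]
  rfl

theorem counit_fElem {i j : Fin (d + 1)} (hij : i < j) :
    (UHopf p (d + 1)).counit (fElem p hij) = 0 := by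
  rw [fElem, map_sub, map_one, counit_of, sub_self]

variable (p d) in
/-- The pairing of the group algebra of the unitriangular group with functions. -/
def model : RootModel (UHopf p (d + 1)).counit d p (𝒰 → ZMod p) where
  act := act p d
  ev := Pi.evalAlgHom (ZMod p) (fun _ : 𝒰 => ZMod p) 1
  coord := coord p d
  ideal := ⊥
  gen i := fElem p (Fin.castSucc_lt_succ (i := i))
  ev_ideal f hf := by
    rw [Ideal.mem_bot] at hf
    rw [hf, map_zero]
  act_sub_mem x m f hf := by
    induction x using MonoidAlgebra.induction_on with
    | of g => rw [act_of, counit_of, one_smul]; exact translate_sub_mem g hf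
    | add x y hx hy =>
      rw [map_add, map_add, MulOpposite.unop_add, LinearMap.add_apply, add_smul, add_sub_add_comm]
      exact add_mem hx hy
    | smul c x hx =>
      rw [map_smul, map_smul, MulOpposite.unop_smul, LinearMap.smul_apply, smul_assoc, ← smul_sub]
      exact Submodule.smul_mem _ _ hx
  counit_gen i := counit_fElem _
  act_gen_sub_mem i m g hg := fElem_act_sub_mem i m hg
  coord_pow_mem v := by
    -- Functions with values in `F_p` are fixed by Frobenius, and the height of `v` is less than `p`
    -- times itself.
    have : coord p d (MvPolynomial.X v) ^ p = coord p d (MvPolynomial.X v) := by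
      funext h
      exact ZMod.pow_card _
    rw [this]
    refine map_X_mem ?_
    have h1 := v.height_pos
    have h2 := hp.out.two_le
    exact_mod_cast (by nlinarith : v.height < p * v.height)
  exists_coord f := by
    obtain ⟨g, rfl⟩ := exists_coord f
    exact ⟨g, by rw [sub_self]; exact zero_mem _⟩
  eq_zero x hx := by
    classical
    refine MonoidAlgebra.ext (Finsupp.ext fun g => ?_)
    -- Pairing with the indicator function of `g` reads off the coefficient of `g`.
    refine Eq.trans ?_ (hx (Pi.single g 1))
    clear hx
    induction x using MonoidAlgebra.induction_on with
    | of g' =>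
      rw [act_of, Pi.evalAlgHom_apply, translate_apply, mul_one, MonoidAlgebra.of_apply,
        MonoidAlgebra.coeff_single, Finsupp.single_apply, Pi.single_apply]
    | add x y hx hy =>
      rw [map_add, MulOpposite.unop_add, LinearMap.add_apply, map_add, ← hx, ← hy]
      rfl
    | smul c x hx =>
      rw [map_smul, MulOpposite.unop_smul, LinearMap.smul_apply, map_smul, ← hx]
      rfl

/-- The pairing with `f` is `f 1 - f E_{i,j}`. All coordinates vanish at `1`, and at `E_{i,j}` only
coordinate `(i, j)` survives, with value `-1`; the weight bound excludes its higher powers. -/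
theorem isRootVector_fElem {i j : Fin (d + 1)} (hij : i < j) :
    (model p d).IsRootVector ⟨(i, j), hij⟩ (fElem p hij) := by
  intro s hs
  change (model p d).pair (fElem p hij) (coord p d (MvPolynomial.monomial s 1)) = _
  have e : (model p d).pair (fElem p hij) (coord p d (MvPolynomial.monomial s 1))
      = coord p d (MvPolynomial.monomial s 1) 1
        - coord p d (MvPolynomial.monomial s 1) (elemUnitriangular p hij) := by
    rw [RootModel.pair_apply]
    change Pi.evalAlgHom (ZMod p) (fun _ : 𝒰 => ZMod p) 1
      ((act p d (fElem p hij)).unop _) = _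
    rw [fElem_act, Pi.evalAlgHom_apply, Pi.sub_apply, translate_apply, mul_one]
  have h1 : ∀ v : Root d, invEntry (p := p) v.1.1 v.1.2 1 = 0 := fun v => by
    rw [invEntry, inv_one]
    exact Matrix.one_apply_ne v.2.ne
  have h2 : ∀ v : Root d, invEntry (p := p) v.1.1 v.1.2 (elemUnitriangular p hij)
      = if v = ⟨(i, j), hij⟩ then -1 else 0 := by
    intro v
    have h3 := invEntry_elem hij v.1.1 v.1.2 (1 : 𝒰)
    rw [mul_one, h1 v, zero_sub] at h3
    rw [h3]
    split_ifs with h4 h5 h5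
    · rw [h5, invEntry_self]
      rfl
    · have h6 : v.1.1 ≠ i := fun h => h5 (Subtype.ext (Prod.ext h h4))
      rw [invEntry, inv_one]
      exact neg_eq_zero.2 (Matrix.one_apply_ne h6)
    · exact absurd (by rw [h5]) h4
    · exact neg_zero
  rw [e, coord_apply, coord_apply, MvPolynomial.eval_monomial, MvPolynomial.eval_monomial,
    one_mul, one_mul]
  simp only [h1, h2]
  by_cases h0 : s = 0
  · subst h0
    rw [if_neg fun h => one_ne_zero (α := ℕ) (by
      simpa using (DFunLike.congr_fun h ⟨(i, j), hij⟩).symm), Finsupp.prod_zero_index, Finsupp.prod_zero_index, sub_self]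
  have h3 : (s.prod fun _ e => (0 : ZMod p) ^ e) = 0 := by
    obtain ⟨v, hv⟩ := Finsupp.support_nonempty_iff.2 h0
    exact Finset.prod_eq_zero hv (zero_pow (Finsupp.mem_support_iff.1 hv))
  rw [h3, zero_sub]
  split_ifs with h4
  · subst h4
    rw [Finsupp.prod_single_index (by exact pow_zero _), if_pos rfl, pow_one, neg_neg]
  · rw [neg_eq_zero]
    obtain ⟨u, hu⟩ := Finsupp.support_nonempty_iff.2 h0
    have hu' : u ≠ ⟨(i, j), hij⟩ := by
      rintro rfl
      exact h4 (eq_single_of_weight_le hs hu)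
    refine Finset.prod_eq_zero hu ?_
    change (if u = _ then (-1 : ZMod p) else 0) ^ s u = 0
    rw [if_neg hu', zero_pow (Finsupp.mem_support_iff.1 hu)]

end UGroup

end

noncomputable section

/-! ### Subalgebras of the algebra of Steenrod powers -/

/-- The elements of an algebra which act on a filtration as their augmentation modulo the next
smaller step. -/
def loweringSubalgebra {k A O : Type*} [Field k] [Ring A] [Algebra k A] [CommRing O] [Algebra k O]
    (ε : A →ₐ[k] k) (act : A →ₐ[k] (Module.End k O)ᵐᵒᵖ) (G : ℤ → Submodule k O)
    (hG : ∀ m, G m ≤ G (m + 1)) : Subalgebra k A where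
  carrier := {x | ∀ m, ∀ f ∈ G (m + 1), (act x).unop f - ε x • f ∈ G m}
  mul_mem' {x y} hx hy m f hf := by
    have h1 : (act x).unop f ∈ G (m + 1) := by
      rw [← sub_add_cancel ((act x).unop f) (ε x • f)]
      exact add_mem (hG m (hx m f hf)) (Submodule.smul_mem _ _ hf)
    have h2 := add_mem (hy m _ h1) (Submodule.smul_mem _ (ε y) (hx m f hf))
    convert h2 using 1
    rw [map_mul, map_mul, MulOpposite.unop_mul, Module.End.mul_apply, smul_sub, smul_smul,
      mul_comm (ε y), sub_add_sub_cancel]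
  add_mem' {x y} hx hy m f hf := by
    rw [map_add, map_add, MulOpposite.unop_add, LinearMap.add_apply, add_smul, add_sub_add_comm]
    exact add_mem (hx m f hf) (hy m f hf)
  algebraMap_mem' c m f hf := by
    rw [AlgHom.commutes, AlgHom.commutes]
    have : (algebraMap k (Module.End k O)ᵐᵒᵖ c).unop f - algebraMap k k c • f = 0 := by
      rw [MulOpposite.algebraMap_apply, MulOpposite.unop_op, Module.algebraMap_end_apply]
      exact sub_self _
    rw [this]
    exact zero_mem _

namespace SteenrodPowers

variable {p : ℕ} [hp : Fact p.Prime]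

local notation "𝓢" => MvPolynomial ℕ (ZMod p)

variable (p) in
/-- The power `ξ_{b - a} ^ {p ^ a}` of a generator of the dual. -/
def dualEntry (a b : ℕ) : 𝓢 := if a ≤ b then milnorXi p (b - a) ^ p ^ a else 0

theorem dualEntry_of_lt {a b : ℕ} (h : b < a) : dualEntry p a b = 0 := if_neg (not_le.2 h)

theorem dualEntry_self (a : ℕ) : dualEntry p a a = 1 := by
  rw [dualEntry, if_pos le_rfl, Nat.sub_self, milnorXi, one_pow]

theorem dualHom_xi_pow (t c : ℕ) : dualHom p (milnorXi p (t + 1) ^ p ^ c)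
    = Polynomial.C (milnorXi p (t + 1) ^ p ^ c)
      + Polynomial.X ^ p ^ (t + c) * Polynomial.C (milnorXi p t ^ p ^ c) := by
  have hfr : ∀ x y : Polynomial 𝓢, (x + y) ^ p ^ c = x ^ p ^ c + y ^ p ^ c :=
    fun x y => add_pow_char_pow x y p c
  rw [map_pow, dualHom_xi_succ, hfr, mul_pow, ← pow_mul, ← pow_add, Polynomial.C_pow,
    Polynomial.C_pow]

/-- Apart from the identity in degree zero, column `b` is affected only by `P ^ (p ^ (b - 1))`,
which moves it to column `b - 1`. This is the simple root derivation, here without error term on the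
coordinates. -/
theorem coeffOp_dualEntry {a b : ℕ} (h : a < b) (r : ℕ) :
    coeffOp (dualHom p) r (dualEntry p a b) - (if r = 0 then dualEntry p a b else 0)
      = if r = p ^ (b - 1) then dualEntry p a (b - 1) else 0 := by
  obtain ⟨t, rfl⟩ := Nat.exists_eq_add_of_lt h
  have e1 : a + t + 1 - a = t + 1 := by omega
  have e2 : a + t + 1 - 1 - a = t := by omega
  have e3 : a + t + 1 - 1 = t + a := by omega
  have hA : dualEntry p a (a + t + 1) = milnorXi p (t + 1) ^ p ^ a := by
    rw [dualEntry, if_pos h.le, e1]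
  have hB : dualEntry p a (a + t + 1 - 1) = milnorXi p t ^ p ^ a := by
    rw [dualEntry, if_pos (by omega), e2]
  rw [hA, hB, e3, coeffOp_apply, dualHom_xi_pow, Polynomial.coeff_add, Polynomial.coeff_C,
    Polynomial.coeff_mul_C, Polynomial.coeff_X_pow, add_sub_cancel_left]
  split_ifs
  · rw [one_mul]
  · rw [zero_mul]

/-! #### The filtration on the whole dual -/

variable (p) in
/-- The coordinates for the infinite unitriangular group. -/
def dualCoord : MvPolynomial {v : ℕ × ℕ // v.1 < v.2} (ZMod p) →ₐ[ZMod p] 𝓢 :=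
  MvPolynomial.aeval fun v => dualEntry p v.1.1 v.1.2

variable (p) in
/-- The weight filtration of the dual. -/
def dualFilt (m : ℤ) : Submodule (ZMod p) 𝓢 :=
  weightFiltration (dualCoord p) (fun v => v.1.2 - v.1.1) ⊥ m

theorem dualEntry_mem_dualFilt {a b : ℕ} {m : ℤ} (h : (b : ℤ) - a < m) :
    dualEntry p a b ∈ dualFilt p m := by
  rcases lt_trichotomy a b with hab | rfl | hab
  · have : dualCoord p (MvPolynomial.X ⟨(a, b), hab⟩) = dualEntry p a b := by
      rw [dualCoord, MvPolynomial.aeval_X]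
    rw [← this]
    refine map_X_mem ?_
    change ((b - a : ℕ) : ℤ) < m
    omega
  · rw [dualEntry_self, ← map_one (dualCoord p)]
    exact map_monomial_mem (by rw [map_zero]; push_cast; omega) 1
  · rw [dualEntry_of_lt hab]
    exact zero_mem _

theorem act_sub_mem_dualFilt (x : SteenrodPowers p) (m : ℤ) (f : 𝓢)
    (hf : f ∈ dualFilt p (m + 1)) :
    (dualAction p x).unop f - counit p x • f ∈ dualFilt p m := by
  let L := loweringSubalgebra (counit p) (dualAction p) (dualFilt p)
    fun m => weightFiltration_mono (by omega)
  suffices h : x ∈ L from h m f hf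
  have hP : ∀ r, steenrodP p r ∈ L := by
    intro r m f hf
    have h := coeffOp_sub_mem (dualHom p) (B := r + 1) (fun r _ v => by
      rw [dualCoord, MvPolynomial.aeval_X, coeffOp_dualEntry v.2]
      split_ifs
      · have := v.2
        exact dualEntry_mem_dualFilt (by omega)
      · exact zero_mem _) (fun r _ f hf => by
        rw [Ideal.mem_bot] at hf
        rw [hf, map_zero]
        exact zero_mem _) hf (Nat.lt_succ_self r)
    have e : (if r = 0 then (1 : ZMod p) else 0) • f = if r = 0 then f else 0 := by
      split_ifs
      · rw [one_smul]
      · rw [zero_smul]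
    rw [dualAction_steenrodP, counit_steenrodP, e]
    exact h
  induction x using word_induction with
  | h0 => exact zero_mem L
  | hw l =>
    refine list_prod_mem fun y hy => ?_
    obtain ⟨r, -, rfl⟩ := List.mem_map.1 hy
    exact hP r
  | hadd x y hx hy => exact add_mem hx hy
  | hsmul c x hx => exact L.smul_mem hx c

theorem pair_eq_zero_of_mem_dualFilt {m : ℕ} {x : SteenrodPowers p}
    (hx : x ∈ augFiltration (counit p) m) {f : 𝓢} (hf : f ∈ dualFilt p m) : pair p x f = 0 := by
  induction m generalizing x f with
  | zero =>
    have h := weightFiltration_of_nonpos (by norm_num) hf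
    rw [Ideal.mem_bot] at h
    rw [h, map_zero]
  | succ m ih =>
    induction hx using E0.aug_succ_induction with
    | hmul a b ha hb =>
      rw [pair_mul]
      have h := act_sub_mem_dualFilt a m f (by exact_mod_cast hf)
      rw [E0.counit_eq_zero one_pos ha, zero_smul, sub_zero] at h
      exact ih hb h
    | hadd x y _ _ hx hy => rw [map_add, LinearMap.add_apply, hx, hy, add_zero]

/-! #### The model of a subalgebra -/

variable (p) in
/-- The ideal of the dual which pairs to zero with the subalgebra generated by the `P ^ (p ^ i)`,
`i < d`. -/
def dualIdeal (d : ℕ) : Ideal 𝓢 :=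
  -- For `t ≥ d` the truncated subtraction gives exponent `p ^ 0 = 1`, so `ξ_{t+1}` itself is
  -- killed.
  Ideal.span (Set.range fun t => milnorXi p (t + 1) ^ p ^ (d - t))

/-- The total operation changes the generator `ξ_{t+1} ^ (p ^ (d - t))` only in degree `p ^ (t + (d
- t))`, which is at least `p ^ d`. -/
theorem coeffOp_mem_dualIdeal {d r : ℕ} (hr : r < p ^ d) {f : 𝓢} (hf : f ∈ dualIdeal p d) :
    coeffOp (dualHom p) r f ∈ dualIdeal p d := by
  induction hf using Submodule.span_induction generalizing r with
  | mem f hf =>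
    obtain ⟨t, rfl⟩ := hf
    have h1 : r ≠ p ^ (t + (d - t)) := by
      have := Nat.pow_le_pow_right hp.out.pos (show d ≤ t + (d - t) by omega)
      omega
    rw [coeffOp_apply]
    simp only [dualHom_xi_pow]
    rw [Polynomial.coeff_add, Polynomial.coeff_mul_C, Polynomial.coeff_X_pow, if_neg h1, zero_mul,
      add_zero, Polynomial.coeff_C]
    split_ifs
    · exact Ideal.subset_span ⟨t, rfl⟩
    · exact zero_mem _
  | zero => rw [map_zero]; exact zero_mem _
  | add f g _ _ hf hg => rw [map_add]; exact add_mem (hf hr) (hg hr)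
  | smul h f _ hf =>
    rw [smul_eq_mul, coeffOp_mul]
    refine Ideal.sum_mem _ fun ij hij => Ideal.mul_mem_left _ _ (hf ?_)
    rw [Finset.HasAntidiagonal.mem_antidiagonal] at hij
    omega

theorem aeval_zero_of_mem_dualIdeal {d : ℕ} {f : 𝓢} (hf : f ∈ dualIdeal p d) :
    MvPolynomial.aeval (fun _ : ℕ => (0 : ZMod p)) f = 0 := by
  induction hf using Submodule.span_induction with
  | mem f hf =>
    obtain ⟨t, rfl⟩ := hf
    simp only [milnorXi, map_pow, MvPolynomial.aeval_X]
    exact zero_pow (pow_ne_zero _ hp.out.ne_zero)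
  | zero => rw [map_zero]
  | add f g _ _ hf hg => rw [map_add, hf, hg, add_zero]
  | smul h f _ hf => rw [smul_eq_mul, map_mul, hf, mul_zero]

variable (p) in
/-- The coordinates for the dual of a subalgebra. -/
def subCoord (d : ℕ) : MvPolynomial (Root d) (ZMod p) →ₐ[ZMod p] 𝓢 :=
  MvPolynomial.aeval fun v => dualEntry p v.1.1 v.1.2

theorem subCoord_X {d : ℕ} (v : Root d) :
    subCoord p d (MvPolynomial.X v) = dualEntry p v.1.1 v.1.2 := by
  rw [subCoord, MvPolynomial.aeval_X]

theorem subCoord_rootVar {d : ℕ} (a b : Fin (d + 1)) :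
    subCoord p d (rootVar (ZMod p) a b) = dualEntry p a b := by
  rcases lt_trichotomy a b with h | rfl | h
  · rw [rootVar_of_lt h, subCoord_X]
  · rw [rootVar_self, map_one, dualEntry_self]
  · rw [rootVar_of_gt h, map_zero, dualEntry_of_lt (Fin.lt_def.1 h)]

theorem coeffOp_subCoord_mem {d : ℕ} (r : ℕ) (v : Root d) :
    coeffOp (dualHom p) r (subCoord p d (MvPolynomial.X v))
      - (if r = 0 then subCoord p d (MvPolynomial.X v) else 0)
      ∈ weightFiltration (subCoord p d) Root.height (dualIdeal p d) v.height := by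
  obtain ⟨⟨a, b⟩, hab⟩ := v
  replace hab : (a : ℕ) < b := hab
  rw [subCoord_X, coeffOp_dualEntry hab]
  split_ifs
  · obtain ⟨c, hc⟩ : ∃ c : Fin (d + 1), (c : ℕ) = b - 1 := ⟨⟨b - 1, by omega⟩, rfl⟩
    rw [← hc, ← subCoord_rootVar]
    refine map_mem_weightFiltration (rootVar_mem_weightLT ?_)
    simp only [Root.height]
    omega
  · exact zero_mem _

theorem steenrodP_mem_steenrodSub {e i : ℕ} (h : i ≤ e) : steenrodP p (p ^ i) ∈ steenrodSub p e :=
  Algebra.subset_adjoin ⟨i, h, rfl⟩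

/-- The pairing of the subalgebra generated by the `P ^ (p ^ i)`, `i ≤ e`, with the dual. -/
def subModel {e : ℕ} (ε : steenrodSub p e →ₐ[ZMod p] ZMod p)
    (hε : ∀ x : steenrodSub p e, ε x = counit p (x : SteenrodPowers p)) :
    RootModel ε (e + 1) p 𝓢 where
  act := (dualAction p).comp (steenrodSub p e).val
  ev := MvPolynomial.aeval fun _ : ℕ => (0 : ZMod p)
  coord := subCoord p (e + 1)
  ideal := dualIdeal p (e + 1)
  gen i := ⟨steenrodP p (p ^ (i : ℕ)), steenrodP_mem_steenrodSub (Nat.lt_succ_iff.1 i.2)⟩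
  ev_ideal f hf := aeval_zero_of_mem_dualIdeal hf
  act_sub_mem x m f hf := by
    let L := loweringSubalgebra (counit p) (dualAction p)
      (weightFiltration (subCoord p (e + 1)) Root.height (dualIdeal p (e + 1)))
      fun m => weightFiltration_mono (by omega)
    -- Elements acting as their augmentation modulo lower filtration form a subalgebra, so the
    -- generators suffice.
    have h : steenrodSub p e ≤ L := by
      refine Algebra.adjoin_le ?_
      rintro _ ⟨i, hi, rfl⟩ m f hf
      have h := coeffOp_sub_mem (dualHom p) (B := p ^ (e + 1)) (fun r _ v =>
        coeffOp_subCoord_mem r v) (fun r hr f hf => coeffOp_mem_dualIdeal hr hf) hf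
        (Nat.pow_lt_pow_right hp.out.one_lt (Nat.lt_succ_of_le hi))
      rw [if_neg (pow_ne_zero _ hp.out.ne_zero)] at h
      rw [dualAction_steenrodP, counit_steenrodP, if_neg (pow_ne_zero _ hp.out.ne_zero), zero_smul]
      exact h
    rw [hε]
    exact h x.2 m f hf
  counit_gen i := by
    rw [hε, counit_steenrodP, if_neg (pow_ne_zero _ hp.out.ne_zero)]
  act_gen_sub_mem i m g hg := by
    have h0 : p ^ (i : ℕ) ≠ 0 := pow_ne_zero _ hp.out.ne_zero
    have h := coeffOp_sub_derivation_mem (q := subCoord p (e + 1)) (w := Root.height)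
      (J := dualIdeal p (e + 1)) (dualHom p) (B := p ^ (e + 1)) (fun r _ v =>
        coeffOp_subCoord_mem r v) (r := p ^ (i : ℕ)) (Nat.pow_lt_pow_right hp.out.one_lt i.2)
      (rootDer (ZMod p) i.castSucc i.succ) (fun v => by
        rw [rootDer_X, subCoord_X, coeffOp_dualEntry (Fin.lt_def.1 v.2)]
        have h1 := Fin.lt_def.1 v.2
        by_cases h2 : v.1.2 = i.succ
        · have h3 : (v.1.2 : ℕ) - 1 = i := by rw [h2]; simp
          rw [if_pos h2, h3, if_pos rfl, subCoord_rootVar, Fin.val_castSucc, sub_self]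
          exact zero_mem _
        · rw [if_neg h2, if_neg, map_zero, sub_self]
          · exact zero_mem _
          · intro h3
            have h4 := Nat.pow_right_injective hp.out.two_le h3
            refine h2 (Fin.ext ?_)
            rw [Fin.val_succ]
            omega) hg
    rw [if_neg h0, sub_zero, ← dualAction_steenrodP] at h
    exact h
  coord_pow_mem v := by
    obtain ⟨⟨a, b⟩, hab⟩ := v
    replace hab : (a : ℕ) < b := hab
    rw [subCoord_X, dualEntry, if_pos hab.le, ← pow_mul, ← pow_succ]
    simp only
    rcases Nat.lt_or_ge b (e + 1) with hb | hb
    · have e1 : milnorXi p ((b : ℕ) - a) ^ p ^ ((a : ℕ) + 1)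
          = subCoord p (e + 1) (rootVar (ZMod p) ⟨a + 1, by omega⟩ ⟨b + 1, by omega⟩) := by
        rw [subCoord_rootVar, dualEntry, if_pos (by simp only; omega)]
        simp only [Nat.add_sub_add_right]
      rw [e1]
      refine map_mem_weightFiltration (rootVar_mem_weightLT ?_)
      have h2 := hp.out.two_le
      have h3 : ((b : ℕ) - a) < p * ((b : ℕ) - a) := by
        have : 0 < (b : ℕ) - a := by omega
        nlinarith
      simp only [Root.height]
      omega
    -- In the last column the step leaves the matrix, and the `p`th power is a generator of the
    -- ideal.
    · refine mem_weightFiltration_of_mem_ideal (Ideal.subset_span ⟨(b : ℕ) - a - 1, ?_⟩)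
      have := b.2
      have e1 : (b : ℕ) - a - 1 + 1 = b - a := by omega
      have e2 : e + 1 - ((b : ℕ) - a - 1) = a + 1 := by omega
      simp only [e1, e2]
  exists_coord f := by
    induction f using MvPolynomial.induction_on with
    | C c =>
      refine ⟨MvPolynomial.C c, ?_⟩
      have : subCoord p (e + 1) (MvPolynomial.C c) = MvPolynomial.C c := AlgHom.commutes _ c
      rw [this, sub_self]
      exact zero_mem _
    | add f g hf hg =>
      obtain ⟨f', hf⟩ := hf
      obtain ⟨g', hg⟩ := hg
      refine ⟨f' + g', ?_⟩
      rw [map_add, add_sub_add_comm]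
      exact add_mem hf hg
    | mul_X f i hf =>
      obtain ⟨f', hf⟩ := hf
      have : ∃ g, MvPolynomial.X i - subCoord p (e + 1) g ∈ dualIdeal p (e + 1) := by
        by_cases hi : i < e + 1
        · refine ⟨rootVar (ZMod p) 0 ⟨i + 1, by omega⟩, ?_⟩
          rw [subCoord_rootVar, dualEntry, if_pos (by simp)]
          simp only [Fin.coe_ofNat_eq_mod, Nat.zero_mod, Nat.sub_zero, pow_zero, pow_one, milnorXi,
            sub_self]
          exact zero_mem _
        · refine ⟨0, ?_⟩
          rw [map_zero, sub_zero]
          refine Ideal.subset_span ⟨i, ?_⟩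
          have e1 : e + 1 - i = 0 := by omega
          simp only [e1, pow_zero, pow_one, milnorXi]
      obtain ⟨g, hg⟩ := this
      refine ⟨f' * g, ?_⟩
      have e1 : f * MvPolynomial.X i - subCoord p (e + 1) (f' * g)
          = MvPolynomial.X i * (f - subCoord p (e + 1) f')
            + subCoord p (e + 1) f' * (MvPolynomial.X i - subCoord p (e + 1) g) := by
        rw [map_mul]
        ring
      rw [e1]
      exact add_mem (Ideal.mul_mem_left _ _ hf) (Ideal.mul_mem_left _ _ hg)
  eq_zero x hx := Subtype.ext (eq_zero_of_pair fun f => hx f)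

end SteenrodPowers

end

noncomputable section

namespace SteenrodPowers

variable {p : ℕ} [hp : Fact p.Prime]

local notation "𝓢" => MvPolynomial ℕ (ZMod p)

/-! #### The Hopf subalgebra -/

variable {e : ℕ} {ε : steenrodSub p e →ₐ[ZMod p] ZMod p}
  (hε : ∀ x : steenrodSub p e, ε x = counit p (x : SteenrodPowers p))

theorem subModel_pair (x : steenrodSub p e) (f : 𝓢) :
    (subModel ε hε).pair x f = pair p (x : SteenrodPowers p) f := rfl

/-- Such a power pairs to zero with the ideal, so by perfect duality some element of the subalgebra
has the same pairing, and the pairing separates elements. This gives closure under the coproduct. -/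
theorem steenrodP_mem_steenrodSub_of_lt {r : ℕ} (hr : r < p ^ (e + 1)) :
    steenrodP p r ∈ steenrodSub p e := by
  obtain ⟨x, hx⟩ := (subModel (e := e) ((counit p).comp (steenrodSub p e).val)
    fun _ => rfl).exists_pair_eq_right (pair p (steenrodP p r)) (fun f hf => by
      rw [pair_apply, dualAction_steenrodP]
      exact aeval_zero_of_mem_dualIdeal (coeffOp_mem_dualIdeal hr hf))
  suffices h : (x : SteenrodPowers p) - steenrodP p r = 0 by
    rw [← sub_eq_zero.1 h]
    exact x.2
  refine eq_zero_of_pair fun f => ?_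
  rw [map_sub, LinearMap.sub_apply, sub_eq_zero]
  exact hx f

theorem comul_mem_range {x : SteenrodPowers p} (hx : x ∈ steenrodSub p e) :
    comul p x ∈ (Algebra.TensorProduct.map (steenrodSub p e).val (steenrodSub p e).val).range := by
  suffices h : steenrodSub p e ≤
      (Algebra.TensorProduct.map (steenrodSub p e).val (steenrodSub p e).val).range.comap
        (comul p) from h hx
  refine Algebra.adjoin_le ?_
  rintro _ ⟨i, hi, rfl⟩
  rw [SetLike.mem_coe, Subalgebra.mem_comap, comul_steenrodP]
  refine Subalgebra.sum_mem _ fun ab hab => ?_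
  rw [Finset.HasAntidiagonal.mem_antidiagonal] at hab
  have h : p ^ i < p ^ (e + 1) :=
    Nat.pow_lt_pow_right hp.out.one_lt (Nat.lt_succ_of_le hi)
  exact ⟨⟨_, steenrodP_mem_steenrodSub_of_lt (e := e) (r := ab.1) (by omega)⟩ ⊗ₜ
    ⟨_, steenrodP_mem_steenrodSub_of_lt (e := e) (r := ab.2) (by omega)⟩, rfl⟩

/-- The antipode axiom expresses the antipode of `P ^ r` recursively through those of smaller
powers. -/
theorem antipode_steenrodP_mem {r : ℕ} (hr : r < p ^ (e + 1)) :
    (hopf p).antipode (steenrodP p r) ∈ steenrodSub p e := by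
  induction r using Nat.strong_induction_on with
  | _ r ih =>
    have h := LinearMap.congr_fun (hopf p).antipode_left (steenrodP p r)
    simp only [LinearMap.comp_apply, AlgHom.toLinearMap_apply, hopf_comul, hopf_counit,
      comul_steenrodP, map_sum, LinearMap.rTensor_tmul, LinearMap.mul'_apply,
      Algebra.linearMap_apply] at h
    have hm : (r, 0) ∈ Finset.HasAntidiagonal.antidiagonal r :=
      Finset.HasAntidiagonal.mem_antidiagonal.2 (add_zero r)
    rw [← Finset.add_sum_erase _ _ hm, steenrodP_zero, mul_one] at h
    rw [eq_sub_of_add_eq h]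
    refine sub_mem (Subalgebra.algebraMap_mem _ _) (Subalgebra.sum_mem _ fun ab hab => ?_)
    rw [Finset.mem_erase, Finset.HasAntidiagonal.mem_antidiagonal] at hab
    have hlt : ab.1 < r := by
      rcases Nat.eq_zero_or_pos ab.2 with h0 | h0
      · exact absurd (Prod.ext (by simp only; omega) h0) hab.1
      · omega
    exact mul_mem (ih _ hlt (by omega)) (steenrodP_mem_steenrodSub_of_lt (by omega))

theorem antipode_mem_steenrodSub {x : SteenrodPowers p} (hx : x ∈ steenrodSub p e) :
    (hopf p).antipode x ∈ steenrodSub p e := by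
  induction hx using Algebra.adjoin_induction with
  | mem x hx =>
    obtain ⟨i, hi, rfl⟩ := hx
    exact antipode_steenrodP_mem (Nat.pow_lt_pow_right hp.out.one_lt (Nat.lt_succ_of_le hi))
  | algebraMap c =>
    rw [Algebra.algebraMap_eq_smul_one, map_smul]
    refine Subalgebra.smul_mem _ ?_ c
    rw [← steenrodP_zero]
    exact antipode_steenrodP_mem (pow_pos hp.out.pos _)
  | add x y _ _ hx hy => rw [map_add]; exact add_mem hx hy
  | mul x y _ _ hx hy => rw [HopfStructure.antipode_mul]; exact mul_mem hy hx

theorem exists_hopfStructure_steenrodSub (p e : ℕ) [Fact p.Prime] :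
    ∃ K : HopfStructure (ZMod p) (steenrodSub p e), K.IsHom (hopf p) (steenrodSub p e).val :=
  (hopf p).exists_restrict (steenrodSub p e) (fun _ hx => by
    rw [hopf_comul]
    exact comul_mem_range hx) fun _ hx => antipode_mem_steenrodSub hx

/-! #### The two filtrations of the subalgebra -/

theorem subCoord_monomial_mem_dualFilt {d : ℕ} (s : Root d →₀ ℕ) :
    subCoord p d (MvPolynomial.monomial s 1)
      ∈ dualFilt p ((Finsupp.weight Root.height s : ℕ) + 1) := by
  classical
  induction s using Finsupp.induction_linear with
  | zero =>
    rw [MvPolynomial.monomial_zero', map_one, map_one, ← dualEntry_self (p := p) 0]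
    exact dualEntry_mem_dualFilt (by simp)
  | add s t hs ht =>
    rw [← one_mul (1 : ZMod p), ← MvPolynomial.monomial_mul, map_mul]
    refine weightFiltration_mul hs ht ?_
    rw [map_add]
    push_cast
    omega
  | single v n =>
    induction n with
    | zero =>
      rw [Finsupp.single_zero, MvPolynomial.monomial_zero', map_one, map_one,
        ← dualEntry_self (p := p) 0]
      exact dualEntry_mem_dualFilt (by simp)
    | succ n ih =>
      rw [Finsupp.single_add, ← one_mul (1 : ZMod p), ← MvPolynomial.monomial_mul, map_mul]
      have h : subCoord p d (MvPolynomial.monomial (Finsupp.single v 1) 1)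
          ∈ dualFilt p (v.height + 1) := by
        change subCoord p d (MvPolynomial.X v) ∈ _
        rw [subCoord_X]
        have := Fin.lt_def.1 v.2
        refine dualEntry_mem_dualFilt ?_
        simp only [Root.height]
        omega
      refine weightFiltration_mul ih h ?_
      rw [map_add, Finsupp.weight_single, Finsupp.weight_single, one_smul]
      push_cast
      omega

/-- For the converse, an element in the `m`th power of the large augmentation ideal annihilates step
`m` of `dualFilt`. That step contains the monomials spanning step `m` of the model modulo its ideal,
and duality in the subalgebra finishes the argument. -/
theorem mem_augFiltration_steenrodSub_iff
    (hε : ∀ x : steenrodSub p e, ε x = counit p (x : SteenrodPowers p)) (m : ℕ) (x : steenrodSub p e) :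
    x ∈ augFiltration ε m ↔ (x : SteenrodPowers p) ∈ augFiltration (counit p) m := by
  constructor
  · intro hx
    induction m generalizing x with
    | zero => exact augFiltration_zero_eq_top _ _
    | succ m ih =>
      induction hx using E0.aug_succ_induction with
      | hmul a b ha hb =>
        rw [Subalgebra.coe_mul, add_comm]
        refine augFiltration_mul_mem (E0.mem_aug_one ?_) (ih b hb)
        rw [← hε]
        exact E0.counit_eq_zero one_pos ha
      | hadd x y _ _ hx hy => exact add_mem hx hy
  · intro hx
    refine (subModel ε hε).mem_augFiltration_iff.2 fun f hf => ?_
    induction hf using weightFiltration_induction with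
    | hJ f hf => exact (subModel ε hε).pair_ideal x hf
    | hq s hs =>
      rw [subModel_pair]
      exact pair_eq_zero_of_mem_dualFilt hx
        (weightFiltration_mono (by omega) (subCoord_monomial_mem_dualFilt s))
    | hadd f g _ _ hf hg => rw [map_add, hf, hg, add_zero]
    | hsmul c f _ hf => rw [map_smul, hf, smul_zero]

/-! #### The elements `P^s_t` -/

variable (p) in
/-- The algebra map to the polynomial ring which sends `ξ_t` to the variable and `ξ_k` to zero for
`k ≠ t`. -/
def xiProj (t : ℕ) : 𝓢 →ₐ[ZMod p] Polynomial (ZMod p) :=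
  MvPolynomial.aeval fun k => if k + 1 = t then Polynomial.X else 0

theorem xiProj_xi_succ (t k : ℕ) :
    xiProj p t (milnorXi p (k + 1)) = if k + 1 = t then Polynomial.X else 0 := by
  rw [milnorXi, xiProj, MvPolynomial.aeval_X]

/-- The only generator surviving the projection becomes `u ^ (p ^ (d - t + 1))`, whose exponent
exceeds `p ^ i`. Hence the functional defining `P^i_t` descends to the dual of the subalgebra. -/
theorem coeff_xiProj_eq_zero {d t i : ℕ} (ht : i + t ≤ d) {f : 𝓢} (hf : f ∈ dualIdeal p d) :
    (xiProj p t f).coeff (p ^ i) = 0 := by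
  suffices h : f ∈ (Ideal.span {(Polynomial.X : Polynomial (ZMod p)) ^ (p ^ i + 1)}).comap
      (xiProj p t) by
    rw [Ideal.mem_comap, Ideal.mem_span_singleton] at h
    exact Polynomial.X_pow_dvd_iff.1 h _ (Nat.lt_succ_self _)
  refine Ideal.span_le.2 ?_ hf
  rintro _ ⟨k, rfl⟩
  rw [SetLike.mem_coe, Ideal.mem_comap, map_pow, xiProj_xi_succ]
  split_ifs with h
  · refine Ideal.mem_span_singleton.2 (pow_dvd_pow _ ?_)
    exact Nat.pow_lt_pow_right hp.out.one_lt (by omega)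
  · rw [zero_pow (pow_ne_zero _ hp.out.ne_zero)]
    exact zero_mem _

theorem xiProj_subCoord_X {d t : ℕ} (v : Root d) : xiProj p t (subCoord p d (MvPolynomial.X v))
    = if v.height = t then Polynomial.X ^ p ^ (v.1.1 : ℕ) else 0 := by
  have hv := Fin.lt_def.1 v.2
  obtain ⟨k, hk⟩ := Nat.exists_eq_add_of_lt hv
  have e1 : (v.1.2 : ℕ) - v.1.1 = k + 1 := by omega
  rw [subCoord_X, dualEntry, if_pos hv.le, e1, map_pow, xiProj_xi_succ, Root.height, e1]
  split_ifs
  · rfl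
  · exact zero_pow (pow_ne_zero _ hp.out.ne_zero)

/-- Only variables on the diagonal of `v` survive. Within the weight bound they occur alone, and the
exponent `p ^ row` then identifies the root. -/
theorem coeff_xiProj_subCoord {d : ℕ} (v : Root d) {s : Root d →₀ ℕ}
    (hs : Finsupp.weight Root.height s ≤ v.height) :
    (xiProj p v.height (subCoord p d (MvPolynomial.monomial s 1))).coeff (p ^ (v.1.1 : ℕ))
      = if s = Finsupp.single v 1 then 1 else 0 := by
  have h0 : p ^ (v.1.1 : ℕ) ≠ 0 := pow_ne_zero _ hp.out.ne_zero
  by_cases h : ∃ u ∈ s.support, u.height = v.height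
  · obtain ⟨u, hu, huv⟩ := h
    obtain rfl := eq_single_of_weight_le (v := u) (by rw [huv]; exact hs) hu
    have e1 : (xiProj p v.height (subCoord p d
        (MvPolynomial.monomial (Finsupp.single u 1) 1))).coeff (p ^ (v.1.1 : ℕ))
        = (Polynomial.X ^ p ^ (u.1.1 : ℕ) : Polynomial (ZMod p)).coeff (p ^ (v.1.1 : ℕ)) := by
      change (xiProj p v.height (subCoord p d (MvPolynomial.X u))).coeff (p ^ (v.1.1 : ℕ)) = _
      rw [xiProj_subCoord_X, if_pos huv]
    rw [e1, Polynomial.coeff_X_pow]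
    refine if_congr ⟨fun h => ?_, fun h => ?_⟩ rfl rfl
    · have h1 := Nat.pow_right_injective hp.out.two_le h
      have h2 := Fin.lt_def.1 u.2
      have h3 := Fin.lt_def.1 v.2
      simp only [Root.height] at huv
      rw [Subtype.ext (Prod.ext (Fin.ext h1.symm) (Fin.ext (by omega)) : u.1 = v.1)]
    · rw [Finsupp.single_left_injective one_ne_zero h]
  · have hne : s ≠ Finsupp.single v 1 := by
      rintro rfl
      exact h ⟨v, by simp, rfl⟩
    rw [if_neg hne]
    by_cases hs0 : s = 0
    · rw [hs0, MvPolynomial.monomial_zero', map_one, map_one, map_one, Polynomial.coeff_one,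
        if_neg h0]
    · obtain ⟨u, hu⟩ := Finsupp.support_nonempty_iff.2 hs0
      have e1 : s = Finsupp.single u 1 + (s - Finsupp.single u 1) :=
        (add_tsub_cancel_of_le (Finsupp.single_le_iff.2
          (Nat.one_le_iff_ne_zero.2 (Finsupp.mem_support_iff.1 hu)))).symm
      have e2 : (MvPolynomial.monomial s 1 : MvPolynomial (Root d) (ZMod p))
          = MvPolynomial.X u * MvPolynomial.monomial (s - Finsupp.single u 1) 1 := by
        rw [MvPolynomial.X, MvPolynomial.monomial_mul, one_mul, ← e1]
      rw [e2, map_mul, map_mul, xiProj_subCoord_X, if_neg fun hu' => h ⟨u, hu, hu'⟩, zero_mul,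
        Polynomial.coeff_zero]

/-- The element `P^s_t` is produced by perfect duality from the functional that reads off the
coefficient of `u ^ (p ^ s)` after `ξ_t ↦ u`; the same functional gives both its action on
polynomials and its role as dual of a coordinate. -/
theorem exists_isRootVector (v : Root (e + 1)) : ∃ x : steenrodSub p e,
    rho p (x : SteenrodPowers p) = milnorOp p v.height (p ^ (v.1.1 : ℕ)) ∧
    (subModel ε hε).IsRootVector v x := by
  have hv : (v.1.1 : ℕ) + v.height ≤ e + 1 := by
    have h2 := Fin.lt_def.1 v.2
    simp only [Root.height]
    omega
  obtain ⟨x, hx⟩ := (subModel ε hε).exists_pair_eq_right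
    (((Polynomial.lcoeff (ZMod p) (p ^ (v.1.1 : ℕ)))).comp (xiProj p v.height).toLinearMap)
    fun f hf => coeff_xiProj_eq_zero hv hf
  refine ⟨x, rho_eq_milnorOp (xiProj p v.height) (xiProj_xi_succ _) v.height_pos hx, ?_⟩
  intro s hs
  rw [hx]
  exact coeff_xiProj_subCoord v hs

end SteenrodPowers

end

theorem theorem1p3 (p n : ℕ) [Fact p.Prime] (hn : 2 ≤ n) :
    ∃ (ρ : SteenrodPowers p →ₐ[ZMod p] Module.End (ZMod p) (MvPolynomial ℕ (ZMod p)))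
      (H : HopfStructure (ZMod p) (SteenrodPowers p))
      (K : HopfStructure (ZMod p) (steenrodSub p (n - 2)))
      (G₁ : HopfStructure (ZMod p) (E0 (UHopf p n).counit))
      (G₂ : HopfStructure (ZMod p) (E0 K.counit))
      (Φ : E0 (UHopf p n).counit ≃ₐ[ZMod p] E0 K.counit),
      -- the standard action of the Steenrod powers on polynomials
      (∀ r, ρ (steenrodP p r) = milnorOp p 1 r) ∧ Function.Injective ρ ∧
      -- the Hopf algebra of Steenrod powers
      (∀ r, H.comul (steenrodP p r) =
        ∑ ij ∈ Finset.HasAntidiagonal.antidiagonal r, steenrodP p ij.1 ⊗ₜ[ZMod p] steenrodP p ij.2) ∧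
      -- its Hopf subalgebra, with the filtration by powers of the augmentation ideal
      K.IsHom H (steenrodSub p (n - 2)).val ∧
      (∀ (m : ℕ) (x : steenrodSub p (n - 2)),
        x ∈ augFiltration K.counit m ↔ (x : SteenrodPowers p) ∈ augFiltration H.counit m) ∧
      -- the associated graded Hopf algebras
      (UHopf p n).IsInduced G₁ ∧ K.IsInduced G₂ ∧
      -- `Φ` is an isomorphism of graded Hopf algebras
      G₁.IsHom G₂ (Φ : E0 (UHopf p n).counit →ₐ[ZMod p] E0 K.counit) ∧
      (∀ m, (E0.component (UHopf p n).counit m).map Φ.toLinearMap = E0.component K.counit m) ∧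
      -- the generators `f` correspond to the elements `P^s_t` with `s = i`, `t = j - i`,
      -- where the indices of matrix entries start at `0`
      Algebra.adjoin (ZMod p) {x | ∃ (i j : Fin n) (h : i < j)
          (hf : fElem p h ∈ augFiltration (UHopf p n).counit (j - i : ℕ)),
          x = E0.cls (UHopf p n).counit (j - i : ℕ) ⟨fElem p h, hf⟩} = ⊤ ∧
      ∀ (i j : Fin n) (h : i < j),
        ∃ (hf : fElem p h ∈ augFiltration (UHopf p n).counit (j - i : ℕ))
          (θ : augFiltration K.counit (j - i : ℕ)),
          ρ ((θ : steenrodSub p (n - 2)) : SteenrodPowers p)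
            = milnorOp p (j - i : ℕ) (p ^ (i : ℕ)) ∧
          Φ (E0.cls (UHopf p n).counit (j - i : ℕ) ⟨fElem p h, hf⟩)
            = E0.cls K.counit (j - i : ℕ) θ := by
  obtain ⟨e, rfl⟩ : ∃ e, n = e + 2 := ⟨n - 2, by omega⟩
  obtain ⟨K, hK⟩ := SteenrodPowers.exists_hopfStructure_steenrodSub p e
  have hε : ∀ x : steenrodSub p e,
      K.counit x = SteenrodPowers.counit p (x : SteenrodPowers p) := by
    intro x
    rw [hK.2.1, SteenrodPowers.hopf_counit]
    rfl
  -- With `n = e + 2`, both models use the roots of the matrices of size `d + 1 = n`, that is `d = e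
  -- + 1`.
  let M := UGroup.model p (e + 1)
  let M' := SteenrodPowers.subModel K.counit hε
  obtain ⟨Φ, hΦ, hΦ'⟩ := M.exists_algEquiv M'
  refine ⟨SteenrodPowers.rho p, SteenrodPowers.hopf p, K, (UHopf p (e + 2)).gr, K.gr, Φ,
    SteenrodPowers.rho_steenrodP, SteenrodPowers.rho_injective, ?_, hK, ?_,
    (UHopf p (e + 2)).isInduced_gr, K.isInduced_gr, ?_, hΦ, ?_, ?_⟩
  · intro r
    rw [SteenrodPowers.hopf_comul, SteenrodPowers.comul_steenrodP]
  · intro m x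
    rw [SteenrodPowers.hopf_counit]
    exact SteenrodPowers.mem_augFiltration_steenrodSub_iff hε m x
  -- Compatibility with the Hopf structures only needs that `Φ` preserves degree one.
  · refine HopfStructure.gr_isHom _ _ _ fun x => ?_
    have h : Φ (E0.cls (UHopf p (e + 2)).counit 1 x) ∈ E0.component K.counit 1 := by
      rw [← hΦ 1]
      exact ⟨_, ⟨grMk _ 1 x, rfl⟩, rfl⟩
    obtain ⟨y, hy⟩ := h
    obtain ⟨y, rfl⟩ := grMk_surjective K.counit 1 y
    exact ⟨y, hy.symm⟩
  · rw [eq_top_iff]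
    rintro z -
    -- The classes of the simple roots `(i, i + 1)` already generate.
    obtain ⟨z, rfl⟩ := M.ofFree_surjective z
    induction z using FreeAlgebra.induction with
    | grade0 c => rw [AlgHom.commutes]; exact Subalgebra.algebraMap_mem _ c
    | grade1 i =>
      have hi : ((i.succ : Fin (e + 2)) - (i.castSucc : Fin (e + 2)) : ℕ) = 1 := by
        rw [Fin.val_succ, Fin.val_castSucc]
        omega
      have hf : fElem p (Fin.castSucc_lt_succ (i := i)) ∈ augFiltration (UHopf p (e + 2)).counit
          ((i.succ : Fin (e + 2)) - (i.castSucc : Fin (e + 2)) : ℕ) := by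
        rw [hi]
        exact M.gen_mem i
      refine Algebra.subset_adjoin ⟨i.castSucc, i.succ, Fin.castSucc_lt_succ, hf, ?_⟩
      rw [RootModel.ofFree, FreeAlgebra.lift_ι_apply]
      exact E0.cls_congr hi.symm _ _ rfl
    | mul x y hx hy => rw [map_mul]; exact mul_mem hx hy
    | add x y hx hy => rw [map_add]; exact add_mem hx hy
  · intro i j h
    obtain ⟨x, hx, hx'⟩ := SteenrodPowers.exists_isRootVector hε ⟨(i, j), h⟩
    have hf := UGroup.isRootVector_fElem (p := p) h
    -- Both elements are dual to the same coordinate, so they have equal pairings in weight `j - i`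
    -- and `Φ` matches their classes.
    exact ⟨hf.mem_augFiltration, ⟨x, hx'.mem_augFiltration⟩, hx,
      hΦ' _ _ _ fun g hg => hf.pair_eq hx' hg⟩
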